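/- Let $\kappa\in\mathbb R$ and $\nu>0$ be such that $2\nu+\kappa>0$ if $\kappa\le 0$, and $2\nu/\kappa\in\{1,2,3,\dots\}$ if $\kappa>0$. Let $m\ge 0$ be an integer with $m<(2\nu+\kappa)/(|\kappa|-\kappa)$ (the bound being $+\infty$ if $\kappa\ge 0$). Let $M_\kappa=\{z\in\mathbb C: 1+\kappa|z|^2>0\}$, that is, the disc of radius $1/\sqrt{-\kappa}$ for $\kappa<0$, the plane for $\kappa=0$, and the sphere $\mathbb C\cup\{\infty\}$ without the null set $\{\infty\}$ for $\kappa>0$. Equip it with $d\mu_\kappa=(1+\kappa|z|^2)^{-2}d\lambda$, where $\lambda$ is Lebesgue measure. Put $$\mathfrak L_\kappa^\nu=-\Big\{(1+\kappa|z|^2)^2\frac{\partial^2}{\partial z\partial\bar z}+\nu(1+\kappa|z|^2)\Big(z\frac{\partial}{\partial z}-\bar z\frac{\partial}{\partial\bar z}\Big)-\nu^2|z|^2\Big\},\qquad \nabla_\alpha=-(1+\kappa|z|^2)\frac{\partial}{\partial z}+\alpha\bar z,$$ $E_{\kappa,m}^\nu=\nu(2m+1)+m(m+1)\kappa$, and let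 $$A^{2,\nu}_m(M_\kappa)=\{\Phi\in L^2(M_\kappa;d\mu_\kappa):\ \mathfrak L_\kappa^\nu\Phi=E_{\kappa,m}^\nu\Phi\}$$ be the $L^2$-eigenspace, the equation being understood in the sense of distributions on $M_\kappa$. For $n=0,1,2,\dots$ set $$\Psi_n=\nabla_{\nu+\kappa}\circ\nabla_{\nu+2\kappa}\circ\cdots\circ\nabla_{\nu+m\kappa}\big[(1+\kappa|z|^2)^{-(\nu/\kappa+m)}z^n\big],$$ where for $\kappa=0$ the factor $(1+\kappa|z|^2)^{-(\nu/\kappa+m)}$ is read as its limit $e^{-\nu|z|^2}$. Then every $\Psi_n$ is smooth on $M_\kappa$ and satisfies $\mathfrak L_\kappa^\nu\Psi_n=E_{\kappa,m}^\nu\Psi_n$ there. The function $\Psi_n$ belongs to $L^2(M_\kappa;d\mu_\kappa)$ for every $n\geq 0$ if $\kappa\le 0$, and exactly for $0\le n\le 2(\nu/\kappa+m)$ if $\kappa>0$. The square integrable functions among the $\Psi_n$ form an orthogonal basis of $A^{2,\nu}_m(M_\kappa)$: they are nonzero and pairwise orthogonal, and the closed linear span of them in $L^2(M_\kappa;d\mu_\kappa)$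 is exactly $A^{2,\nu}_m(M_\kappa)$. -/

import Mathlib

open MeasureTheory
open scoped ContDiff ComplexConjugate InnerProductSpace

noncomputable section

namespace TwistedLaplacian

/-- The conformal factor `h(z) = 1 + κ |z|²`. -/
def h (κ : ℝ) (z : ℂ) : ℝ := 1 + κ * ‖z‖ ^ 2

/-- The surface `M_κ` in the coordinate `z`: the open disc of radius `1 / √(-κ)` for `κ < 0`, the
plane for `κ = 0`, and for `κ > 0` the sphere without the point `∞`, which is a null set. -/
def surface (κ : ℝ) : Set ℂ := {z | 0 < h κ z}

/-- The volume measure `dμ_κ = (1 + κ |z|²)⁻² dλ` on `M_κ`. -/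
def vol (κ : ℝ) : Measure ℂ :=
  (volume.restrict (surface κ)).withDensity fun z => ENNReal.ofReal ((h κ z ^ 2)⁻¹)

/-- The Wirtinger derivative `∂f/∂z = (∂f/∂x - i ∂f/∂y) / 2`. -/
def dz (f : ℂ → ℂ) (z : ℂ) : ℂ :=
  (fderiv ℝ f z 1 - Complex.I * fderiv ℝ f z Complex.I) / 2

/-- The Wirtinger derivative `∂f/∂z̄ = (∂f/∂x + i ∂f/∂y) / 2`. -/
def dzbar (f : ℂ → ℂ) (z : ℂ) : ℂ :=
  (fderiv ℝ f z 1 + Complex.I * fderiv ℝ f z Complex.I) / 2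

/-- The twisted Laplacian `𝔏_κ^ν` as a differential expression. -/
def twistedLaplacian (κ ν : ℝ) (f : ℂ → ℂ) (z : ℂ) : ℂ :=
  -((h κ z : ℂ) ^ 2 * dz (dzbar f) z
    + (ν : ℂ) * (h κ z : ℂ) * (z * dz f z - conj z * dzbar f z)
    - (ν : ℂ) ^ 2 * (‖z‖ : ℂ) ^ 2 * f z)

/-- The first order operator `∇_α = -(1 + κ |z|²) ∂/∂z + α z̄`. -/
def nabla (κ α : ℝ) (f : ℂ → ℂ) (z : ℂ) : ℂ :=
  -(h κ z : ℂ) * dz f z + (α : ℂ) * conj z * f z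

/-- The composition `∇_{ν+κ} ∘ ∇_{ν+2κ} ∘ ⋯ ∘ ∇_{ν+mκ}` (the identity for `m = 0`). -/
def nablaComp (κ ν : ℝ) : ℕ → (ℂ → ℂ) → (ℂ → ℂ)
  | 0, f => f
  | m + 1, f => nablaComp κ ν m (nabla κ (ν + ((m : ℝ) + 1) * κ) f)

/-- The factor `(1 + κ |z|²)^{-(ν/κ + m)}`; for `κ = 0` this is read, as usual, as its limit
`exp (-ν |z|²)` for `κ → 0`. -/
def weight (κ ν : ℝ) (m : ℕ) (z : ℂ) : ℝ :=
  if κ = 0 then Real.exp (-ν * ‖z‖ ^ 2) else h κ z ^ (-(ν / κ + m))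

/-- The function `∇_{ν+κ} ∘ ⋯ ∘ ∇_{ν+mκ} [(1 + κ |z|²)^{-(ν/κ + m)} zⁿ]`. -/
def Psi (κ ν : ℝ) (m n : ℕ) : ℂ → ℂ :=
  nablaComp κ ν m fun z => (weight κ ν m z : ℂ) * z ^ n

/-- The eigenvalue `E_{κ,m}^ν = ν (2m + 1) + m (m + 1) κ`. -/
def eigenvalue (κ ν : ℝ) (m : ℕ) : ℝ := ν * (2 * m + 1) + m * (m + 1) * κ

/-- Test functions on `M_κ`: smooth functions with compact support contained in `M_κ`. -/
def IsTestFunction (κ : ℝ) (φ : ℂ → ℂ) : Prop :=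
  ContDiff ℝ ∞ φ ∧ HasCompactSupport φ ∧ tsupport φ ⊆ surface κ

/-- The `L²`-eigenspace of all `Φ ∈ L²(M_κ; dμ_κ)` with `𝔏_κ^ν Φ = E_{κ,m}^ν Φ`, the equation being
understood in the sense of distributions on `M_κ` (`𝔏_κ^ν` is formally symmetric with respect to
`dμ_κ`). No regularity beyond `L²` is required of `Φ`. -/
def eigenspace (κ ν : ℝ) (m : ℕ) : Set (Lp ℂ 2 (vol κ)) :=
  {Φ | ∀ φ : ℂ → ℂ, IsTestFunction κ φ →
    ∫ z, Φ z * conj (twistedLaplacian κ ν φ z) ∂(vol κ)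
      = (eigenvalue κ ν m : ℂ) * ∫ z, Φ z * conj (φ z) ∂(vol κ)}

/-- `e` is an orthogonal basis of the subset `A` of the Hilbert space `H`: its members are nonzero
and pairwise orthogonal, and the closure of their linear span is exactly `A`. -/
def IsOrthogonalBasis {H : Type*} [NormedAddCommGroup H] [InnerProductSpace ℂ H] {ι : Type*}
    (e : ι → H) (A : Set H) : Prop :=
  (∀ i, e i ≠ 0) ∧ (∀ i j, i ≠ j → ⟪e i, e j⟫_ℂ = 0) ∧
    ((Submodule.span ℂ (Set.range e)).topologicalClosure : Set H) = A

end TwistedLaplacian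

end

noncomputable section

namespace TwistedLaplacian

open Filter Topology Set

/-! ### Wirtinger calculus -/

/-! Write `A_ν = (1 + κ|z|²) ∂/∂z̄ + ν z`, `𝔏^ν` for the twisted Laplacian, `∇^(m)` for the composed
operators `∇_{ν+κ} ∘ ⋯ ∘ ∇_{ν+mκ}`, `A^(m)` for their adjoints composed in reverse order, `E` for
the eigenvalue, and `x = |z|²`. With respect to `dμ_κ` the operators `∇_{ν+κ}` and `A_ν` are formal
adjoints. They factor the Laplacian in two ways, `∇_{ν+κ} A_ν = 𝔏^ν - ν` and `A_ν ∇_{ν+κ} = 𝔏^{ν+κ}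
+ ν + κ`. Hence `∇_{ν+κ}` intertwines `𝔏^{ν+κ}` and `𝔏^ν` up to a constant, and iteration gives
`(𝔏^ν - E) ∇^(m) = ∇^(m+1) A_{ν+mκ}` (`twistedLaplacian_nablaComp`). The factor `w zⁿ` inside `Psi`
is killed by `A_{ν+mκ}`, so `Psi` solves the eigenvalue equation; applying `A^(m)` to it returns a
positive multiple of `w zⁿ`, so it is not zero.

In polar form `Psi` is `z^(n-m)` times the weight times a real polynomial in `x`. Orthogonality is
then rotation invariance, and square integrability is a matter of degrees. For `κ > 0` the recursion
of the coefficients decides it: up to the critical exponent the degree is small enough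
(`natDegree_radPoly_le_of_eq`), and beyond it all coefficients have the same sign, so that no
cancellation can help (`coeff_radPoly_sign`).

Completeness is proved without elliptic regularity. Let `Φ` be a weak eigenfunction and `k` any
integer. On test functions, `∇^(m) A^(m)` is a positive constant modulo the range of `𝔏^ν - E`,
which `Φ` annihilates. Suppose that a test function of angular momentum `k - m`, supported in an
annulus, is orthogonal to `∇^(m)(w z^k)`. Then its image under `A^(m)` is orthogonal to `w z^k`, and
solving a first order radial equation shows that this image is `∇_{ν+(m+1)κ}` of a test function of
angular momentum `k + 1`. The latter is in the range of `A_{ν+mκ}`, exactly for `k ≥ 0`, and for `k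
< 0` up to bumps that escape to the boundary. So `Φ` annihilates the original test function
(`IsWeakEigenfunction.pairing_mode_eq_zero`).

Thus on each angular momentum `Φ` is a multiple of the single function `∇^(m)(w z^k)`. If the factor
is not zero, this function must be in `L²`. That excludes `k < 0` because of the singularity at the
origin; for `k ≥ 0` the function is a member of the family, and if `Φ` is orthogonal to the family
the factor vanishes after all. A function orthogonal to all annular test functions of every angular
momentum is zero by Stone–Weierstrass (`ae_eq_zero_of_pairing_mode`). -/

theorem dz_congr {f g : ℂ → ℂ} {z : ℂ} (hfg : f =ᶠ[𝓝 z] g) : dz f z = dz g z := by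
  simp only [dz, hfg.fderiv_eq]

theorem dzbar_congr {f g : ℂ → ℂ} {z : ℂ} (hfg : f =ᶠ[𝓝 z] g) : dzbar f z = dzbar g z := by
  simp only [dzbar, hfg.fderiv_eq]

theorem dz_add {f g : ℂ → ℂ} {z : ℂ} (hf : DifferentiableAt ℝ f z) (hg : DifferentiableAt ℝ g z) :
    dz (fun w => f w + g w) z = dz f z + dz g z := by
  simp only [dz, fderiv_fun_add hf hg, add_apply]
  ring

theorem dzbar_add {f g : ℂ → ℂ} {z : ℂ} (hf : DifferentiableAt ℝ f z)
    (hg : DifferentiableAt ℝ g z) :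
    dzbar (fun w => f w + g w) z = dzbar f z + dzbar g z := by
  simp only [dzbar, fderiv_fun_add hf hg, add_apply]
  ring

theorem dz_mul {f g : ℂ → ℂ} {z : ℂ} (hf : DifferentiableAt ℝ f z) (hg : DifferentiableAt ℝ g z) :
    dz (fun w => f w * g w) z = dz f z * g z + f z * dz g z := by
  simp only [dz, fderiv_fun_mul hf hg, add_apply,
    smul_apply, smul_eq_mul]
  ring

theorem dzbar_mul {f g : ℂ → ℂ} {z : ℂ} (hf : DifferentiableAt ℝ f z)
    (hg : DifferentiableAt ℝ g z) :
    dzbar (fun w => f w * g w) z = dzbar f z * g z + f z * dzbar g z := by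
  simp only [dzbar, fderiv_fun_mul hf hg, add_apply,
    smul_apply, smul_eq_mul]
  ring

@[simp] theorem dz_const (c z : ℂ) : dz (fun _ => c) z = 0 := by simp [dz]

@[simp] theorem dzbar_const (c z : ℂ) : dzbar (fun _ => c) z = 0 := by simp [dzbar]

theorem dz_const_mul (c : ℂ) {f : ℂ → ℂ} {z : ℂ} (hf : DifferentiableAt ℝ f z) :
    dz (fun w => c * f w) z = c * dz f z := by
  rw [dz_mul (differentiableAt_const c) hf]; simp

theorem dzbar_const_mul (c : ℂ) {f : ℂ → ℂ} {z : ℂ} (hf : DifferentiableAt ℝ f z) :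
    dzbar (fun w => c * f w) z = c * dzbar f z := by
  rw [dzbar_mul (differentiableAt_const c) hf]; simp

@[simp] theorem dz_id (z : ℂ) : dz (fun w => w) z = 1 := by
  simp [dz]

@[simp] theorem dzbar_id (z : ℂ) : dzbar (fun w => w) z = 0 := by
  simp [dzbar]

theorem hasFDerivAt_conj (z : ℂ) :
    HasFDerivAt (fun w : ℂ => conj w) (Complex.conjCLE : ℂ →L[ℝ] ℂ) z :=
  Complex.conjCLE.hasFDerivAt

@[simp] theorem dz_conj (z : ℂ) : dz (fun w => conj w) z = 0 := by
  simp [dz, (hasFDerivAt_conj z).fderiv]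

@[simp] theorem dzbar_conj (z : ℂ) : dzbar (fun w => conj w) z = 1 := by
  simp [dzbar, (hasFDerivAt_conj z).fderiv]

theorem contDiff_conj {n : WithTop ℕ∞} : ContDiff ℝ n (fun w : ℂ => conj w) :=
  Complex.conjCLE.contDiff

theorem dz_comp_conj {f : ℂ → ℂ} {z : ℂ} (hf : DifferentiableAt ℝ f z) :
    dz (fun w => conj (f w)) z = conj (dzbar f z) := by
  have := ((hasFDerivAt_conj (f z)).comp z hf.hasFDerivAt).fderiv
  simp only [Function.comp_def] at this
  simp [dz, dzbar, this, map_ofNat, sub_eq_add_neg]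

theorem dzbar_comp_conj {f : ℂ → ℂ} {z : ℂ} (hf : DifferentiableAt ℝ f z) :
    dzbar (fun w => conj (f w)) z = conj (dz f z) := by
  have := ((hasFDerivAt_conj (f z)).comp z hf.hasFDerivAt).fderiv
  simp only [Function.comp_def] at this
  simp [dz, dzbar, this, map_ofNat, sub_eq_add_neg]

theorem ofReal_h (κ : ℝ) (z : ℂ) : (h κ z : ℂ) = 1 + κ * (z * conj z) := by
  simp [h, Complex.mul_conj, Complex.normSq_eq_norm_sq]

theorem contDiff_h {n : WithTop ℕ∞} (κ : ℝ) : ContDiff ℝ n (h κ) := by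
  unfold h
  exact contDiff_const.add (contDiff_const.mul (contDiff_norm_sq ℝ))

theorem contDiff_ofReal_h {n : WithTop ℕ∞} (κ : ℝ) : ContDiff ℝ n (fun z => (h κ z : ℂ)) :=
  Complex.ofRealCLM.contDiff.comp (contDiff_h κ)

theorem differentiable_ofReal_h (κ : ℝ) : Differentiable ℝ (fun z => (h κ z : ℂ)) :=
  (contDiff_ofReal_h (n := 1) κ).differentiable (by simp)

theorem differentiable_conj : Differentiable ℝ (fun w : ℂ => conj w) :=
  (contDiff_conj (n := 1)).differentiable (by simp)

@[simp] theorem dz_h (κ : ℝ) (z : ℂ) : dz (fun w => (h κ w : ℂ)) z = κ * conj z := by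
  simp only [ofReal_h]
  have hd : DifferentiableAt ℝ (fun w : ℂ => w * conj w) z :=
    differentiableAt_fun_id.fun_mul (differentiable_conj z)
  rw [dz_add (differentiableAt_const _) (hd.const_mul _), dz_const_mul _ hd,
    dz_mul differentiableAt_fun_id (differentiable_conj z)]
  simp

@[simp] theorem dzbar_h (κ : ℝ) (z : ℂ) : dzbar (fun w => (h κ w : ℂ)) z = κ * z := by
  simp only [ofReal_h]
  have hd : DifferentiableAt ℝ (fun w : ℂ => w * conj w) z :=
    differentiableAt_fun_id.fun_mul (differentiable_conj z)
  rw [dzbar_add (differentiableAt_const _) (hd.const_mul _), dzbar_const_mul _ hd,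
    dzbar_mul differentiableAt_fun_id (differentiable_conj z)]
  simp

theorem contDiffOn_dz {f : ℂ → ℂ} {U : Set ℂ} (hf : ContDiffOn ℝ ∞ f U) (hU : IsOpen U) :
    ContDiffOn ℝ ∞ (dz f) U := by
  have h1 : ContDiffOn ℝ ∞ (fderiv ℝ f) U := hf.fderiv_of_isOpen hU (by simp)
  unfold dz
  exact ((h1.clm_apply contDiffOn_const).sub
    (contDiffOn_const.mul (h1.clm_apply contDiffOn_const))).div_const _

theorem contDiffOn_dzbar {f : ℂ → ℂ} {U : Set ℂ} (hf : ContDiffOn ℝ ∞ f U) (hU : IsOpen U) :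
    ContDiffOn ℝ ∞ (dzbar f) U := by
  have h1 : ContDiffOn ℝ ∞ (fderiv ℝ f) U := hf.fderiv_of_isOpen hU (by simp)
  unfold dzbar
  exact ((h1.clm_apply contDiffOn_const).add
    (contDiffOn_const.mul (h1.clm_apply contDiffOn_const))).div_const _

theorem dzbar_dz {f : ℂ → ℂ} {z : ℂ} (hf : ContDiffAt ℝ ∞ f z) :
    dzbar (dz f) z = dz (dzbar f) z := by
  have hs : IsSymmSndFDerivAt ℝ f z := hf.isSymmSndFDerivAt (by simp; norm_cast)
  have hd : DifferentiableAt ℝ (fderiv ℝ f) z :=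
    (hf.fderiv_right (m := 1) (by norm_cast)).differentiableAt (by simp)
  have hv : ∀ v : ℂ, HasFDerivAt (fun w => fderiv ℝ f w v)
      ((fderiv ℝ (fderiv ℝ f) z).flip v) z := fun v => by
    simpa using hd.hasFDerivAt.clm_apply (hasFDerivAt_const v z)
  have h1 : HasFDerivAt (dz f) ((2 : ℂ)⁻¹ • ((fderiv ℝ (fderiv ℝ f) z).flip 1
      - Complex.I • (fderiv ℝ (fderiv ℝ f) z).flip Complex.I)) z := by
    have := ((hv 1).fun_sub ((hv Complex.I).const_mul Complex.I)).const_mul (2 : ℂ)⁻¹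
    refine this.congr_of_eventuallyEq (Eventually.of_forall fun w => ?_)
    simp [dz, div_eq_inv_mul]
  have h2 : HasFDerivAt (dzbar f) ((2 : ℂ)⁻¹ • ((fderiv ℝ (fderiv ℝ f) z).flip 1
      + Complex.I • (fderiv ℝ (fderiv ℝ f) z).flip Complex.I)) z := by
    have := ((hv 1).fun_add ((hv Complex.I).const_mul Complex.I)).const_mul (2 : ℂ)⁻¹
    refine this.congr_of_eventuallyEq (Eventually.of_forall fun w => ?_)
    simp [dzbar, div_eq_inv_mul]
  have e := hs.eq 1 Complex.I
  rw [dz, dzbar, h1.fderiv, h2.fderiv]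
  simp only [smul_apply, sub_apply,
    add_apply, ContinuousLinearMap.flip_apply, smul_eq_mul, e]
  ring

/-! ### The ladder -/

/-- The first order operator `(1 + κ |z|²) ∂/∂z̄ + ν z`, the formal adjoint of `∇_{ν+κ}`. -/
def lower (κ ν : ℝ) (f : ℂ → ℂ) (z : ℂ) : ℂ :=
  (h κ z : ℂ) * dzbar f z + (ν : ℂ) * z * f z

/-- The composition of the adjoints of `∇_{ν+mκ}, …, ∇_{ν+κ}`, the last one being applied first. -/
def lowerComp (κ : ℝ) : ℝ → ℕ → (ℂ → ℂ) → (ℂ → ℂ)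
  | _, 0, f => f
  | ν, m + 1, f => lowerComp κ (ν + κ) m (lower κ ν f)

theorem contDiffOn_nabla {f : ℂ → ℂ} {U : Set ℂ} (hf : ContDiffOn ℝ ∞ f U) (hU : IsOpen U)
    (κ α : ℝ) : ContDiffOn ℝ ∞ (nabla κ α f) U := by
  unfold nabla
  exact ((contDiff_ofReal_h κ).contDiffOn.neg.mul (contDiffOn_dz hf hU)).add
    ((contDiffOn_const.mul contDiff_conj.contDiffOn).mul hf)

theorem contDiffOn_lower {f : ℂ → ℂ} {U : Set ℂ} (hf : ContDiffOn ℝ ∞ f U) (hU : IsOpen U)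
    (κ ν : ℝ) : ContDiffOn ℝ ∞ (lower κ ν f) U := by
  unfold lower
  exact ((contDiff_ofReal_h κ).contDiffOn.mul (contDiffOn_dzbar hf hU)).add
    ((contDiffOn_const.mul contDiffOn_id).mul hf)

theorem contDiffOn_nablaComp {U : Set ℂ} (hU : IsOpen U) (κ ν : ℝ) (m : ℕ) {f : ℂ → ℂ}
    (hf : ContDiffOn ℝ ∞ f U) : ContDiffOn ℝ ∞ (nablaComp κ ν m f) U := by
  induction m generalizing f with
  | zero => exact hf
  | succ m ih => exact ih (contDiffOn_nabla hf hU _ _)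

theorem differentiableAt_of_contDiffOn {f : ℂ → ℂ} {U : Set ℂ} (hf : ContDiffOn ℝ ∞ f U)
    (hU : IsOpen U) {z : ℂ} (hz : z ∈ U) : DifferentiableAt ℝ f z :=
  (hf.contDiffAt (hU.mem_nhds hz)).differentiableAt (by simp)

theorem nabla_congr {κ α : ℝ} {f g : ℂ → ℂ} {U : Set ℂ} (hU : IsOpen U) (hfg : EqOn f g U) :
    EqOn (nabla κ α f) (nabla κ α g) U := fun z hz => by
  simp only [nabla, dz_congr (hfg.eventuallyEq_of_mem (hU.mem_nhds hz)), hfg hz]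

theorem lower_congr {κ α : ℝ} {f g : ℂ → ℂ} {U : Set ℂ} (hU : IsOpen U) (hfg : EqOn f g U) :
    EqOn (lower κ α f) (lower κ α g) U := fun z hz => by
  simp only [lower, dzbar_congr (hfg.eventuallyEq_of_mem (hU.mem_nhds hz)), hfg hz]

theorem nablaComp_congr {κ ν : ℝ} {U : Set ℂ} (hU : IsOpen U) (m : ℕ) {f g : ℂ → ℂ}
    (hfg : EqOn f g U) : EqOn (nablaComp κ ν m f) (nablaComp κ ν m g) U := by
  induction m generalizing f g with
  | zero => exact hfg
  | succ m ih => exact ih (nabla_congr hU hfg)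

theorem lowerComp_congr {κ : ℝ} {U : Set ℂ} (hU : IsOpen U) (m : ℕ) {ν : ℝ} {f g : ℂ → ℂ}
    (hfg : EqOn f g U) : EqOn (lowerComp κ ν m f) (lowerComp κ ν m g) U := by
  induction m generalizing f g ν with
  | zero => exact hfg
  | succ m ih => exact ih (lower_congr hU hfg)

theorem nabla_add (κ α : ℝ) {f g : ℂ → ℂ} {z : ℂ} (hf : DifferentiableAt ℝ f z)
    (hg : DifferentiableAt ℝ g z) :
    nabla κ α (fun w => f w + g w) z = nabla κ α f z + nabla κ α g z := by
  simp only [nabla, dz_add hf hg]; ring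

theorem nabla_const_mul (κ α : ℝ) (c : ℂ) {f : ℂ → ℂ} {z : ℂ} (hf : DifferentiableAt ℝ f z) :
    nabla κ α (fun w => c * f w) z = c * nabla κ α f z := by
  simp only [nabla, dz_const_mul c hf]; ring

theorem lower_const_mul (κ α : ℝ) (c : ℂ) {f : ℂ → ℂ} {z : ℂ} (hf : DifferentiableAt ℝ f z) :
    lower κ α (fun w => c * f w) z = c * lower κ α f z := by
  simp only [lower, dzbar_const_mul c hf]; ring

theorem nablaComp_add {U : Set ℂ} (hU : IsOpen U) (κ ν : ℝ) (m : ℕ) {f g : ℂ → ℂ}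
    (hf : ContDiffOn ℝ ∞ f U) (hg : ContDiffOn ℝ ∞ g U) :
    EqOn (nablaComp κ ν m fun w => f w + g w)
      (fun z => nablaComp κ ν m f z + nablaComp κ ν m g z) U := by
  induction m generalizing f g with
  | zero => exact fun z _ => rfl
  | succ m ih =>
    refine (nablaComp_congr hU m fun z hz => nabla_add _ _
      (differentiableAt_of_contDiffOn hf hU hz) (differentiableAt_of_contDiffOn hg hU hz)).trans ?_
    exact ih (contDiffOn_nabla hf hU _ _) (contDiffOn_nabla hg hU _ _)

theorem nablaComp_const_mul {U : Set ℂ} (hU : IsOpen U) (κ ν : ℝ) (m : ℕ) (c : ℂ) {f : ℂ → ℂ}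
    (hf : ContDiffOn ℝ ∞ f U) :
    EqOn (nablaComp κ ν m fun w => c * f w) (fun z => c * nablaComp κ ν m f z) U := by
  induction m generalizing f with
  | zero => exact fun z _ => rfl
  | succ m ih =>
    refine (nablaComp_congr hU m fun z hz => nabla_const_mul _ _ c
      (differentiableAt_of_contDiffOn hf hU hz)).trans ?_
    exact ih (contDiffOn_nabla hf hU _ _)

/-- The recursion in the definition splits off the innermost operator. Splitting off the outermost
one leaves a composition with `ν` shifted to `ν + κ`, the form that the intertwining relation needs
in inductions on `m`. -/
theorem nablaComp_succ (κ ν : ℝ) (m : ℕ) (f : ℂ → ℂ) :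
    nablaComp κ ν (m + 1) f = nabla κ (ν + κ) (nablaComp κ (ν + κ) m f) := by
  induction m generalizing f with
  | zero => simp [nablaComp]
  | succ m ih =>
    rw [nablaComp, ih, nablaComp]
    congr 3
    push_cast; ring

theorem norm_sq_eq (z : ℂ) : (‖z‖ : ℂ) ^ 2 = z * conj z := by
  simp [Complex.mul_conj, Complex.normSq_eq_norm_sq]

/-- `𝔏^ν = ∇_{ν+κ} A_ν + ν`. -/
theorem nabla_lower (κ ν : ℝ) {f : ℂ → ℂ} {U : Set ℂ} (hU : IsOpen U)
    (hf : ContDiffOn ℝ ∞ f U) {z : ℂ} (hz : z ∈ U) :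
    nabla κ (ν + κ) (lower κ ν f) z = twistedLaplacian κ ν f z - ν * f z := by
  have d0 := differentiableAt_of_contDiffOn hf hU hz
  have d1 := differentiableAt_of_contDiffOn (contDiffOn_dzbar hf hU) hU hz
  have dh := differentiable_ofReal_h κ z
  have e : dz (lower κ ν f) z = κ * conj z * dzbar f z + h κ z * dz (dzbar f) z
      + (ν * f z + ν * z * dz f z) := by
    unfold lower
    rw [dz_add (dh.fun_mul d1) ((differentiableAt_fun_id.const_mul _).fun_mul d0), dz_mul dh d1,
      dz_mul (differentiableAt_fun_id.const_mul _) d0, dz_const_mul _ differentiableAt_fun_id]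
    simp
  rw [nabla, e, twistedLaplacian, lower, norm_sq_eq, ofReal_h]
  push_cast; ring

/-- `A_ν ∇_{ν+κ} = 𝔏^{ν+κ} + ν + κ`. -/
theorem lower_nabla (κ ν : ℝ) {f : ℂ → ℂ} {U : Set ℂ} (hU : IsOpen U)
    (hf : ContDiffOn ℝ ∞ f U) {z : ℂ} (hz : z ∈ U) :
    lower κ ν (nabla κ (ν + κ) f) z
      = twistedLaplacian κ (ν + κ) f z + ((ν + κ : ℝ) : ℂ) * f z := by
  have d0 := differentiableAt_of_contDiffOn hf hU hz
  have d1 := differentiableAt_of_contDiffOn (contDiffOn_dz hf hU) hU hz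
  have dh := differentiable_ofReal_h κ z
  have dc := differentiable_conj z
  have e : dzbar (nabla κ (ν + κ) f) z = -(κ * z) * dz f z - h κ z * dz (dzbar f) z
      + (((ν + κ : ℝ) : ℂ) * f z + ((ν + κ : ℝ) : ℂ) * conj z * dzbar f z) := by
    have hn : dzbar (fun w => -(h κ w : ℂ)) z = -(κ * z) := by
      have := dzbar_const_mul (-1) dh
      simpa using this
    unfold nabla
    rw [dzbar_add (dh.fun_neg.fun_mul d1) ((dc.const_mul _).fun_mul d0), dzbar_mul dh.fun_neg d1,
      dzbar_mul (dc.const_mul _) d0, dzbar_const_mul _ dc,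
      dzbar_dz (hf.contDiffAt (hU.mem_nhds hz)), hn]
    simp; ring
  rw [lower, e, twistedLaplacian, nabla, norm_sq_eq, ofReal_h]
  push_cast; ring

theorem contDiffOn_twistedLaplacian {f : ℂ → ℂ} {U : Set ℂ} (hf : ContDiffOn ℝ ∞ f U)
    (hU : IsOpen U) (κ ν : ℝ) : ContDiffOn ℝ ∞ (twistedLaplacian κ ν f) U :=
  ((contDiffOn_nabla (contDiffOn_lower hf hU κ ν) hU κ (ν + κ)).add
    (contDiffOn_const.mul hf)).congr fun z hz => by
      change _ = nabla κ (ν + κ) (lower κ ν f) z + (ν : ℂ) * f z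
      rw [nabla_lower κ ν hU hf hz]; ring

/-- `𝔏^ν ∇_{ν+κ} = ∇_{ν+κ} (𝔏^{ν+κ} + 2ν + κ)`. -/
theorem twistedLaplacian_nabla (κ ν : ℝ) {f : ℂ → ℂ} {U : Set ℂ} (hU : IsOpen U)
    (hf : ContDiffOn ℝ ∞ f U) {z : ℂ} (hz : z ∈ U) :
    twistedLaplacian κ ν (nabla κ (ν + κ) f) z
      = nabla κ (ν + κ) (twistedLaplacian κ (ν + κ) f) z
        + ((2 * ν + κ : ℝ) : ℂ) * nabla κ (ν + κ) f z := by
  have h1 := nabla_lower κ ν hU (contDiffOn_nabla hf hU κ (ν + κ)) hz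
  rw [nabla_congr hU (fun w hw => lower_nabla κ ν hU hf hw) hz,
    nabla_add _ _ (differentiableAt_of_contDiffOn (contDiffOn_twistedLaplacian hf hU _ _) hU hz)
      ((differentiableAt_of_contDiffOn hf hU hz).const_mul _),
    nabla_const_mul _ _ _ (differentiableAt_of_contDiffOn hf hU hz)] at h1
  push_cast at h1 ⊢
  linear_combination -h1

theorem eigenvalue_succ (κ ν : ℝ) (m : ℕ) :
    eigenvalue κ ν (m + 1) = eigenvalue κ (ν + κ) m + (2 * ν + κ) := by
  simp only [eigenvalue]; push_cast; ring

theorem eigenvalue_zero (κ ν : ℝ) : eigenvalue κ ν 0 = ν := by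
  simp [eigenvalue]

/-- `(𝔏^ν - E_m^ν) ∇^{(m)} = ∇^{(m)} ∇_{ν+(m+1)κ} A_{ν+mκ}`. -/
theorem twistedLaplacian_nablaComp (κ : ℝ) {U : Set ℂ} (hU : IsOpen U) {f : ℂ → ℂ}
    (hf : ContDiffOn ℝ ∞ f U) (m : ℕ) (ν : ℝ) {z : ℂ} (hz : z ∈ U) :
    twistedLaplacian κ ν (nablaComp κ ν m f) z
        - (eigenvalue κ ν m : ℂ) * nablaComp κ ν m f z
      = nablaComp κ ν m (nabla κ (ν + m * κ + κ) (lower κ (ν + m * κ) f)) z := by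
  induction m generalizing ν z with
  | zero => simp [nablaComp, eigenvalue_zero, nabla_lower κ ν hU hf hz]
  | succ m ih =>
    have hc := contDiffOn_nablaComp hU κ (ν + κ) m hf
    have hd := differentiableAt_of_contDiffOn hc hU hz
    have e := nabla_congr (κ := κ) (α := ν + κ) hU (fun w hw => (ih (ν + κ) hw).symm) hz
    rw [nablaComp_succ, nablaComp_succ]
    have e3 : ν + κ + m * κ = ν + ((m + 1 : ℕ) : ℝ) * κ := by push_cast; ring
    rw [e3] at e
    rw [e]
    have e2 := nabla_add κ (ν + κ)
      (differentiableAt_of_contDiffOn (contDiffOn_twistedLaplacian hc hU κ (ν + κ)) hU hz)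
      (hd.const_mul (-(eigenvalue κ (ν + κ) m : ℂ)))
    simp only [neg_mul, ← sub_eq_add_neg] at e2
    rw [e2]
    have e4 := nabla_const_mul κ (ν + κ) (-(eigenvalue κ (ν + κ) m : ℂ)) hd
    simp only [neg_mul] at e4
    rw [e4, twistedLaplacian_nabla κ ν hU hc hz, eigenvalue_succ]
    push_cast; ring

/-! ### Test functions and the volume measure -/

theorem isOpen_surface (κ : ℝ) : IsOpen (surface κ) :=
  isOpen_lt continuous_const (contDiff_h (n := 0) κ).continuous

theorem zero_mem_surface (κ : ℝ) : (0 : ℂ) ∈ surface κ := by simp [surface, h]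

theorem ofReal_h_ne_zero {κ : ℝ} {z : ℂ} (hz : z ∈ surface κ) : (h κ z : ℂ) ≠ 0 :=
  Complex.ofReal_ne_zero.2 (ne_of_gt hz)

theorem measurable_density (κ : ℝ) :
    Measurable fun z => ENNReal.ofReal ((h κ z ^ 2)⁻¹) :=
  ((((contDiff_h (n := 0) κ).continuous.measurable.pow_const 2).inv).ennreal_ofReal :)

theorem integral_vol (κ : ℝ) (f : ℂ → ℂ) :
    ∫ z, f z ∂(vol κ) = ∫ z in surface κ, ((h κ z : ℂ) ^ 2)⁻¹ * f z := by
  unfold vol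
  rw [integral_withDensity_eq_integral_toReal_smul
    (measurable_density κ)
    (Eventually.of_forall fun _ => ENNReal.ofReal_lt_top)]
  refine integral_congr_ae (Eventually.of_forall fun z => ?_)
  simp only [ENNReal.toReal_ofReal (inv_nonneg.2 (sq_nonneg (h κ z))), Complex.real_smul]
  push_cast; rfl

theorem vol_absolutelyContinuous (κ : ℝ) : vol κ ≪ volume :=
  (withDensity_absolutelyContinuous _ _).trans Measure.restrict_le_self.absolutelyContinuous

theorem ae_vol_mem_surface (κ : ℝ) : ∀ᵐ z ∂(vol κ), z ∈ surface κ :=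
  (withDensity_absolutelyContinuous _ _).ae_le
    (ae_restrict_mem (isOpen_surface κ).measurableSet)

theorem ae_vol_ne_zero (κ : ℝ) : ∀ᵐ z ∂(vol κ), z ≠ 0 :=
  (vol_absolutelyContinuous κ).ae_le (Measure.ae_ne volume 0)

theorem vol_lt_top_of_isCompact {κ : ℝ} {K : Set ℂ} (hK : IsCompact K) (hKs : K ⊆ surface κ) :
    vol κ K < ⊤ := by
  have h1 : IntegrableOn (fun z => (h κ z ^ 2)⁻¹) K :=
    ContinuousOn.integrableOn_compact hK
      (((contDiff_h (n := 0) κ).continuous.continuousOn.pow 2).inv₀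
        fun z hz => pow_ne_zero 2 (ne_of_gt (hKs hz)))
  rw [vol, withDensity_apply _ hK.measurableSet]
  refine lt_of_le_of_lt (lintegral_mono' (Measure.restrict_mono le_rfl Measure.restrict_le_self)
    le_rfl) ?_
  exact h1.lintegral_lt_top

theorem memLp_indicator_of_isCompact {κ : ℝ} {K : Set ℂ} (hK : IsCompact K)
    (hKs : K ⊆ surface κ) {f : ℂ → ℂ} (hf : ContinuousOn f K) (p : ENNReal) :
    MemLp (K.indicator f) p (vol κ) := by
  rw [memLp_indicator_iff_restrict hK.measurableSet]
  have : IsFiniteMeasure ((vol κ).restrict K) :=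
    ⟨by rw [Measure.restrict_apply_univ]; exact vol_lt_top_of_isCompact hK hKs⟩
  obtain ⟨C, hC⟩ := hK.exists_bound_of_continuousOn hf
  exact MemLp.of_bound (hf.aestronglyMeasurable hK.measurableSet) C
    ((ae_restrict_iff' hK.measurableSet).2 (Eventually.of_forall hC))

theorem memLp_of_hasCompactSupport {κ : ℝ} {f : ℂ → ℂ} (hf : Continuous f)
    (hc : HasCompactSupport f) (hs : tsupport f ⊆ surface κ) (p : ENNReal) :
    MemLp f p (vol κ) := by
  have := memLp_indicator_of_isCompact hc hs hf.continuousOn p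
  rwa [indicator_eq_self.2 (subset_tsupport f)] at this

theorem IsTestFunction.memLp {κ : ℝ} {φ : ℂ → ℂ} (hφ : IsTestFunction κ φ) (p : ENNReal) :
    MemLp φ p (vol κ) :=
  memLp_of_hasCompactSupport hφ.1.continuous hφ.2.1 hφ.2.2 p

theorem IsTestFunction.of_eq_zero {κ : ℝ} {φ ψ : ℂ → ℂ} (hφ : IsTestFunction κ φ)
    (hψ : ContDiff ℝ ∞ ψ) (h0 : ∀ z, z ∉ tsupport φ → ψ z = 0) :
    IsTestFunction κ ψ ∧ tsupport ψ ⊆ tsupport φ := by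
  have hs : tsupport ψ ⊆ tsupport φ :=
    closure_minimal (fun z hz => by_contra fun hn => hz (h0 z hn)) (isClosed_tsupport φ)
  exact ⟨⟨hψ, hφ.2.1.of_isClosed_subset (isClosed_tsupport ψ) hs, hs.trans hφ.2.2⟩, hs⟩

theorem fderiv_eq_zero_of_notMem_tsupport {φ : ℂ → ℂ} {z : ℂ} (hz : z ∉ tsupport φ) :
    fderiv ℝ φ z = 0 :=
  (HasFDerivAt.of_notMem_tsupport ℝ hz).fderiv

theorem IsTestFunction.nabla' {κ : ℝ} {φ : ℂ → ℂ} (hφ : IsTestFunction κ φ) (κ' α : ℝ) :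
    IsTestFunction κ (nabla κ' α φ) ∧ tsupport (nabla κ' α φ) ⊆ tsupport φ :=
  hφ.of_eq_zero (contDiffOn_univ.1 (contDiffOn_nabla hφ.1.contDiffOn isOpen_univ κ' α))
    fun z hz => by
      simp [nabla, dz, fderiv_eq_zero_of_notMem_tsupport hz, image_eq_zero_of_notMem_tsupport hz]

theorem IsTestFunction.nabla {κ : ℝ} {φ : ℂ → ℂ} (hφ : IsTestFunction κ φ) (κ' α : ℝ) :
    IsTestFunction κ (nabla κ' α φ) := (hφ.nabla' κ' α).1

theorem IsTestFunction.lower' {κ : ℝ} {φ : ℂ → ℂ} (hφ : IsTestFunction κ φ) (κ' α : ℝ) :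
    IsTestFunction κ (lower κ' α φ) ∧ tsupport (lower κ' α φ) ⊆ tsupport φ :=
  hφ.of_eq_zero (contDiffOn_univ.1 (contDiffOn_lower hφ.1.contDiffOn isOpen_univ κ' α))
    fun z hz => by
      simp [lower, dzbar, fderiv_eq_zero_of_notMem_tsupport hz,
        image_eq_zero_of_notMem_tsupport hz]

theorem IsTestFunction.lower {κ : ℝ} {φ : ℂ → ℂ} (hφ : IsTestFunction κ φ) (κ' α : ℝ) :
    IsTestFunction κ (lower κ' α φ) := (hφ.lower' κ' α).1

theorem IsTestFunction.nablaComp {κ : ℝ} (κ' ν : ℝ) (m : ℕ) {φ : ℂ → ℂ}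
    (hφ : IsTestFunction κ φ) : IsTestFunction κ (nablaComp κ' ν m φ) := by
  induction m generalizing φ with
  | zero => exact hφ
  | succ m ih => exact ih (hφ.nabla _ _)

theorem IsTestFunction.add {κ : ℝ} {φ ψ : ℂ → ℂ} (hφ : IsTestFunction κ φ)
    (hψ : IsTestFunction κ ψ) : IsTestFunction κ (fun z => φ z + ψ z) := by
  refine ⟨hφ.1.add hψ.1, hφ.2.1.add hψ.2.1, (tsupport_add φ ψ).trans ?_⟩
  exact union_subset hφ.2.2 hψ.2.2

theorem IsTestFunction.const_mul {κ : ℝ} {φ : ℂ → ℂ} (hφ : IsTestFunction κ φ) (c : ℂ) :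
    IsTestFunction κ (fun z => c * φ z) :=
  (hφ.of_eq_zero (contDiff_const.mul hφ.1) fun z hz => by
    simp [image_eq_zero_of_notMem_tsupport hz]).1

theorem twistedLaplacian_eq (κ ν : ℝ) {φ : ℂ → ℂ} (hφ : ContDiff ℝ ∞ φ) (z : ℂ) :
    twistedLaplacian κ ν φ z = nabla κ (ν + κ) (lower κ ν φ) z + ν * φ z := by
  rw [nabla_lower κ ν isOpen_univ hφ.contDiffOn (mem_univ z)]; ring

theorem IsTestFunction.twistedLaplacian {κ : ℝ} {φ : ℂ → ℂ} (hφ : IsTestFunction κ φ) (ν : ℝ) :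
    IsTestFunction κ (twistedLaplacian κ ν φ) := by
  rw [funext (twistedLaplacian_eq κ ν hφ.1)]
  exact ((hφ.lower κ ν).nabla κ (ν + κ)).add (hφ.const_mul _)

/-! ### Integration by parts -/

theorem integral_dz_eq_zero {F : ℂ → ℂ} (hF : ContDiff ℝ ∞ F) (hc : HasCompactSupport F) :
    ∫ z, dz F z = 0 := by
  have hi : ∀ v : ℂ, Integrable (fun z => fderiv ℝ F z v) := fun v =>
    ((hF.continuous_fderiv (by simp)).clm_apply continuous_const).integrable_of_hasCompactSupport
      (hc.fderiv_apply ℝ v)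
  have h0 : ∀ v : ℂ, ∫ z, fderiv ℝ F z v = 0 := fun v => by
    have := integral_mul_fderiv_eq_neg_fderiv_mul_of_integrable (μ := (volume : Measure ℂ))
      (f := fun _ : ℂ => (1 : ℂ)) (g := F) (v := v) (by simp) (by simpa using hi v)
      (by simpa using hF.continuous.integrable_of_hasCompactSupport hc)
      (fun x _ => differentiableAt_const _)
      (fun x _ => hF.differentiable (by simp) x)
    simpa using this
  unfold dz
  rw [integral_div, integral_sub (hi 1) ((hi Complex.I).const_mul _), integral_const_mul, h0, h0]
  simp

/-- Only smoothness of `f` near the support of `φ` matters. The open set `U` will be `M_κ` or `M_κ`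
without the origin; the second choice admits negative powers of `z`. -/
theorem contDiff_mul_conj {f φ : ℂ → ℂ} {U : Set ℂ} (hU : IsOpen U) (hf : ContDiffOn ℝ ∞ f U)
    (hφ : ContDiff ℝ ∞ φ) (hs : tsupport φ ⊆ U) : ContDiff ℝ ∞ (fun z => f z * conj (φ z)) := by
  rw [contDiff_iff_contDiffAt]
  intro z
  by_cases hz : z ∈ tsupport φ
  · exact (hf.contDiffAt (hU.mem_nhds (hs hz))).mul (contDiff_conj.comp hφ).contDiffAt
  · refine (contDiffAt_const (c := (0 : ℂ))).congr_of_eventuallyEq ?_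
    filter_upwards [notMem_tsupport_iff_eventuallyEq.1 hz] with w hw
    simp [hw]

theorem tsupport_mul_conj_subset (f φ : ℂ → ℂ) :
    tsupport (fun z => f z * conj (φ z)) ⊆ tsupport φ :=
  closure_mono fun z hz hn => hz (by simp [hn])

theorem integrable_mul_conj {κ : ℝ} {f φ : ℂ → ℂ} {U : Set ℂ} (hU : IsOpen U)
    (hf : ContDiffOn ℝ ∞ f U) (hφ : IsTestFunction κ φ) (hs : tsupport φ ⊆ U) :
    Integrable (fun z => f z * conj (φ z)) (vol κ) :=
  memLp_one_iff_integrable.1 <| memLp_of_hasCompactSupport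
    (contDiff_mul_conj hU hf hφ.1 hs).continuous
    (hφ.2.1.of_isClosed_subset (isClosed_tsupport _) (tsupport_mul_conj_subset f φ))
    ((tsupport_mul_conj_subset f φ).trans hφ.2.2) 1

/-- The hypothesis on `g` says that `h⁻² g = -∂(h⁻¹ f φ̄)/∂z`, a total derivative of a compactly
supported function. The term `κ z̄` comes from differentiating `h⁻¹`. -/
theorem integral_vol_eq_zero_of_dz {κ : ℝ} {f φ g : ℂ → ℂ} {U : Set ℂ} (hU : IsOpen U)
    (hUs : U ⊆ surface κ) (hf : ContDiffOn ℝ ∞ f U) (hφ : ContDiff ℝ ∞ φ)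
    (hc : HasCompactSupport φ) (hs : tsupport φ ⊆ U)
    (hg : ∀ z ∈ U, g z = κ * conj z * (f z * conj (φ z))
      - h κ z * (dz f z * conj (φ z) + f z * conj (dzbar φ z)))
    (hg0 : ∀ z, z ∉ tsupport φ → g z = 0) :
    ∫ z, g z ∂(vol κ) = 0 := by
  set u : ℂ → ℂ := fun z => (h κ z : ℂ)⁻¹ * f z with hu
  have hus : ContDiffOn ℝ ∞ u U :=
    ((contDiff_ofReal_h κ).contDiffOn.inv fun z hz => ofReal_h_ne_zero (hUs hz)).mul hf
  set F : ℂ → ℂ := fun z => u z * conj (φ z)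
  have hF := contDiff_mul_conj hU hus hφ hs
  have hFs := tsupport_mul_conj_subset u φ
  have key : ∀ z ∈ surface κ, ((h κ z : ℂ) ^ 2)⁻¹ * g z = -dz F z := by
    intro z hzs
    have hz0 := ofReal_h_ne_zero hzs
    by_cases hz : z ∈ tsupport φ
    · have hzU := hs hz
      have d1 := hF.differentiable (by simp) z
      have e1 : dz (fun w => f w * conj (φ w)) z = dz (fun w => (h κ w : ℂ) * F w) z := by
        refine dz_congr ?_
        filter_upwards [hU.mem_nhds hzU] with w hw
        have := ofReal_h_ne_zero (hUs hw)
        simp only [F, u]; field_simp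
      have dφ := hφ.differentiable (by simp) z
      rw [dz_mul (differentiableAt_of_contDiffOn hf hU hzU)
        (show DifferentiableAt ℝ (fun w => conj (φ w)) z from
          DifferentiableAt.comp z (differentiable_conj (φ z)) dφ),
        dz_mul (differentiable_ofReal_h κ z) d1, dz_h] at e1
      rw [dz_comp_conj dφ] at e1
      rw [hg z hzU, e1]
      simp only [F, u]
      field_simp
      ring
    · have : F =ᶠ[𝓝 z] fun _ => 0 := by
        filter_upwards [notMem_tsupport_iff_eventuallyEq.1 hz] with w hw
        simp [F, hw]
      rw [hg0 z hz, dz_congr this]; simp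
  rw [integral_vol, setIntegral_congr_fun (isOpen_surface κ).measurableSet key,
    setIntegral_eq_integral_of_forall_compl_eq_zero, integral_neg,
    integral_dz_eq_zero hF (hc.of_isClosed_subset (isClosed_tsupport _) hFs), neg_zero]
  intro z hz
  have hz' : z ∉ tsupport F := fun hn => hz (hUs (hs (hFs hn)))
  simp [dz, fderiv_eq_zero_of_notMem_tsupport hz']

/-- `∇_{ν+κ}` and `A_ν` are formally adjoint to each other. -/
theorem integral_nabla_mul_conj {κ : ℝ} (ν : ℝ) {f φ : ℂ → ℂ} {U : Set ℂ} (hU : IsOpen U)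
    (hUs : U ⊆ surface κ) (hf : ContDiffOn ℝ ∞ f U) (hφ : IsTestFunction κ φ)
    (hs : tsupport φ ⊆ U) :
    ∫ z, nabla κ (ν + κ) f z * conj (φ z) ∂(vol κ) = ∫ z, f z * conj (lower κ ν φ z) ∂(vol κ) := by
  rw [← sub_eq_zero, ← integral_sub
    (integrable_mul_conj hU (contDiffOn_nabla hf hU κ (ν + κ)) hφ hs)
    (integrable_mul_conj hU hf (hφ.lower κ ν) ((hφ.lower' κ ν).2.trans hs))]
  refine integral_vol_eq_zero_of_dz hU hUs hf hφ.1 hφ.2.1 hs (fun z _ => ?_) fun z hz => ?_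
  · simp only [nabla, lower, map_add, map_mul, Complex.conj_ofReal]
    push_cast; ring
  · simp [lower, dzbar, fderiv_eq_zero_of_notMem_tsupport hz, image_eq_zero_of_notMem_tsupport hz]

theorem integral_lower_mul_conj {κ : ℝ} (ν : ℝ) {f φ : ℂ → ℂ} {U : Set ℂ} (hU : IsOpen U)
    (hUs : U ⊆ surface κ) (hf : ContDiffOn ℝ ∞ f U) (hφ : IsTestFunction κ φ)
    (hs : tsupport φ ⊆ U) :
    ∫ z, lower κ ν f z * conj (φ z) ∂(vol κ) = ∫ z, f z * conj (nabla κ (ν + κ) φ z) ∂(vol κ) := by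
  rw [← sub_eq_zero, ← integral_sub
    (integrable_mul_conj hU (contDiffOn_lower hf hU κ ν) hφ hs)
    (integrable_mul_conj hU hf (hφ.nabla κ (ν + κ)) ((hφ.nabla' κ (ν + κ)).2.trans hs))]
  have hts : tsupport (fun z => conj (φ z)) = tsupport φ := congrArg closure (by ext; simp)
  have hfc : ContDiffOn ℝ ∞ (fun z => conj (f z)) U := contDiff_conj.comp_contDiffOn hf
  -- The conjugated integrand is again of the form covered by `integral_vol_eq_zero_of_dz`, with `f`
  -- and `φ` replaced by their conjugates.
  have h0 : ∫ z, conj (f z * conj (nabla κ (ν + κ) φ z) - lower κ ν f z * conj (φ z)) ∂(vol κ)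
      = 0 := by
    refine integral_vol_eq_zero_of_dz (φ := fun z => conj (φ z)) hU hUs hfc
      (contDiff_conj.comp hφ.1) (hφ.2.1.comp_left (map_zero _)) (by rwa [hts])
      (fun z hz => ?_) (fun z hz => ?_)
    · rw [dz_comp_conj (differentiableAt_of_contDiffOn hf hU hz),
        dzbar_comp_conj (hφ.1.differentiable (by simp) z)]
      simp only [nabla, lower, map_add, map_mul, map_sub, map_neg, Complex.conj_ofReal,
        Complex.conj_conj]
      push_cast; ring
    · rw [hts] at hz
      simp [nabla, dz, fderiv_eq_zero_of_notMem_tsupport hz, image_eq_zero_of_notMem_tsupport hz]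
  rw [integral_conj, map_eq_zero] at h0
  rw [← neg_eq_zero, ← integral_neg, ← h0]
  exact integral_congr_ae (Eventually.of_forall fun z => by simp only [neg_sub])

/-! ### The reduction to the lowest eigenvalue -/

/-- `∇^{(m)} A^{(m)}` acts on the eigenspace of `E_m^ν` as this constant. -/
def ladderConst (κ : ℝ) : ℝ → ℕ → ℝ
  | _, 0 => 1
  | ν, m + 1 => ladderConst κ (ν + κ) m * (eigenvalue κ ν (m + 1) - ν)

/-- Each factor is `(m + 1)(2ν + (m + 2)κ)`. For `κ ≤ 0` positivity at the two ends `ν` and `ν + mκ`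
of the ladder gives positivity in between. -/
theorem ladderConst_pos {κ : ℝ} (m : ℕ) {ν : ℝ} (hν : 0 < ν) (hm : 0 < ν + m * κ) :
    0 < ladderConst κ ν m := by
  induction m generalizing ν with
  | zero => simp [ladderConst]
  | succ m ih =>
    push_cast at hm
    have hm0 : (0 : ℝ) ≤ m := m.cast_nonneg
    refine mul_pos (ih ?_ (by linarith)) ?_
    · rcases le_total 0 κ with hκ | hκ
      · linarith
      · nlinarith
    · have : eigenvalue κ ν (m + 1) - ν = (m + 1) * (2 * ν + (m + 2) * κ) := by
        simp only [eigenvalue]; push_cast; ring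
      rw [this]
      refine mul_pos (by linarith) ?_
      rcases le_total 0 κ with hκ | hκ
      · nlinarith
      · nlinarith

/-- This replaces an inversion of `A^(m)`: weak eigenfunctions do not see the term `(𝔏 - E) ψ`, so
for them `∇^(m) A^(m)` on test functions is multiplication by a constant. -/
theorem nablaComp_lowerComp {κ : ℝ} (m : ℕ) {ν : ℝ} {φ : ℂ → ℂ} (hφ : IsTestFunction κ φ) :
    ∃ ψ, IsTestFunction κ ψ ∧ ∀ z, nablaComp κ ν m (lowerComp κ ν m φ) z
      = (ladderConst κ ν m : ℂ) * φ z
        + (twistedLaplacian κ ν ψ z - (eigenvalue κ ν m : ℂ) * ψ z) := by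
  induction m generalizing ν φ with
  | zero =>
    refine ⟨fun z => 0 * φ z, hφ.const_mul 0, fun z => ?_⟩
    have : twistedLaplacian κ ν (fun z => 0 * φ z) z = 0 := by
      rw [twistedLaplacian_eq κ ν (contDiff_const.mul hφ.1)]
      have h1 : lower κ ν (fun z => 0 * φ z) = fun _ => 0 := by
        funext w; simp [lower, dzbar]
      rw [h1]; simp [nabla]
    rw [this]
    simp [nablaComp, lowerComp, ladderConst]
  | succ m ih =>
    obtain ⟨ψ, hψ, he⟩ := ih (ν := ν + κ) (hφ.lower κ ν)
    -- With `c` the previous constant, applying `∇_{ν+κ}` gives `c (𝔏 - ν) φ + (𝔏 - E) ∇_{ν+κ} ψ`.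
    -- Writing `𝔏 - ν = (𝔏 - E) + (E - ν)` collects the defect in `c φ + ∇_{ν+κ} ψ`.
    refine ⟨fun z => (ladderConst κ (ν + κ) m : ℂ) * φ z + nabla κ (ν + κ) ψ z,
      (hφ.const_mul _).add (hψ.nabla κ (ν + κ)), fun z => ?_⟩
    have hd : ∀ {χ : ℂ → ℂ}, IsTestFunction κ χ → DifferentiableAt ℝ χ z := fun h =>
      h.1.differentiable (by simp) z
    have hA := hφ.lower κ ν
    have hL := hψ.twistedLaplacian (ν + κ)
    have hN := hψ.nabla κ (ν + κ)
    rw [nablaComp_succ, lowerComp, funext he]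
    simp only [sub_eq_add_neg, ← neg_mul]
    rw [nabla_add _ _ (hd (hA.const_mul _)) (hd (hL.add (hψ.const_mul _))),
      nabla_add _ _ (hd hL) (hd (hψ.const_mul _)), nabla_const_mul _ _ _ (hd hA),
      nabla_const_mul _ _ _ (hd hψ)]
    have h1 := twistedLaplacian_nabla κ ν isOpen_univ hψ.1.contDiffOn (mem_univ z)
    have h2 := twistedLaplacian_eq κ ν hφ.1 z
    have h3 : twistedLaplacian κ ν
        (fun z => (ladderConst κ (ν + κ) m : ℂ) * φ z + nabla κ (ν + κ) ψ z) z
        = (ladderConst κ (ν + κ) m : ℂ) * twistedLaplacian κ ν φ z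
          + twistedLaplacian κ ν (nabla κ (ν + κ) ψ) z := by
      rw [twistedLaplacian_eq κ ν ((hφ.const_mul _).add hN).1, h2,
        twistedLaplacian_eq κ ν hN.1]
      have h4 : lower κ ν (fun z => (ladderConst κ (ν + κ) m : ℂ) * φ z + nabla κ (ν + κ) ψ z)
          = fun z => (ladderConst κ (ν + κ) m : ℂ) * lower κ ν φ z
            + lower κ ν (nabla κ (ν + κ) ψ) z := by
        funext w
        have hφw : DifferentiableAt ℝ φ w := hφ.1.differentiable (by simp) w
        rw [lower, dzbar_add (hφw.const_mul _) (hN.1.differentiable (by simp) w),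
          dzbar_const_mul _ hφw, lower, lower]
        ring
      rw [h4, nabla_add _ _ (hd (hA.const_mul _)) (hd (hN.lower κ ν)),
        nabla_const_mul _ _ _ (hd hA)]
      ring
    rw [h3, h1, h2, ladderConst, eigenvalue_succ]
    push_cast; ring

theorem integral_nablaComp_mul_conj {κ : ℝ} (m : ℕ) {ν : ℝ} {f φ : ℂ → ℂ} {U : Set ℂ}
    (hU : IsOpen U) (hUs : U ⊆ surface κ) (hf : ContDiffOn ℝ ∞ f U) (hφ : IsTestFunction κ φ)
    (hs : tsupport φ ⊆ U) :
    ∫ z, nablaComp κ ν m f z * conj (φ z) ∂(vol κ)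
      = ∫ z, f z * conj (lowerComp κ ν m φ z) ∂(vol κ) := by
  induction m generalizing ν φ with
  | zero => rfl
  | succ m ih =>
    rw [nablaComp_succ, integral_nabla_mul_conj ν hU hUs (contDiffOn_nablaComp hU κ (ν + κ) m hf)
      hφ hs, ih (hφ.lower κ ν) ((hφ.lower' κ ν).2.trans hs), lowerComp]

theorem integral_twistedLaplacian_mul_conj {κ : ℝ} (ν : ℝ) {f φ : ℂ → ℂ} {U : Set ℂ}
    (hU : IsOpen U) (hUs : U ⊆ surface κ) (hf : ContDiffOn ℝ ∞ f U) (hφ : IsTestFunction κ φ)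
    (hs : tsupport φ ⊆ U) :
    ∫ z, f z * conj (twistedLaplacian κ ν φ z) ∂(vol κ)
      = ∫ z, twistedLaplacian κ ν f z * conj (φ z) ∂(vol κ) := by
  have hA := hφ.lower κ ν
  have hAs := (hφ.lower' κ ν).2.trans hs
  have hfA := contDiffOn_lower hf hU κ ν
  have i1 := integrable_mul_conj hU hf (hA.nabla κ (ν + κ)) ((hA.nabla' κ (ν + κ)).2.trans hAs)
  have i2 := (integrable_mul_conj hU hf hφ hs).const_mul (ν : ℂ)
  have i3 := integrable_mul_conj hU (contDiffOn_nabla hfA hU κ (ν + κ)) hφ hs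
  calc _ = ∫ z, (f z * conj (nabla κ (ν + κ) (lower κ ν φ) z) + ν * (f z * conj (φ z))) ∂(vol κ) :=
        integral_congr_ae (Eventually.of_forall fun z => by
          simp only [twistedLaplacian_eq κ ν hφ.1, map_add, map_mul, Complex.conj_ofReal]; ring)
    _ = ∫ z, (nabla κ (ν + κ) (lower κ ν f) z * conj (φ z) + ν * (f z * conj (φ z))) ∂(vol κ) := by
        rw [integral_add i1 i2, integral_add i3 i2, ← integral_lower_mul_conj ν hU hUs hf hA hAs,
          integral_nabla_mul_conj ν hU hUs hfA hφ hs]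
    _ = _ := integral_congr_ae (Eventually.of_forall fun z => by
        by_cases hz : z ∈ U
        · simp only [nabla_lower κ ν hU hf hz]; ring
        · simp [image_eq_zero_of_notMem_tsupport fun hn => hz (hs hn)])

/-! ### Functions with a fixed angular momentum -/

/-- The function `zᵏ g(|z|²)`. -/
def mode (k : ℤ) (g : ℝ → ℂ) (z : ℂ) : ℂ := z ^ k * g (‖z‖ ^ 2)

/-- The values of `|z|²` on `M_κ` without the origin. -/
def radii (κ : ℝ) : Set ℝ := {x | 0 < x ∧ 0 < 1 + κ * x}

/-- The weight as a function of `x = |z|²`; it solves `(1 + κ x) w' = -ν w`. -/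
def radialWeight (κ ν x : ℝ) : ℝ :=
  if κ = 0 then Real.exp (-ν * x) else (1 + κ * x) ^ (-(ν / κ))

theorem isOpen_radii (κ : ℝ) : IsOpen (radii κ) :=
  (isOpen_lt continuous_const continuous_id).inter
    (isOpen_lt continuous_const (show Continuous fun x : ℝ => 1 + κ * x by fun_prop))

theorem norm_sq_mem_radii {κ : ℝ} {z : ℂ} (hz : z ∈ surface κ) (hz0 : z ≠ 0) :
    ‖z‖ ^ 2 ∈ radii κ :=
  ⟨by positivity, hz⟩

theorem weight_eq (κ ν : ℝ) (m : ℕ) (z : ℂ) :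
    weight κ ν m z = radialWeight κ (ν + m * κ) (‖z‖ ^ 2) := by
  unfold weight radialWeight h
  split_ifs with hκ
  · simp [hκ]
  · congr 1; field_simp

theorem radialWeight_pos {κ ν x : ℝ} (hx : 0 < 1 + κ * x) : 0 < radialWeight κ ν x := by
  unfold radialWeight
  split_ifs
  · positivity
  · positivity

theorem hasDerivAt_radialWeight {κ : ℝ} (ν : ℝ) {x : ℝ} (hx : 0 < 1 + κ * x) :
    HasDerivAt (radialWeight κ ν) (-ν * radialWeight κ ν x / (1 + κ * x)) x := by
  unfold radialWeight
  split_ifs with hκ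
  · subst hκ
    simpa [mul_comm] using ((hasDerivAt_id x).const_mul (-ν)).exp
  · have h1 : HasDerivAt (fun x => 1 + κ * x) κ x := by
      simpa using ((hasDerivAt_id x).const_mul κ).const_add 1
    refine (h1.rpow_const (p := -(ν / κ)) (Or.inl hx.ne')).congr_deriv ?_
    rw [Real.rpow_sub_one hx.ne']
    field_simp

theorem contDiffAt_radialWeight {κ : ℝ} (ν : ℝ) {x : ℝ} (hx : 0 < 1 + κ * x) :
    ContDiffAt ℝ ∞ (radialWeight κ ν) x := by
  unfold radialWeight
  split_ifs with hκ
  · fun_prop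
  · exact ContDiffAt.rpow_const_of_ne (by fun_prop) hx.ne'

theorem contDiffAt_ofReal_radialWeight {κ : ℝ} (ν : ℝ) {x : ℝ} (hx : 0 < 1 + κ * x) :
    ContDiffAt ℝ ∞ (fun x => (radialWeight κ ν x : ℂ)) x :=
  Complex.ofRealCLM.contDiff.contDiffAt.comp x (contDiffAt_radialWeight ν hx)

theorem contDiffAt_radial {g : ℝ → ℂ} {z : ℂ} (hg : ContDiffAt ℝ ∞ g (‖z‖ ^ 2)) :
    ContDiffAt ℝ ∞ (fun w : ℂ => g (‖w‖ ^ 2)) z :=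
  ContDiffAt.comp z hg (contDiff_norm_sq ℝ).contDiffAt

theorem contDiffAt_zpow {z : ℂ} (hz : z ≠ 0) (k : ℤ) : ContDiffAt ℝ ∞ (fun w : ℂ => w ^ k) z := by
  have h1 : ContDiffAt ℂ ∞ (fun w : ℂ => w ^ k) z := by
    rcases k with n | n
    · simp only [Int.ofNat_eq_natCast, zpow_natCast]; fun_prop
    · simp only [zpow_negSucc]
      exact ContDiffAt.inv (by fun_prop) (pow_ne_zero _ hz)
  exact h1.restrict_scalars ℝ

theorem contDiffAt_mode {g : ℝ → ℂ} {z : ℂ} (hz : z ≠ 0) (k : ℤ)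
    (hg : ContDiffAt ℝ ∞ g (‖z‖ ^ 2)) : ContDiffAt ℝ ∞ (mode k g) z :=
  (contDiffAt_zpow hz k).mul (contDiffAt_radial hg)

theorem hasFDerivAt_zpow_real {z : ℂ} (hz : z ≠ 0) (k : ℤ) :
    HasFDerivAt (fun w : ℂ => w ^ k) ((k * z ^ (k - 1)) • (1 : ℂ →L[ℝ] ℂ)) z :=
  (hasDerivAt_zpow k z (Or.inl hz)).complexToReal_fderiv

theorem hasFDerivAt_radial {g : ℝ → ℂ} {g' : ℂ} {z : ℂ} (hg : HasDerivAt g g' (‖z‖ ^ 2)) :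
    HasFDerivAt (fun w : ℂ => g (‖w‖ ^ 2))
      ((ContinuousLinearMap.toSpanSingleton ℝ g').comp (2 • innerSL ℝ z)) z :=
  hg.hasFDerivAt.comp z (hasStrictFDerivAt_norm_sq z).hasFDerivAt

theorem dz_radial {g : ℝ → ℂ} {g' : ℂ} {z : ℂ} (hg : HasDerivAt g g' (‖z‖ ^ 2)) :
    dz (fun w : ℂ => g (‖w‖ ^ 2)) z = conj z * g' := by
  rw [dz, (hasFDerivAt_radial hg).fderiv]
  have : conj z = z.re - Complex.I * z.im := by
    apply Complex.ext <;> simp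
  simp [Complex.inner, this]
  ring

theorem dzbar_radial {g : ℝ → ℂ} {g' : ℂ} {z : ℂ} (hg : HasDerivAt g g' (‖z‖ ^ 2)) :
    dzbar (fun w : ℂ => g (‖w‖ ^ 2)) z = z * g' := by
  rw [dzbar, (hasFDerivAt_radial hg).fderiv]
  have : z = z.re + Complex.I * z.im := by
    apply Complex.ext <;> simp
  conv_rhs => rw [this]
  simp [Complex.inner]
  ring

theorem dz_mode (k : ℤ) {g : ℝ → ℂ} {g' : ℂ} {z : ℂ} (hz : z ≠ 0)
    (hg : HasDerivAt g g' (‖z‖ ^ 2)) :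
    dz (mode k g) z = z ^ (k - 1) * (k * g (‖z‖ ^ 2) + ((‖z‖ ^ 2 : ℝ) : ℂ) * g') := by
  unfold mode
  rw [dz_mul (hasFDerivAt_zpow_real hz k).differentiableAt
    (hasFDerivAt_radial hg).differentiableAt, dz_radial hg]
  have h1 : dz (fun w : ℂ => w ^ k) z = k * z ^ (k - 1) := by
    rw [dz, (hasFDerivAt_zpow_real hz k).fderiv]
    simp only [smul_apply, one_apply_eq_self, smul_eq_mul]
    linear_combination (-(k * z ^ (k - 1)) / 2 : ℂ) * Complex.I_mul_I
  have h2 : z ^ k = z ^ (k - 1) * z := by rw [← zpow_add_one₀ hz]; simp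
  rw [h1, h2]
  push_cast
  rw [norm_sq_eq]
  ring

theorem dzbar_mode (k : ℤ) {g : ℝ → ℂ} {g' : ℂ} {z : ℂ} (hz : z ≠ 0)
    (hg : HasDerivAt g g' (‖z‖ ^ 2)) :
    dzbar (mode k g) z = z ^ (k + 1) * g' := by
  unfold mode
  rw [dzbar_mul (hasFDerivAt_zpow_real hz k).differentiableAt
    (hasFDerivAt_radial hg).differentiableAt, dzbar_radial hg]
  have h1 : dzbar (fun w : ℂ => w ^ k) z = 0 := by
    rw [dzbar, (hasFDerivAt_zpow_real hz k).fderiv]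
    simp only [smul_apply, one_apply_eq_self, smul_eq_mul]
    linear_combination ((k * z ^ (k - 1)) / 2 : ℂ) * Complex.I_mul_I
  rw [h1, zpow_add_one₀ hz]
  ring

theorem ofReal_h_eq (κ : ℝ) (z : ℂ) : (h κ z : ℂ) = 1 + κ * ((‖z‖ ^ 2 : ℝ) : ℂ) := by
  simp [h]

theorem nabla_mode (κ α : ℝ) (k : ℤ) {g : ℝ → ℂ} {g' : ℂ} {z : ℂ} (hz : z ≠ 0)
    (hg : HasDerivAt g g' (‖z‖ ^ 2)) :
    nabla κ α (mode k g) z = z ^ (k - 1) *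
      (-(1 + κ * ((‖z‖ ^ 2 : ℝ) : ℂ)) * (k * g (‖z‖ ^ 2) + ((‖z‖ ^ 2 : ℝ) : ℂ) * g')
        + α * ((‖z‖ ^ 2 : ℝ) : ℂ) * g (‖z‖ ^ 2)) := by
  have h2 : z ^ k = z ^ (k - 1) * z := by rw [← zpow_add_one₀ hz]; simp
  have h3 : ((‖z‖ ^ 2 : ℝ) : ℂ) = z * conj z := by push_cast; exact norm_sq_eq z
  rw [nabla, dz_mode k hz hg, mode, h2, ofReal_h_eq]
  linear_combination (-α * g (‖z‖ ^ 2) * z ^ (k - 1)) * h3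

theorem lower_mode (κ α : ℝ) (k : ℤ) {g : ℝ → ℂ} {g' : ℂ} {z : ℂ} (hz : z ≠ 0)
    (hg : HasDerivAt g g' (‖z‖ ^ 2)) :
    lower κ α (mode k g) z = z ^ (k + 1) *
      ((1 + κ * ((‖z‖ ^ 2 : ℝ) : ℂ)) * g' + α * g (‖z‖ ^ 2)) := by
  rw [lower, dzbar_mode k hz hg, mode, ofReal_h_eq, zpow_add_one₀ hz]
  ring

theorem hasDerivAt_radialWeight_mul {κ : ℝ} (ν : ℝ) {p : ℝ → ℂ} {p' : ℂ} {x : ℝ}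
    (hx : 0 < 1 + κ * x) (hp : HasDerivAt p p' x) :
    HasDerivAt (fun x => (radialWeight κ ν x : ℂ) * p x)
      ((radialWeight κ ν x : ℂ) * (p' - ν * p x / (1 + κ * x))) x := by
  have := ((hasDerivAt_radialWeight ν hx).ofReal_comp).fun_mul hp
  refine this.congr_deriv ?_
  push_cast
  ring

theorem nabla_mode_radialWeight {κ : ℝ} (ν α : ℝ) (k : ℤ) {p : ℝ → ℂ} {p' : ℂ} {z : ℂ}
    (hzs : z ∈ surface κ) (hz : z ≠ 0) (hp : HasDerivAt p p' (‖z‖ ^ 2)) :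
    nabla κ α (mode k fun x => (radialWeight κ ν x : ℂ) * p x) z = z ^ (k - 1) *
      (radialWeight κ ν (‖z‖ ^ 2) *
        (-(1 + κ * ((‖z‖ ^ 2 : ℝ) : ℂ)) * (k * p (‖z‖ ^ 2) + ((‖z‖ ^ 2 : ℝ) : ℂ) * p')
          + (α + ν) * ((‖z‖ ^ 2 : ℝ) : ℂ) * p (‖z‖ ^ 2))) := by
  rw [nabla_mode κ α k hz (hasDerivAt_radialWeight_mul ν hzs hp)]
  have h0 := ofReal_h_ne_zero hzs
  rw [ofReal_h_eq] at h0
  field_simp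
  ring

theorem lower_mode_radialWeight {κ : ℝ} (ν : ℝ) (k : ℤ) {p : ℝ → ℂ} {p' : ℂ} {z : ℂ}
    (hzs : z ∈ surface κ) (hz : z ≠ 0) (hp : HasDerivAt p p' (‖z‖ ^ 2)) :
    lower κ ν (mode k fun x => (radialWeight κ ν x : ℂ) * p x) z = z ^ (k + 1) *
      (radialWeight κ ν (‖z‖ ^ 2) * ((1 + κ * ((‖z‖ ^ 2 : ℝ) : ℂ)) * p')) := by
  rw [lower_mode κ ν k hz (hasDerivAt_radialWeight_mul ν hzs hp)]
  have h0 := ofReal_h_ne_zero hzs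
  rw [ofReal_h_eq] at h0
  field_simp
  ring

theorem isOpen_punctured (κ : ℝ) : IsOpen (surface κ \ {0}) :=
  (isOpen_surface κ).sdiff isClosed_singleton

theorem contDiffOn_mode {κ : ℝ} (k : ℤ) {g : ℝ → ℂ} (hg : ContDiffOn ℝ ∞ g (radii κ)) :
    ContDiffOn ℝ ∞ (mode k g) (surface κ \ {0}) := fun _ hz =>
  (contDiffAt_mode hz.2 k (hg.contDiffAt
    ((isOpen_radii κ).mem_nhds (norm_sq_mem_radii hz.1 hz.2)))).contDiffWithinAt

/-! ### The radial polynomials -/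

open Polynomial in
/-- The action of `∇_α` on `zᵏ w(|z|²) p(|z|²)` in terms of the polynomial `p`, where
`(1 + κ x) w' = (α - β) w`. -/
def nablaPoly (κ β : ℝ) (k : ℤ) (p : ℝ[X]) : ℝ[X] :=
  -((1 + C κ * X) * (C (k : ℝ) * p + X * derivative p)) + C β * X * p

open Polynomial in
/-- The iterates of `nablaPoly` that belong to `nablaComp`. -/
def radPoly (κ c : ℝ) : ℕ → ℤ → ℝ[X] → ℝ[X]
  | 0, _, p => p
  | m + 1, k, p => radPoly κ c m (k - 1) (nablaPoly κ (c + (m + 1) * κ) k p)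

open Polynomial in
theorem nablaComp_mode_radialWeight {κ ν ν' : ℝ} (m : ℕ) (k : ℤ) (p : ℝ[X]) :
    EqOn (nablaComp κ ν m (mode k fun x => (radialWeight κ ν' x : ℂ) * (p.eval x : ℝ)))
      (mode (k - m) fun x =>
        (radialWeight κ ν' x : ℂ) * ((radPoly κ (ν + ν') m k p).eval x : ℝ)) (surface κ \ {0}) := by
  induction m generalizing k p with
  | zero => intro z _; simp [nablaComp, radPoly]
  | succ m ih =>
    have h1 : EqOn (nabla κ (ν + (m + 1) * κ)
          (mode k fun x => (radialWeight κ ν' x : ℂ) * (p.eval x : ℝ)))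
        (mode (k - 1) fun x => (radialWeight κ ν' x : ℂ) *
          ((nablaPoly κ (ν + ν' + (m + 1) * κ) k p).eval x : ℝ)) (surface κ \ {0}) := by
      intro z hz
      rw [nabla_mode_radialWeight ν' _ k hz.1 hz.2 ((p.hasDerivAt (‖z‖ ^ 2)).ofReal_comp), mode]
      simp only [nablaPoly, eval_add, eval_neg, eval_mul, eval_one, eval_C, eval_X]
      push_cast
      ring
    rw [nablaComp]
    refine (nablaComp_congr (isOpen_punctured κ) m h1).trans ((ih (k - 1) _).trans ?_)
    intro z _
    rw [radPoly, show k - 1 - (m : ℤ) = k - (m + 1 : ℕ) by push_cast; ring]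

open Polynomial in
theorem Psi_eq_mode (κ ν : ℝ) (m n : ℕ) :
    EqOn (Psi κ ν m n) (mode ((n : ℤ) - m) fun x => (radialWeight κ (ν + m * κ) x : ℂ) *
      ((radPoly κ (ν + (ν + m * κ)) m n 1).eval x : ℝ)) (surface κ \ {0}) := by
  refine (nablaComp_congr (isOpen_punctured κ) m fun z hz => ?_).trans
    (nablaComp_mode_radialWeight (ν := ν) (ν' := ν + m * κ) m (n : ℤ) 1)
  simp [mode, weight_eq, mul_comm]

open Polynomial in
theorem coeff_zero_nablaPoly (κ β : ℝ) (k : ℤ) (p : ℝ[X]) :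
    (nablaPoly κ β k p).coeff 0 = -(k * p.coeff 0) := by
  simp [nablaPoly, mul_assoc, add_mul]

open Polynomial in
theorem coeff_succ_nablaPoly (κ β : ℝ) (k : ℤ) (p : ℝ[X]) (d : ℕ) :
    (nablaPoly κ β k p).coeff (d + 1)
      = -((k + d + 1) * p.coeff (d + 1) + (κ * (k + d) - β) * p.coeff d) := by
  have h1 : (X * derivative p).coeff d = d * p.coeff d := by
    cases d with
    | zero => simp
    | succ d => rw [coeff_X_mul, coeff_derivative]; push_cast; ring
  simp only [nablaPoly, add_mul, one_mul, mul_assoc, coeff_add, coeff_neg, coeff_C_mul,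
    coeff_X_mul, h1, coeff_derivative]
  ring

open Polynomial in
-- Each step multiplies the constant term by `-k`, and `k` only decreases, so all factors are
-- positive.
theorem coeff_zero_radPoly_pos (κ c : ℝ) (m : ℕ) {k : ℤ} (hk : k < 0) {p : ℝ[X]}
    (hp : 0 < p.coeff 0) : 0 < (radPoly κ c m k p).coeff 0 := by
  induction m generalizing k p with
  | zero => exact hp
  | succ m ih =>
    refine ih (by omega) ?_
    rw [coeff_zero_nablaPoly]
    have : (k : ℝ) < 0 := by exact_mod_cast hk
    nlinarith

open Polynomial in
-- Under `hk` the numbers `k + d + 1` and `κ (k + d) - β` in the coefficient recursion are positive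
-- at every step, so each step flips a common sign. The exponent `s` counts the flips and marks a
-- coefficient known to be nonzero.
theorem coeff_radPoly_sign {κ c : ℝ} (hκ : 0 < κ) (hc : 0 < c) (m : ℕ) {k : ℤ}
    (hk : c + m * κ < κ * k) {p : ℝ[X]} (s : ℕ) (hp : ∀ d, 0 ≤ (-1) ^ s * p.coeff d)
    (hp' : 0 < (-1) ^ s * p.coeff s) :
    (∀ d, 0 ≤ (-1) ^ (s + m) * (radPoly κ c m k p).coeff d) ∧
      0 < (-1) ^ (s + m) * (radPoly κ c m k p).coeff (s + m) := by
  induction m generalizing k p s with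
  | zero => exact ⟨hp, hp'⟩
  | succ m ih =>
    push_cast at hk
    have hk0 : (0 : ℝ) < k := by
      by_contra hn
      have : κ * k ≤ 0 := mul_nonpos_of_nonneg_of_nonpos hκ.le (not_lt.1 hn)
      have : (0 : ℝ) ≤ (m + 1) * κ := by positivity
      linarith
    have hs : ∀ d, (-1 : ℝ) ^ (s + 1) * (nablaPoly κ (c + (m + 1) * κ) k p).coeff (d + 1)
        = (k + d + 1) * ((-1) ^ s * p.coeff (d + 1))
          + (κ * (k + d) - (c + (m + 1) * κ)) * ((-1) ^ s * p.coeff d) := fun d => by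
      rw [coeff_succ_nablaPoly]; ring
    have hb : ∀ d : ℕ, 0 < κ * (k + d) - (c + (m + 1) * κ) := fun d => by
      have : 0 ≤ κ * d := by positivity
      linarith
    have := ih (k := k - 1) (p := nablaPoly κ (c + (m + 1) * κ) k p)
      (by push_cast; linarith) (s + 1) (fun d => ?_) ?_
    · rwa [show s + 1 + m = s + (m + 1) by ring] at this
    · cases d with
      | zero =>
        rw [coeff_zero_nablaPoly]
        have : (-1 : ℝ) ^ (s + 1) * -(k * p.coeff 0) = k * ((-1) ^ s * p.coeff 0) := by ring
        rw [this]
        exact mul_nonneg hk0.le (hp 0)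
      | succ d =>
        rw [hs]
        exact add_nonneg (mul_nonneg (by positivity) (hp _)) (mul_nonneg (hb d).le (hp _))
    · rw [hs]
      exact add_pos_of_nonneg_of_pos (mul_nonneg (by positivity) (hp _)) (mul_pos (hb s) hp')

open Polynomial in
theorem natDegree_radPoly_le (κ c : ℝ) (m : ℕ) (k : ℤ) {p : ℝ[X]} {s : ℕ}
    (hp : p.natDegree ≤ s) : (radPoly κ c m k p).natDegree ≤ s + m := by
  induction m generalizing k p s with
  | zero => exact hp
  | succ m ih =>
    have := ih (k - 1) (p := nablaPoly κ (c + (m + 1) * κ) k p) (s := s + 1) ?_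
    · rw [radPoly]; omega
    · rw [natDegree_le_iff_coeff_eq_zero] at hp ⊢
      intro d hd
      obtain ⟨d, rfl⟩ : ∃ e, d = e + 1 := ⟨d - 1, by omega⟩
      rw [coeff_succ_nablaPoly, hp _ (by omega), hp _ (by omega)]
      ring

open Polynomial in
-- The quantity `β - κ k` does not change along the recursion, because `k` drops by one while `β`
-- drops by `κ`. By `hk` it equals `κ r`, so the factor that would create a term of degree `r + 1`
-- vanishes each time.
theorem natDegree_radPoly_le_of_eq (κ c : ℝ) (m r : ℕ) {k : ℤ} (hk : c + m * κ = κ * (k + r))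
    {p : ℝ[X]} (hp : p.natDegree ≤ r) : (radPoly κ c m k p).natDegree ≤ r := by
  induction m generalizing k p with
  | zero => exact hp
  | succ m ih =>
    push_cast at hk
    refine ih (by push_cast; linarith) ?_
    rw [natDegree_le_iff_coeff_eq_zero] at hp ⊢
    intro d hd
    obtain ⟨d, rfl⟩ : ∃ e, d = e + 1 := ⟨d - 1, by omega⟩
    rw [coeff_succ_nablaPoly, hp _ (by omega)]
    rcases (show d = r ∨ r < d by omega) with rfl | hd'
    · rw [hk]; ring
    · rw [hp _ hd']; ring

open Polynomial in
theorem exists_abs_eval_le (p : ℝ[X]) {D : ℕ} (hp : p.natDegree ≤ D) :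
    ∃ C, 0 ≤ C ∧ ∀ x, 0 ≤ x → |p.eval x| ≤ C * (1 + x) ^ D := by
  refine ⟨∑ i ∈ Finset.range (D + 1), |p.coeff i|, Finset.sum_nonneg fun _ _ => abs_nonneg _,
    fun x hx => ?_⟩
  rw [eval_eq_sum_range' (Nat.lt_succ_of_le hp), Finset.sum_mul]
  refine (Finset.abs_sum_le_sum_abs _ _).trans (Finset.sum_le_sum fun i hi => ?_)
  rw [abs_mul, abs_of_nonneg (pow_nonneg hx i)]
  refine mul_le_mul_of_nonneg_left ?_ (abs_nonneg _)
  exact (pow_le_pow_left₀ hx (by linarith) i).trans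
    (pow_le_pow_right₀ (by linarith) (by simpa [Nat.lt_succ_iff] using hi))

/-! ### Square integrability -/

theorem memLp_vol_two_iff {κ : ℝ} {f : ℂ → ℂ} (hf : AEStronglyMeasurable f (vol κ)) :
    MemLp f 2 (vol κ) ↔ IntegrableOn (fun z => (h κ z ^ 2)⁻¹ * ‖f z‖ ^ 2) (surface κ) := by
  rw [memLp_two_iff_integrable_sq_norm hf]
  unfold vol
  rw [integrable_withDensity_iff_integrable_smul' (measurable_density κ)
    (Eventually.of_forall fun _ => ENNReal.ofReal_lt_top)]
  simp only [ENNReal.toReal_ofReal (inv_nonneg.2 (sq_nonneg (h κ _))), smul_eq_mul]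
  rfl

theorem integrable_inv_one_add_norm_sq_sq :
    Integrable (fun z : ℂ => ((1 + ‖z‖ ^ 2) ^ 2)⁻¹) := by
  have := integrable_rpow_neg_one_add_norm_sq (E := ℂ) (μ := volume) (r := 4)
    (by rw [Complex.finrank_real_complex]; norm_num)
  refine this.congr (Eventually.of_forall fun z => ?_)
  have h0 : (0 : ℝ) ≤ 1 + ‖z‖ ^ 2 := by positivity
  simp only
  rw [show -(4 : ℝ) / 2 = -(2 : ℕ) by norm_num, Real.rpow_neg h0, Real.rpow_natCast]

theorem integrableOn_radial_iff {f : ℝ → ℝ} {s : Set ℝ} (hs : MeasurableSet s) :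
    IntegrableOn (fun z : ℂ => f ‖z‖) {z | ‖z‖ ∈ s} ↔
      IntegrableOn (fun r => r * f r) (Ioi 0 ∩ s) := by
  have hs' : MeasurableSet {z : ℂ | ‖z‖ ∈ s} := measurable_norm hs
  rw [← integrable_indicator_iff hs', inter_comm, IntegrableOn, ← Measure.restrict_restrict hs]
  change _ ↔ IntegrableOn _ s (volume.restrict (Ioi 0))
  rw [← integrable_indicator_iff hs]
  have := integrable_fun_norm_addHaar (E := ℂ) volume (f := s.indicator f)
  rw [Complex.finrank_real_complex] at this
  have e : (fun z : ℂ => s.indicator f ‖z‖) = {z : ℂ | ‖z‖ ∈ s}.indicator fun z => f ‖z‖ := by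
    funext z; simp [indicator]
  rw [← e, this, IntegrableOn]
  refine integrable_congr (Eventually.of_forall fun r => ?_)
  simp [indicator]

/-- In polar coordinates the integrand is `r (1 + κ r²)^s`. It is nonnegative and has the primitive
`(1 + κ r²)^(s+1) / (2κ(s+1))`, which is continuous up to the boundary circle because `s + 1 > 0`.
-/
theorem integrableOn_rpow_h {κ s : ℝ} (hκ : κ < 0) (hs : -1 < s) :
    IntegrableOn (fun z => h κ z ^ s) (surface κ) := by
  set R := √(-κ)⁻¹ with hR
  have hR0 : 0 < R := Real.sqrt_pos.2 (inv_pos.2 (neg_pos.2 hκ))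
  have hR2 : κ * R ^ 2 = -1 := by
    rw [hR, Real.sq_sqrt (inv_nonneg.2 (neg_nonneg.2 hκ.le)), inv_neg, mul_neg,
      mul_inv_cancel₀ hκ.ne]
  have hpos : ∀ r, r ∈ Ioo 0 R → 0 < 1 + κ * r ^ 2 := fun r hr => by
    have : r ^ 2 < R ^ 2 := pow_lt_pow_left₀ hr.2 hr.1.le (by norm_num)
    nlinarith
  have hsurf : surface κ = {z | ‖z‖ ∈ Iio R} := by
    ext z
    simp only [surface, h, mem_ofPred_eq, mem_Iio]
    constructor
    · intro hz
      by_contra hn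
      have : R ^ 2 ≤ ‖z‖ ^ 2 := pow_le_pow_left₀ hR0.le (not_lt.1 hn) 2
      nlinarith
    · intro hz
      have : ‖z‖ ^ 2 < R ^ 2 := pow_lt_pow_left₀ hz (norm_nonneg z) (by norm_num)
      nlinarith
  rw [hsurf]
  have := (integrableOn_radial_iff (f := fun r => (1 + κ * r ^ 2) ^ s) (s := Iio R)
    measurableSet_Iio).2 ?_
  · exact this
  · rw [Ioi_inter_Iio]
    have h2 : IntegrableOn (fun r => -(-(r * (1 + κ * r ^ 2) ^ s))) (Ioc 0 R) := by
      simp only [neg_neg]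
      refine intervalIntegral.integrableOn_deriv_of_nonneg
        (g := fun r => (1 + κ * r ^ 2) ^ (s + 1) / (2 * κ * (s + 1))) ?_ ?_ ?_
      · refine ContinuousOn.div_const (ContinuousOn.rpow_const (by fun_prop) fun r _ =>
          Or.inr (by linarith)) _
      · intro r hr
        have h1 : HasDerivAt (fun r => 1 + κ * r ^ 2) (κ * (2 * r)) r := by
          simpa using ((hasDerivAt_pow 2 r).const_mul κ).const_add 1
        refine ((h1.rpow_const (p := s + 1) (Or.inl (hpos r hr).ne')).div_const _).congr_deriv ?_
        have : s + 1 ≠ 0 := by linarith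
        have hκ' := hκ.ne
        rw [add_sub_cancel_right]
        field_simp
      · intro r hr
        have := hpos r hr
        have := hr.1
        positivity
    simp only [neg_neg] at h2
    exact h2.mono_set Ioo_subset_Ioc_self

theorem radialWeight_sq {κ ν x : ℝ} {K : ℕ} (hκ : 0 < κ) (hK : 2 * ν = κ * K)
    (hx : 0 < 1 + κ * x) : radialWeight κ ν x ^ 2 = ((1 + κ * x) ^ K)⁻¹ := by
  rw [radialWeight, if_neg hκ.ne', ← Real.rpow_natCast, ← Real.rpow_mul hx.le,
    ← Real.rpow_natCast (n := K), ← Real.rpow_neg hx.le]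
  congr 1
  have : ν = κ * K / 2 := by linarith
  rw [this]; push_cast; field_simp

theorem one_add_sq_le (r : ℝ) : (1 + r) ^ 2 ≤ 2 * (1 + r ^ 2) := by nlinarith [sq_nonneg (1 - r)]

/-- The density times the squared weight is an integrable power of `h` for `κ < 0`, a Gaussian for
`κ = 0`, and `h^(-K-2)` for `κ > 0`. The power of `1 + |z|` is bounded in the first case, absorbed
in the second, and leaves `(1 + |z|²)⁻²` in the third because `M ≤ K`. -/
theorem memLp_of_norm_le_weight {κ ν : ℝ} {K M : ℕ} (hν : 0 < ν) (hneg : κ < 0 → -κ < 2 * ν)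
    (hpos : 0 < κ → 2 * ν = κ * K ∧ M ≤ K) {f : ℂ → ℂ} (hf : AEStronglyMeasurable f (vol κ))
    {C : ℝ} (hC : ∀ᵐ z ∂(vol κ), ‖f z‖ ≤ C * (radialWeight κ ν (‖z‖ ^ 2) * (1 + ‖z‖) ^ M)) :
    MemLp f 2 (vol κ) := by
  set W : ℂ → ℝ := fun z => radialWeight κ ν (‖z‖ ^ 2) * (1 + ‖z‖) ^ M with hW
  have hmeas : Measurable W := by
    refine Measurable.mul ?_ (by fun_prop)
    unfold radialWeight
    split_ifs
    · fun_prop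
    · fun_prop
  have hW2 : MemLp (fun z => (W z : ℂ)) 2 (vol κ) := by
    rw [memLp_vol_two_iff (f := fun z => (W z : ℂ))
      (Complex.measurable_ofReal.comp hmeas).aestronglyMeasurable]
    have hm : AEStronglyMeasurable (fun z => (h κ z ^ 2)⁻¹ * ‖(W z : ℂ)‖ ^ 2)
        (volume.restrict (surface κ)) :=
      ((((contDiff_h (n := 0) κ).continuous.measurable.pow_const 2).inv).mul
        ((Complex.measurable_ofReal.comp hmeas).norm.pow_const 2)).aestronglyMeasurable
    have h12 : ∀ z : ℂ, (1 + ‖z‖) ^ (2 * M) ≤ 2 ^ M * (1 + ‖z‖ ^ 2) ^ M := fun z => by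
      rw [pow_mul, ← mul_pow]
      exact pow_le_pow_left₀ (by positivity) (one_add_sq_le _) M
    have hsq : ∀ z, ‖(W z : ℂ)‖ ^ 2 = radialWeight κ ν (‖z‖ ^ 2) ^ 2 * (1 + ‖z‖) ^ (2 * M) := by
      intro z
      rw [Complex.norm_real, Real.norm_eq_abs, sq_abs, hW, mul_pow, ← pow_mul, mul_comm M]
    rcases lt_trichotomy κ 0 with hκ | hκ | hκ
    · refine ((integrableOn_rpow_h (s := -(2 * ν / κ) - 2) hκ ?_).const_mul
        ((1 + √(-κ)⁻¹) ^ (2 * M))).mono' hm ?_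
      · have : 1 < -(2 * ν / κ) := by
          rw [← div_neg, one_lt_div (neg_pos.2 hκ)]; exact hneg hκ
        linarith
      · filter_upwards [ae_restrict_mem (isOpen_surface κ).measurableSet] with z hz
        have hz' : 0 < h κ z := hz
        have hr : ‖z‖ ≤ √(-κ)⁻¹ := by
          refine Real.le_sqrt_of_sq_le ?_
          rw [← one_div, le_div_iff₀ (neg_pos.2 hκ)]
          have : 0 < 1 + κ * ‖z‖ ^ 2 := hz
          nlinarith
        have e1 : radialWeight κ ν (‖z‖ ^ 2) ^ 2 = h κ z ^ (-(2 * ν / κ)) := by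
          rw [radialWeight, if_neg hκ.ne]
          change (h κ z ^ (-(ν / κ))) ^ 2 = _
          rw [← Real.rpow_natCast, ← Real.rpow_mul hz'.le]
          congr 1; push_cast; ring
        rw [Real.norm_of_nonneg (by positivity), hsq, e1, Real.rpow_sub hz',
          Real.rpow_two, div_eq_mul_inv]
        have h3 : (1 + ‖z‖) ^ (2 * M) ≤ (1 + √(-κ)⁻¹) ^ (2 * M) :=
          pow_le_pow_left₀ (by positivity) (by linarith) _
        have h4 : 0 ≤ h κ z ^ (-(2 * ν / κ)) * (h κ z ^ 2)⁻¹ := by positivity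
        calc _ = (1 + ‖z‖) ^ (2 * M) * (h κ z ^ (-(2 * ν / κ)) * (h κ z ^ 2)⁻¹) := by ring_nf
          _ ≤ _ := mul_le_mul_of_nonneg_right h3 h4
    · subst hκ
      refine ((integrable_inv_one_add_norm_sq_sq.const_mul
        (2 ^ M * ((M + 2).factorial / (2 * ν) ^ (M + 2) * Real.exp (2 * ν)))).integrableOn).mono'
        hm ?_
      filter_upwards with z
      rw [Real.norm_of_nonneg (by positivity), hsq]
      -- This is `t^j / j! ≤ exp t` at `t = 2ν(1 + |z|²)` and `j = M + 2`; the two extra powers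
      -- leave the integrable factor `(1 + |z|²)⁻²`.
      have h1 : (1 + ‖z‖ ^ 2) ^ (M + 2) ≤ (M + 2).factorial / (2 * ν) ^ (M + 2) * Real.exp (2 * ν)
          * Real.exp (2 * ν * ‖z‖ ^ 2) := by
        have := Real.pow_div_factorial_le_exp (2 * ν * (1 + ‖z‖ ^ 2)) (by positivity) (M + 2)
        rw [mul_pow, div_le_iff₀ (by positivity)] at this
        rw [mul_assoc, ← Real.exp_add, div_mul_eq_mul_div, le_div_iff₀ (by positivity)]
        calc _ = (2 * ν) ^ (M + 2) * (1 + ‖z‖ ^ 2) ^ (M + 2) := by ring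
          _ ≤ _ := this
          _ = _ := by rw [mul_add, mul_one]; ring
      have e2 : radialWeight 0 ν (‖z‖ ^ 2) ^ 2 = (Real.exp (2 * ν * ‖z‖ ^ 2))⁻¹ := by
        rw [radialWeight, if_pos rfl, ← Real.exp_nat_mul, ← Real.exp_neg]
        congr 1; push_cast; ring
      have e3 : h 0 z = 1 := by simp [h]
      rw [e2, e3, one_pow, inv_one, one_mul, ← div_eq_mul_inv, le_div_iff₀ (by positivity),
        inv_mul_eq_div, div_mul_eq_mul_div, div_le_iff₀ (by positivity)]
      calc _ ≤ 2 ^ M * (1 + ‖z‖ ^ 2) ^ M * (1 + ‖z‖ ^ 2) ^ 2 :=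
            mul_le_mul_of_nonneg_right (h12 z) (by positivity)
        _ = 2 ^ M * (1 + ‖z‖ ^ 2) ^ (M + 2) := by ring
        _ ≤ _ := by
          rw [mul_assoc (2 ^ M)]
          exact mul_le_mul_of_nonneg_left h1 (by positivity)
    · obtain ⟨hK, hMK⟩ := hpos hκ
      -- This constant gives `c (1 + |z|²) ≤ h`.
      set c := min 1 κ with hc
      have hc0 : 0 < c := lt_min one_pos hκ
      refine ((integrable_inv_one_add_norm_sq_sq.const_mul
        (2 ^ M * (c ^ (K + 2))⁻¹)).integrableOn).mono' hm ?_
      filter_upwards [ae_restrict_mem (isOpen_surface κ).measurableSet] with z hz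
      have hz' : 0 < h κ z := hz
      rw [Real.norm_of_nonneg (by positivity), hsq, radialWeight_sq hκ hK hz]
      have hle : c * (1 + ‖z‖ ^ 2) ≤ h κ z := by
        have h1 : c * ‖z‖ ^ 2 ≤ κ * ‖z‖ ^ 2 :=
          mul_le_mul_of_nonneg_right (min_le_right _ _) (by positivity)
        have h2 : c ≤ 1 := min_le_left _ _
        unfold h; linarith
      have hx1 : 1 ≤ 1 + ‖z‖ ^ 2 := by nlinarith [sq_nonneg ‖z‖]
      have h5 : c ^ (K + 2) * (1 + ‖z‖ ^ 2) ^ (K + 2) ≤ h κ z ^ (K + 2) := by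
        rw [← mul_pow]; exact pow_le_pow_left₀ (by positivity) hle _
      change (h κ z ^ 2)⁻¹ * ((h κ z ^ K)⁻¹ * (1 + ‖z‖) ^ (2 * M)) ≤ _
      calc _ = (1 + ‖z‖) ^ (2 * M) / h κ z ^ (K + 2) := by rw [pow_add]; field_simp
        _ ≤ (2 ^ M * (1 + ‖z‖ ^ 2) ^ K) / (c ^ (K + 2) * (1 + ‖z‖ ^ 2) ^ (K + 2)) := by
          refine div_le_div₀ (by positivity) ((h12 z).trans ?_) (by positivity) h5
          exact mul_le_mul_of_nonneg_left (pow_le_pow_right₀ hx1 hMK) (by positivity)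
        _ = _ := by rw [pow_add _ K 2, pow_add _ K 2]; field_simp
  refine MemLp.of_le_mul (c := C) hW2 hf ?_
  filter_upwards [hC, ae_vol_mem_surface κ] with z hz hzs
  rwa [Complex.norm_real, Real.norm_of_nonneg]
  exact mul_nonneg (radialWeight_pos hzs).le (by positivity)

theorem not_integrableOn_inv_norm_sq_ball {δ : ℝ} (hδ : 0 < δ) :
    ¬ IntegrableOn (fun z : ℂ => (‖z‖ ^ 2)⁻¹) {z | ‖z‖ ∈ Iic δ} := by
  rw [integrableOn_radial_iff (f := fun r => (r ^ 2)⁻¹) measurableSet_Iic, Ioi_inter_Iic]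
  intro hI
  have : IntervalIntegrable (fun x : ℝ => x⁻¹) volume 0 δ := by
    rw [intervalIntegrable_iff_integrableOn_Ioc_of_le hδ.le]
    refine hI.congr_fun (fun r hr => ?_) measurableSet_Ioc
    have := hr.1.ne'
    simp only; field_simp
  rw [intervalIntegrable_inv_iff] at this
  rcases this with h | h
  · exact hδ.ne h
  · exact h left_mem_uIcc

theorem not_integrableOn_inv_norm_sq_compl_ball :
    ¬ IntegrableOn (fun z : ℂ => (‖z‖ ^ 2)⁻¹) {z | ‖z‖ ∈ Ioi 1} := by
  rw [integrableOn_radial_iff (f := fun r => (r ^ 2)⁻¹) measurableSet_Ioi, Ioi_inter_Ioi]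
  intro hI
  refine not_integrableOn_Ioi_inv (a := 1) ?_
  simp only [zero_le_one, sup_of_le_right] at hI
  refine hI.congr_fun (fun r hr => ?_) measurableSet_Ioi
  have : r ≠ 0 := (one_pos.trans hr).ne'
  simp only; field_simp

/-- The comparison function `|z|⁻²` is the borderline case in the plane: it is integrable neither at
the origin nor at infinity. Both failures are used. -/
theorem not_memLp_of_le {κ c : ℝ} {f : ℂ → ℂ} {S : Set ℂ} (hS : MeasurableSet S)
    (hSs : S ⊆ surface κ) (hc : 0 < c)
    (hn : ¬ IntegrableOn (fun z : ℂ => (‖z‖ ^ 2)⁻¹) S)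
    (hf : ∀ z ∈ S, z ≠ 0 → c * (‖z‖ ^ 2)⁻¹ ≤ (h κ z ^ 2)⁻¹ * ‖f z‖ ^ 2) :
    ¬ MemLp f 2 (vol κ) := by
  intro hm
  refine hn ?_
  have h1 := ((memLp_vol_two_iff hm.1).1 hm).mono_set hSs
  refine (h1.const_mul c⁻¹).mono' (Measurable.aestronglyMeasurable (by fun_prop)) ?_
  filter_upwards [ae_restrict_mem hS, ae_restrict_of_ae (Measure.ae_ne volume (0 : ℂ))] with z hz h0
  rw [Real.norm_of_nonneg (by positivity), inv_mul_eq_div, le_div_iff₀ hc, mul_comm]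
  exact hf z hz h0

/-! ### The functions `Psi` -/

/-- The standing assumptions on the parameters: for `κ < 0` the `m`-th eigenvalue lies in the
discrete part of the spectrum, for `κ > 0` the number `2ν/κ` is a positive integer. -/
structure Admissible (κ ν : ℝ) (m : ℕ) : Prop where
  pos : 0 < ν
  top_pos : 0 < ν + m * κ
  of_neg : κ < 0 → -κ < 2 * (ν + m * κ)
  of_pos : 0 < κ → ∃ N : ℕ, 0 < N ∧ 2 * ν = κ * N

theorem contDiffOn_weight_mul_pow (κ ν : ℝ) (m n : ℕ) :
    ContDiffOn ℝ ∞ (fun z => (weight κ ν m z : ℂ) * z ^ n) (surface κ) := by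
  intro z hz
  simp only [weight_eq]
  exact (ContDiffAt.mul (contDiffAt_radial
    (contDiffAt_ofReal_radialWeight (ν + m * κ) (x := ‖z‖ ^ 2) hz)) (by fun_prop)).contDiffWithinAt

theorem contDiffOn_Psi (κ ν : ℝ) (m n : ℕ) : ContDiffOn ℝ ∞ (Psi κ ν m n) (surface κ) :=
  contDiffOn_nablaComp (isOpen_surface κ) κ ν m (contDiffOn_weight_mul_pow κ ν m n)

theorem lower_weight_mul_pow (κ ν : ℝ) (m n : ℕ) {z : ℂ} (hz : z ∈ surface κ) :
    lower κ (ν + m * κ) (fun z => (weight κ ν m z : ℂ) * z ^ n) z = 0 := by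
  simp only [weight_eq]
  have h1 := ((hasDerivAt_radialWeight (ν + m * κ) (x := ‖z‖ ^ 2) hz).ofReal_comp)
  have hd : HasFDerivAt (fun w : ℂ => w ^ n) ((n * z ^ (n - 1)) • (1 : ℂ →L[ℝ] ℂ)) z :=
    (hasDerivAt_pow n z).complexToReal_fderiv
  have h2 : dzbar (fun w : ℂ => w ^ n) z = 0 := by
    rw [dzbar, hd.fderiv]
    simp only [smul_apply, one_apply_eq_self, smul_eq_mul]
    linear_combination ((n * z ^ (n - 1)) / 2 : ℂ) * Complex.I_mul_I
  rw [lower, dzbar_mul (hasFDerivAt_radial h1).differentiableAt hd.differentiableAt,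
    dzbar_radial h1, h2]
  have h0 := ofReal_h_ne_zero hz
  rw [ofReal_h_eq] at h0 ⊢
  push_cast at h0 ⊢
  field_simp
  ring

theorem nabla_zero (κ α : ℝ) : nabla κ α (fun _ => 0) = fun _ => 0 := by
  funext z; simp [nabla]

theorem nablaComp_zero (κ ν : ℝ) (m : ℕ) : nablaComp κ ν m (fun _ => 0) = fun _ => 0 := by
  induction m with
  | zero => rfl
  | succ m ih => rw [nablaComp, nabla_zero, ih]

theorem twistedLaplacian_nablaComp_of_lower_eq_zero {κ ν : ℝ} {m : ℕ} {f : ℂ → ℂ} {U : Set ℂ}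
    (hU : IsOpen U) (hf : ContDiffOn ℝ ∞ f U) (h0 : ∀ z ∈ U, lower κ (ν + m * κ) f z = 0)
    {z : ℂ} (hz : z ∈ U) :
    twistedLaplacian κ ν (nablaComp κ ν m f) z = (eigenvalue κ ν m : ℂ) * nablaComp κ ν m f z := by
  have h1 := twistedLaplacian_nablaComp κ hU hf m ν hz
  have h2 : EqOn (lower κ (ν + m * κ) f) (fun _ => 0) U := h0
  rw [nablaComp_congr hU m (nabla_congr hU h2) hz, nabla_zero, nablaComp_zero] at h1
  exact sub_eq_zero.1 h1

theorem twistedLaplacian_Psi (κ ν : ℝ) (m n : ℕ) {z : ℂ} (hz : z ∈ surface κ) :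
    twistedLaplacian κ ν (Psi κ ν m n) z = (eigenvalue κ ν m : ℂ) * Psi κ ν m n z :=
  twistedLaplacian_nablaComp_of_lower_eq_zero (isOpen_surface κ)
    (contDiffOn_weight_mul_pow κ ν m n) (fun _ h => lower_weight_mul_pow κ ν m n h) hz

theorem lowerComp_const_mul {U : Set ℂ} (hU : IsOpen U) (κ : ℝ) (m : ℕ) (ν : ℝ) (c : ℂ) {f : ℂ → ℂ}
    (hf : ContDiffOn ℝ ∞ f U) :
    EqOn (lowerComp κ ν m fun w => c * f w) (fun z => c * lowerComp κ ν m f z) U := by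
  induction m generalizing f ν with
  | zero => exact fun z _ => rfl
  | succ m ih =>
    refine (lowerComp_congr hU m fun z hz => lower_const_mul _ _ c
      (differentiableAt_of_contDiffOn hf hU hz)).trans ?_
    exact ih (ν + κ) (contDiffOn_lower hf hU _ _)

/-- The counterpart of `nablaComp_lowerComp` on the lowest eigenspace. -/
theorem lowerComp_nablaComp {κ : ℝ} (m : ℕ) {ν : ℝ} {f : ℂ → ℂ} {U : Set ℂ} (hU : IsOpen U)
    (hf : ContDiffOn ℝ ∞ f U) (h0 : ∀ z ∈ U, lower κ (ν + m * κ) f z = 0) :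
    EqOn (lowerComp κ ν m (nablaComp κ ν m f)) (fun z => (ladderConst κ ν m : ℂ) * f z) U := by
  induction m generalizing ν with
  | zero => intro z _; simp [lowerComp, nablaComp, ladderConst]
  | succ m ih =>
    have e : ν + κ + m * κ = ν + ((m + 1 : ℕ) : ℝ) * κ := by push_cast; ring
    rw [← e] at h0
    have hg := contDiffOn_nablaComp hU κ (ν + κ) m hf
    have h1 : EqOn (lower κ ν (nablaComp κ ν (m + 1) f))
        (fun z => ((eigenvalue κ ν (m + 1) - ν : ℝ) : ℂ) * nablaComp κ (ν + κ) m f z) U := by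
      intro z hz
      rw [nablaComp_succ, lower_nabla κ ν hU hg hz,
        twistedLaplacian_nablaComp_of_lower_eq_zero hU hf h0 hz, eigenvalue_succ]
      push_cast; ring
    intro z hz
    rw [lowerComp, lowerComp_congr hU m h1 hz, lowerComp_const_mul hU κ m _ _ hg hz]
    simp only
    rw [ih h0 hz, ladderConst]
    push_cast; ring

theorem exists_closedBall_subset_surface (κ : ℝ) :
    ∃ δ > 0, δ ≤ 1 ∧ Metric.closedBall (0 : ℂ) δ ⊆ surface κ := by
  obtain ⟨ε, hε, h⟩ := Metric.nhds_basis_closedBall.mem_iff.1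
    ((isOpen_surface κ).mem_nhds (zero_mem_surface κ))
  exact ⟨min ε 1, lt_min hε one_pos, min_le_right _ _,
    (Metric.closedBall_subset_closedBall (min_le_left _ _)).trans h⟩

/-- If `Psi` vanished on `M_κ`, so would its image under `A^(m)`, which is a positive multiple of `w
zⁿ`. -/
theorem exists_Psi_ne_zero {κ ν : ℝ} {m : ℕ} (hA : Admissible κ ν m) (n : ℕ) :
    ∃ z ∈ surface κ, Psi κ ν m n z ≠ 0 := by
  by_contra! hn
  have h1 : EqOn (Psi κ ν m n) (fun z => 0 * Psi κ ν m n z) (surface κ) := fun z hz => by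
    simp [hn z hz]
  have h2 := lowerComp_nablaComp m (ν := ν) (isOpen_surface κ)
    (contDiffOn_weight_mul_pow κ ν m n) fun z hz => lower_weight_mul_pow κ ν m n hz
  obtain ⟨δ, hδ, -, hδs⟩ := exists_closedBall_subset_surface κ
  have hz : (δ : ℂ) ∈ surface κ := hδs (by simp [abs_of_pos hδ])
  have h3 := lowerComp_congr (isOpen_surface κ) m (κ := κ) (ν := ν) h1 hz
  rw [lowerComp_const_mul (isOpen_surface κ) κ m ν 0 (contDiffOn_Psi κ ν m n) hz] at h3
  have h4 := (h2 hz).symm.trans h3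
  simp only [zero_mul, mul_eq_zero, Complex.ofReal_eq_zero] at h4
  rcases h4 with h | h | h
  · exact (ladderConst_pos m hA.pos hA.top_pos).ne' h
  · rw [weight_eq] at h
    exact (radialWeight_pos hz).ne' h
  · exact pow_ne_zero n (Complex.ofReal_ne_zero.2 hδ.ne') h

theorem ae_vol_iff {κ : ℝ} {p : ℂ → Prop} :
    (∀ᵐ z ∂(vol κ), p z) ↔ ∀ᵐ z ∂(volume.restrict (surface κ)), p z := by
  constructor
  · intro h
    refine (withDensity_absolutelyContinuous' (measurable_density κ).aemeasurable ?_).ae_le h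
    filter_upwards [ae_restrict_mem (isOpen_surface κ).measurableSet] with z hz
    have : 0 < TwistedLaplacian.h κ z := hz
    simp only [ne_eq, ENNReal.ofReal_eq_zero, not_le]
    positivity
  · intro h
    exact (withDensity_absolutelyContinuous _ _).ae_le h

theorem eqOn_zero_of_ae_vol {κ : ℝ} {f : ℂ → ℂ} (hf : ContinuousOn f (surface κ))
    (h0 : ∀ᵐ z ∂(vol κ), f z = 0) : EqOn f (fun _ => 0) (surface κ) :=
  Measure.eqOn_open_of_ae_eq (ae_vol_iff.1 h0) (isOpen_surface κ) hf continuousOn_const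

theorem aestronglyMeasurable_vol {κ : ℝ} {f : ℂ → ℂ} (hf : ContinuousOn f (surface κ)) :
    AEStronglyMeasurable f (vol κ) :=
  (hf.aestronglyMeasurable (isOpen_surface κ).measurableSet).mono_ac
    (withDensity_absolutelyContinuous _ _)

/-- Away from the origin the left side is comparable to `r^(j+2D)`; the missing `t = M - j - 2D`
powers of `r` cost at most `δ^(-t)`. -/
theorem zpow_mul_le {j : ℤ} {D M : ℕ} (hj : j + 2 * D ≤ M) {δ : ℝ} (hδ : 0 < δ) :
    ∃ C, 0 ≤ C ∧ ∀ r, δ ≤ r → r ^ j * (1 + r ^ 2) ^ D ≤ C * (1 + r) ^ M := by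
  obtain ⟨t, ht⟩ : ∃ t : ℕ, (t : ℤ) = M - (j + 2 * D) := ⟨(M - (j + 2 * D)).toNat, by omega⟩
  refine ⟨(1 + (δ ^ 2)⁻¹) ^ D * (δ⁻¹) ^ t, by positivity, fun r hr => ?_⟩
  have hr0 : 0 < r := hδ.trans_le hr
  have h1 : 1 + r ^ 2 ≤ (1 + (δ ^ 2)⁻¹) * r ^ 2 := by
    have : 1 ≤ (δ ^ 2)⁻¹ * r ^ 2 := by
      rw [inv_mul_eq_div, le_div_iff₀ (by positivity), one_mul]
      exact pow_le_pow_left₀ hδ.le hr 2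
    linarith
  have h2 : r ^ j * (r ^ 2) ^ D = (r⁻¹) ^ t * r ^ M := by
    rw [← zpow_natCast, ← zpow_natCast (r⁻¹), ← zpow_natCast r M, inv_zpow', ← zpow_natCast r 2,
      ← zpow_mul, ← zpow_add₀ hr0.ne', ← zpow_add₀ hr0.ne', ht]
    congr 1; push_cast; ring
  calc r ^ j * (1 + r ^ 2) ^ D ≤ r ^ j * ((1 + (δ ^ 2)⁻¹) * r ^ 2) ^ D :=
        mul_le_mul_of_nonneg_left (pow_le_pow_left₀ (by positivity) h1 D) (by positivity)
    _ = (1 + (δ ^ 2)⁻¹) ^ D * ((r⁻¹) ^ t * r ^ M) := by rw [mul_pow, ← h2]; ring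
    _ ≤ (1 + (δ ^ 2)⁻¹) ^ D * ((δ⁻¹) ^ t * (1 + r) ^ M) := by
        refine mul_le_mul_of_nonneg_left (mul_le_mul ?_ ?_ (by positivity) (by positivity))
          (by positivity)
        · exact pow_le_pow_left₀ (by positivity) (inv_anti₀ hδ hr) t
        · exact pow_le_pow_left₀ hr0.le (by linarith) M
    _ = _ := by ring

theorem norm_mode (k : ℤ) (g : ℝ → ℂ) (z : ℂ) : ‖mode k g z‖ = ‖z‖ ^ k * ‖g (‖z‖ ^ 2)‖ := by
  simp [mode]

/-- Near the origin `Psi` is continuous on a compact ball. The polar form, which may contain a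
negative power of `z`, is used only outside that ball. -/
theorem memLp_Psi_of_natDegree {κ ν : ℝ} {m n : ℕ} (hA : Admissible κ ν m) {K M D : ℕ}
    (hpos : 0 < κ → 2 * (ν + m * κ) = κ * K ∧ M ≤ K)
    (hD : (radPoly κ (ν + (ν + m * κ)) m n 1).natDegree ≤ D)
    (hM : (n : ℤ) - m + 2 * D ≤ M) : MemLp (Psi κ ν m n) 2 (vol κ) := by
  obtain ⟨δ, hδ, -, hδs⟩ := exists_closedBall_subset_surface κ
  set B := Metric.closedBall (0 : ℂ) δ with hB
  have hcont := (contDiffOn_Psi κ ν m n).continuousOn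
  have hBm : MeasurableSet B := Metric.isClosed_closedBall.measurableSet
  have h1 : MemLp (B.indicator (Psi κ ν m n)) 2 (vol κ) :=
    memLp_indicator_of_isCompact (isCompact_closedBall 0 δ) hδs (hcont.mono hδs) 2
  obtain ⟨C₁, hC₁, hb₁⟩ := exists_abs_eval_le _ hD
  obtain ⟨C₂, hC₂, hb₂⟩ := zpow_mul_le hM hδ
  have h2 : MemLp (Bᶜ.indicator (Psi κ ν m n)) 2 (vol κ) := by
    refine memLp_of_norm_le_weight (K := K) (M := M) (C := C₁ * C₂) hA.top_pos hA.of_neg hpos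
      ((aestronglyMeasurable_vol hcont).indicator hBm.compl) ?_
    filter_upwards [ae_vol_mem_surface κ] with z hz
    have hw := (radialWeight_pos (ν := ν + m * κ) hz).le
    by_cases hzB : z ∈ B
    · rw [indicator_of_notMem (by simpa using hzB), norm_zero]
      positivity
    · have hzδ : δ < ‖z‖ := by simpa [hB] using hzB
      have hz0 : z ≠ 0 := norm_pos_iff.1 (hδ.trans hzδ)
      rw [indicator_of_mem (by simpa using hzB), Psi_eq_mode κ ν m n ⟨hz, hz0⟩, norm_mode, norm_mul,
        Complex.norm_real, Complex.norm_real, Real.norm_of_nonneg hw, Real.norm_eq_abs]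
      have e1 := hb₁ (‖z‖ ^ 2) (by positivity)
      have e2 := hb₂ ‖z‖ hzδ.le
      calc _ ≤ ‖z‖ ^ ((n : ℤ) - m) * (radialWeight κ (ν + m * κ) (‖z‖ ^ 2)
              * (C₁ * (1 + ‖z‖ ^ 2) ^ D)) := by gcongr
        _ = C₁ * radialWeight κ (ν + m * κ) (‖z‖ ^ 2)
              * (‖z‖ ^ ((n : ℤ) - m) * (1 + ‖z‖ ^ 2) ^ D) := by ring
        _ ≤ C₁ * radialWeight κ (ν + m * κ) (‖z‖ ^ 2) * (C₂ * (1 + ‖z‖) ^ M) := by gcongr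
        _ = _ := by ring
  have := h1.add h2
  rwa [indicator_self_add_compl] at this

open Polynomial in
-- As all coefficients have sign `(-1)^m` or vanish, the polynomial is at least `c x^m` in absolute
-- value. The integrand then dominates `x^(n+m-K-2)`, hence `x⁻¹` for `|z| > 1`, because `n > K`.
theorem not_memLp_Psi {κ ν : ℝ} {m n K : ℕ} (hA : Admissible κ ν m) (hκ : 0 < κ)
    (hK : 2 * (ν + m * κ) = κ * K) (hmK : m ≤ K) (hn : K < n) :
    ¬ MemLp (Psi κ ν m n) 2 (vol κ) := by
  set p := radPoly κ (ν + (ν + m * κ)) m n 1 with hp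
  have hm0 : (0 : ℝ) ≤ m * κ := by positivity
  have hsign := coeff_radPoly_sign hκ (c := ν + (ν + m * κ)) (by linarith [hA.pos]) m
    (k := (n : ℤ)) (by
      have : (K : ℝ) < n := by exact_mod_cast hn
      have := mul_lt_mul_of_pos_left this hκ
      push_cast; linarith) (p := 1) 0
    (fun d => by simp only [pow_zero, one_mul, coeff_one]; split_ifs <;> norm_num)
    (by simp)
  rw [← hp, zero_add] at hsign
  set c := (-1 : ℝ) ^ m * p.coeff m with hc
  have hpc : ∀ x, 0 ≤ x → c * x ^ m ≤ |p.eval x| := by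
    intro x hx
    have h1 : (-1 : ℝ) ^ m * p.eval x
        = ∑ i ∈ Finset.range (p.natDegree + m + 1), (-1) ^ m * p.coeff i * x ^ i := by
      rw [eval_eq_sum_range' (n := p.natDegree + m + 1) (by omega), Finset.mul_sum]
      simp only [mul_assoc]
    have h2 : c * x ^ m ≤ (-1 : ℝ) ^ m * p.eval x := by
      rw [h1]
      exact Finset.single_le_sum (f := fun i => (-1) ^ m * p.coeff i * x ^ i)
        (fun i _ => mul_nonneg (hsign.1 i) (by positivity))
        (Finset.mem_range.2 (show m < p.natDegree + m + 1 by omega))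
    refine h2.trans ((le_abs_self _).trans ?_)
    simp [abs_mul]
  have hc0 : 0 < c := hsign.2
  clear_value c
  -- The factor `(1 + κ)^(K+2)` stems from `h ≤ (1 + κ)|z|²` for `|z| ≥ 1`.
  refine not_memLp_of_le (S := {z | ‖z‖ ∈ Ioi 1}) (measurable_norm measurableSet_Ioi)
    (fun z _ => ?_) (c := c ^ 2 * ((1 + κ) ^ (K + 2))⁻¹) (by positivity)
    not_integrableOn_inv_norm_sq_compl_ball fun z hz hz0 => ?_
  · show 0 < h κ z
    unfold h; positivity
  · have hz1 : 1 < ‖z‖ := hz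
    have hzs : z ∈ surface κ := by show 0 < h κ z; unfold h; positivity
    have hh : 0 < h κ z := hzs
    obtain ⟨t, rfl⟩ : ∃ t, n = K + 1 + t := ⟨n - (K + 1), by omega⟩
    obtain ⟨s, rfl⟩ : ∃ s, K = m + s := ⟨K - m, by omega⟩
    have hx1 : 1 ≤ ‖z‖ ^ 2 := by nlinarith
    have hle : h κ z ≤ (1 + κ) * ‖z‖ ^ 2 := by unfold h; nlinarith
    have e1 : ((m + s + 1 + t : ℕ) : ℤ) - m = ((s + 1 + t : ℕ) : ℤ) := by push_cast; ring
    rw [Psi_eq_mode κ ν m _ ⟨hzs, hz0⟩, norm_mode, norm_mul, Complex.norm_real, Complex.norm_real,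
      Real.norm_of_nonneg (radialWeight_pos hzs).le, Real.norm_eq_abs, mul_pow, mul_pow,
      radialWeight_sq hκ hK hzs, e1, zpow_natCast, ← pow_mul, mul_comm _ 2, pow_mul]
    change _ ≤ (h κ z ^ 2)⁻¹ * ((‖z‖ ^ 2) ^ (s + 1 + t) * ((h κ z ^ (m + s))⁻¹ * |p.eval _| ^ 2))
    have e2 := pow_le_pow_left₀ (by positivity) (hpc (‖z‖ ^ 2) (by positivity)) 2
    have e3 : h κ z ^ (m + s + 2) ≤ ((1 + κ) * ‖z‖ ^ 2) ^ (m + s + 2) :=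
      pow_le_pow_left₀ hh.le hle _
    set x := ‖z‖ ^ 2 with hx
    have hx0 : 0 < x := by linarith
    calc c ^ 2 * ((1 + κ) ^ (m + s + 2))⁻¹ * x⁻¹
        ≤ c ^ 2 * ((1 + κ) ^ (m + s + 2))⁻¹ * x⁻¹ * x ^ (t + m) :=
          le_mul_of_one_le_right (by positivity) (one_le_pow₀ hx1)
      _ = x ^ (s + 1 + t) * (c * x ^ m) ^ 2 / ((1 + κ) * x) ^ (m + s + 2) := by
          rw [mul_pow (1 + κ)]; field_simp; ring
      _ ≤ x ^ (s + 1 + t) * |p.eval x| ^ 2 / h κ z ^ (m + s + 2) := by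
          refine div_le_div₀ (by positivity) ?_ (by positivity) e3
          exact mul_le_mul_of_nonneg_left e2 (by positivity)
      _ = _ := by rw [pow_add _ (m + s) 2]; field_simp

theorem memLp_Psi_iff {κ ν : ℝ} {m : ℕ} (hA : Admissible κ ν m) (n : ℕ) :
    MemLp (Psi κ ν m n) 2 (vol κ) ↔ (0 < κ → (n : ℝ) ≤ 2 * (ν / κ + m)) := by
  have hdeg : (radPoly κ (ν + (ν + m * κ)) m n 1).natDegree ≤ m := by
    have := natDegree_radPoly_le κ (ν + (ν + m * κ)) m n (p := 1) (s := 0) (by simp)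
    simpa using this
  rcases le_or_gt κ 0 with hκ | hκ
  · refine ⟨fun _ h => absurd h hκ.not_gt, fun _ => ?_⟩
    -- For `κ ≤ 0` every power of `|z|` is allowed, so the degree bound `m` alone suffices, with `M
    -- = (n - m) + 2m`.
    exact memLp_Psi_of_natDegree hA (K := 0) (M := n + m) (fun h => absurd h hκ.not_gt) hdeg
      (by push_cast; linarith)
  · obtain ⟨N, hN, hN'⟩ := hA.of_pos hκ
    have hK : 2 * (ν + m * κ) = κ * (N + 2 * m : ℕ) := by push_cast; linarith
    have e : 2 * (ν / κ + m) = (N + 2 * m : ℕ) := by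
      have : ν = κ * N / 2 := by linarith
      rw [this]; push_cast; field_simp
    simp only [hκ, forall_const, e, Nat.cast_le]
    constructor
    · intro hm
      by_contra hn
      exact not_memLp_Psi hA hκ hK (by omega) (not_le.1 hn) hm
    · intro hn
      -- With `n + r = N + 2m` the degree is at most both `m` and `r`, so `n - m + 2 min(m, r) ≤ n +
      -- r`, which is the largest growth allowed.
      obtain ⟨r, hr⟩ := Nat.exists_eq_add_of_le hn
      have hdeg' := natDegree_radPoly_le_of_eq κ (ν + (ν + m * κ)) m r (k := (n : ℤ)) (by
        have : ((N + 2 * m : ℕ) : ℝ) = n + r := by rw [hr]; push_cast; ring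
        rw [this] at hK
        push_cast; linarith) (p := 1) (by simp)
      exact memLp_Psi_of_natDegree hA (K := N + 2 * m) (M := N + 2 * m) (fun _ => ⟨hK, le_rfl⟩)
        (le_min hdeg hdeg') (by omega)

/-- The continuation of `Psi` to negative exponents is not square integrable at the origin. -/
theorem not_memLp_mode_of_neg {κ ν c : ℝ} (m : ℕ) {k : ℤ} (hk : k < 0) :
    ¬ MemLp (mode (k - m) fun x => (radialWeight κ ν x : ℂ) *
      ((radPoly κ c m k 1).eval x : ℝ)) 2 (vol κ) := by
  set p := radPoly κ c m k 1 with hp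
  -- The squared modulus times the density, without the power of `|z|`. It is continuous and
  -- positive at `0`, so the integrand is at least a multiple of `|z|^(2(k-m))` with `k - m ≤ -1`.
  set g : ℝ → ℝ := fun x => ((1 + κ * x) ^ 2)⁻¹ * (radialWeight κ ν x * p.eval x) ^ 2 with hg
  have hw0 : (0 : ℝ) < 1 + κ * 0 := by simp
  have hg0 : 0 < g 0 := by
    have h1 : 0 < p.coeff 0 := coeff_zero_radPoly_pos κ c m hk (by simp)
    have h2 := radialWeight_pos (ν := ν) hw0
    rw [Polynomial.coeff_zero_eq_eval_zero] at h1
    simp only [hg]; positivity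
  have hgc : ContinuousAt g 0 := by
    refine ContinuousAt.mul (ContinuousAt.inv₀ (by fun_prop) (by simp)) (ContinuousAt.pow ?_ 2)
    exact (contDiffAt_radialWeight ν hw0).continuousAt.mul p.continuous.continuousAt
  obtain ⟨ε, hε, hεg⟩ := Metric.eventually_nhds_iff.1
    (hgc.eventually (lt_mem_nhds (half_lt_self hg0)))
  obtain ⟨δ, hδ, hδ1, hδs⟩ := exists_closedBall_subset_surface κ
  set η := min δ (ε / 2) with hη
  have hη0 : 0 < η := lt_min hδ (by positivity)
  have hsub : {z : ℂ | ‖z‖ ∈ Iic η} ⊆ surface κ := fun z hz =>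
    hδs (by simpa using (show ‖z‖ ≤ η from hz).trans (min_le_left _ _))
  refine not_memLp_of_le (measurable_norm measurableSet_Iic) hsub (half_pos hg0)
    (not_integrableOn_inv_norm_sq_ball hη0) fun z hz hz0 => ?_
  have hzη : ‖z‖ ≤ η := hz
  have hz1 : ‖z‖ ≤ 1 := hzη.trans ((min_le_left _ _).trans hδ1)
  have hzpos : 0 < ‖z‖ := norm_pos_iff.2 hz0
  have hx : g 0 / 2 < g (‖z‖ ^ 2) := hεg (by
    rw [dist_zero_right, Real.norm_of_nonneg (by positivity)]
    have : ‖z‖ ≤ ε / 2 := hzη.trans (min_le_right _ _)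
    nlinarith)
  have e1 : (‖z‖ ^ 2)⁻¹ ≤ (‖z‖ ^ (k - m)) ^ 2 := by
    rw [← inv_pow]
    refine pow_le_pow_left₀ (by positivity) ?_ 2
    rw [← zpow_neg_one]
    exact zpow_le_zpow_right_of_le_one₀ hzpos hz1 (by omega)
  rw [norm_mode, norm_mul, Complex.norm_real, Complex.norm_real, ← norm_mul, mul_pow, Real.norm_eq_abs,
    sq_abs]
  calc g 0 / 2 * (‖z‖ ^ 2)⁻¹ ≤ g (‖z‖ ^ 2) * (‖z‖ ^ (k - m)) ^ 2 :=
        mul_le_mul hx.le e1 (by positivity) (by positivity)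
    _ = _ := by simp only [hg, h]; ring

/-! ### Rotation invariance and orthogonality of different angular momenta -/

theorem integral_vol_rotate (κ : ℝ) {u : ℂ} (hu : ‖u‖ = 1) (f : ℂ → ℂ) :
    ∫ z, f (u * z) ∂(vol κ) = ∫ z, f z ∂(vol κ) := by
  rw [integral_vol, integral_vol, ← integral_indicator (isOpen_surface κ).measurableSet,
    ← integral_indicator (isOpen_surface κ).measurableSet]
  set e := rotation (⟨u, by simpa [Submonoid.unitSphere] using hu⟩ : Circle)
  conv_rhs => rw [← e.measurePreserving.integral_comp e.toHomeomorph.measurableEmbedding]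
  refine integral_congr_ae (Eventually.of_forall fun z => ?_)
  have h1 : h κ (u * z) = h κ z := by simp [h, hu]
  have h2 : u * z ∈ surface κ ↔ z ∈ surface κ := by simp [surface, h1]
  have h3 : e z = u * z := rfl
  simp only
  rw [h3]
  by_cases hz : z ∈ surface κ
  · rw [indicator_of_mem hz, indicator_of_mem (h2.2 hz), h1]
  · rw [indicator_of_notMem hz, indicator_of_notMem (mt h2.1 hz)]

/-- Rotation by the angle `π / (j - k)` changes the sign of the integrand. No integrability is
needed: the change of variables is also valid for the default value of the integral. -/
theorem integral_mode_mul_conj_mode (κ : ℝ) {j k : ℤ} (hjk : j ≠ k) (f g : ℝ → ℂ) :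
    ∫ z, mode j f z * conj (mode k g z) ∂(vol κ) = 0 := by
  set u : ℂ := Complex.exp ((Real.pi / (j - k) : ℝ) * Complex.I) with hu
  have hu1 : ‖u‖ = 1 := Complex.norm_exp_ofReal_mul_I _
  have hu0 : u ≠ 0 := Complex.exp_ne_zero _
  have hjk' : ((j : ℂ) - k) ≠ 0 := sub_ne_zero.2 (by exact_mod_cast hjk)
  have h1 : u ^ (j - k) = -1 := by
    rw [hu, ← Complex.exp_int_mul, ← Complex.exp_pi_mul_I]
    congr 1; push_cast; field_simp
  have h2 : conj u = u⁻¹ := by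
    rw [Complex.inv_def, Complex.normSq_eq_norm_sq, hu1]; simp
  have h3 := integral_vol_rotate κ hu1 fun z => mode j f z * conj (mode k g z)
  have h4 : ∀ z, mode j f (u * z) * conj (mode k g (u * z))
      = -(mode j f z * conj (mode k g z)) := by
    intro z
    have : u ^ j * (u⁻¹) ^ k = -1 := by
      rw [inv_zpow', ← zpow_add₀ hu0, ← sub_eq_add_neg, h1]
    simp only [mode, norm_mul, hu1, one_mul, mul_zpow, map_mul, map_zpow₀, h2]
    linear_combination (z ^ j * f (‖z‖ ^ 2) * (conj z ^ k * conj (g (‖z‖ ^ 2)))) * this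
  simp only [h4, integral_neg] at h3
  exact self_eq_neg.1 h3.symm

theorem integral_Psi_mul_conj_Psi (κ ν : ℝ) (m : ℕ) {n n' : ℕ} (hn : n ≠ n') :
    ∫ z, Psi κ ν m n z * conj (Psi κ ν m n' z) ∂(vol κ) = 0 := by
  rw [← integral_mode_mul_conj_mode κ (j := (n : ℤ) - m) (k := (n' : ℤ) - m) (by omega)
    (fun x => (radialWeight κ (ν + m * κ) x : ℂ) *
      ((radPoly κ (ν + (ν + m * κ)) m n 1).eval x : ℝ))
    (fun x => (radialWeight κ (ν + m * κ) x : ℂ) *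
      ((radPoly κ (ν + (ν + m * κ)) m n' 1).eval x : ℝ))]
  refine integral_congr_ae ?_
  filter_upwards [ae_vol_mem_surface κ, ae_vol_ne_zero κ] with z hz hz0
  rw [Psi_eq_mode κ ν m n ⟨hz, hz0⟩, Psi_eq_mode κ ν m n' ⟨hz, hz0⟩]

/-! ### Test functions with a fixed angular momentum -/

/-- Smooth functions of `x = |z|²` whose support is a compact subset of `radii κ`. -/
structure IsAnnular (κ : ℝ) (g : ℝ → ℂ) : Prop where
  smooth : ContDiff ℝ ∞ g
  bounds : ∃ a b, 0 < a ∧ 0 < 1 + κ * b ∧ ∀ x, x ∉ Icc a b → g x = 0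

theorem Icc_subset_radii {κ a b : ℝ} (ha : 0 < a) (hb : 0 < 1 + κ * b) : Icc a b ⊆ radii κ := by
  intro x hx
  have hx0 : 0 < x := ha.trans_le hx.1
  refine ⟨hx0, ?_⟩
  rcases le_total 0 κ with h | h
  · positivity
  · nlinarith [hx.2]

theorem IsAnnular.eq_zero {κ : ℝ} {g : ℝ → ℂ} (hg : IsAnnular κ g) {x : ℝ} (hx : x ∉ radii κ) :
    g x = 0 := by
  obtain ⟨a, b, ha, hb, h0⟩ := hg.bounds
  exact h0 x fun h => hx (Icc_subset_radii ha hb h)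

/-- The weight and `logCoord` are meaningful only on `radii κ`; the indicator discards their values
elsewhere. It keeps smoothness, since the function already vanishes off a compact subset of `radii
κ`. -/
theorem isAnnular_indicator {κ a b : ℝ} (ha : 0 < a) (hb : 0 < 1 + κ * b) {u : ℝ → ℂ}
    (hu : ContDiffOn ℝ ∞ u (radii κ)) (h0 : ∀ x ∈ radii κ, x ∉ Icc a b → u x = 0) :
    IsAnnular κ ((radii κ).indicator u) := by
  have h0' : ∀ x, x ∉ Icc a b → (radii κ).indicator u x = 0 := fun x hx => by
    by_cases h : x ∈ radii κ
    · rw [indicator_of_mem h, h0 x h hx]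
    · rw [indicator_of_notMem h]
  refine ⟨contDiff_iff_contDiffAt.2 fun x => ?_, a, b, ha, hb, h0'⟩
  by_cases hx : x ∈ radii κ
  · refine (hu.contDiffAt ((isOpen_radii κ).mem_nhds hx)).congr_of_eventuallyEq ?_
    filter_upwards [(isOpen_radii κ).mem_nhds hx] with y hy
    rw [indicator_of_mem hy]
  · refine (contDiffAt_const (c := (0 : ℂ))).congr_of_eventuallyEq ?_
    filter_upwards [isClosed_Icc.isOpen_compl.mem_nhds
      (fun h => hx (Icc_subset_radii ha hb h) : x ∈ (Icc a b)ᶜ)] with y hy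
    exact h0' y hy

theorem IsAnnular.mul {κ : ℝ} {g u : ℝ → ℂ} (hg : IsAnnular κ g)
    (hu : ContDiffOn ℝ ∞ u (radii κ)) : IsAnnular κ (fun x => u x * g x) := by
  obtain ⟨a, b, ha, hb, h0⟩ := hg.bounds
  have := isAnnular_indicator ha hb (hu.mul hg.smooth.contDiffOn)
    fun x _ hx => by simp [h0 x hx]
  rwa [indicator_eq_self.2] at this
  intro x hx
  by_contra hn
  exact hx (by simp [hg.eq_zero hn])

theorem IsAnnular.deriv {κ : ℝ} {g : ℝ → ℂ} (hg : IsAnnular κ g) : IsAnnular κ (deriv g) := by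
  obtain ⟨a, b, ha, hb, h0⟩ := hg.bounds
  refine ⟨(contDiff_infty_iff_deriv.1 hg.smooth).2, a, b, ha, hb, fun x hx => ?_⟩
  have : g =ᶠ[𝓝 x] fun _ => 0 := by
    filter_upwards [isClosed_Icc.isOpen_compl.mem_nhds (show x ∈ (Icc a b)ᶜ from hx)] with y hy
    exact h0 y hy
  rw [this.deriv_eq, deriv_const]

theorem IsAnnular.add {κ : ℝ} {f g : ℝ → ℂ} (hf : IsAnnular κ f) (hg : IsAnnular κ g) :
    IsAnnular κ (fun x => f x + g x) := by
  obtain ⟨a, b, ha, hb, h0⟩ := hf.bounds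
  obtain ⟨a', b', ha', hb', h0'⟩ := hg.bounds
  refine ⟨hf.smooth.add hg.smooth, min a a', max b b', lt_min ha ha', ?_, fun x hx => ?_⟩
  · rcases max_choice b b' with h | h <;> rwa [h]
  · rw [h0 x fun h => hx ⟨(min_le_left _ _).trans h.1, h.2.trans (le_max_left _ _)⟩,
      h0' x fun h => hx ⟨(min_le_right _ _).trans h.1, h.2.trans (le_max_right _ _)⟩, add_zero]

theorem IsAnnular.const_mul {κ : ℝ} {f : ℝ → ℂ} (hf : IsAnnular κ f) (c : ℂ) :
    IsAnnular κ (fun x => c * f x) :=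
  hf.mul (u := fun _ => c) contDiffOn_const

theorem norm_sq_notMem_radii {κ : ℝ} {z : ℂ} (hz : z ∉ surface κ \ {0}) :
    ‖z‖ ^ 2 ∉ radii κ := fun h => hz ⟨h.2, fun h0 => by
      rw [mem_singleton_iff] at h0; simp [h0, radii] at h⟩

theorem IsAnnular.mode_eq_zero {κ : ℝ} {g : ℝ → ℂ} (hg : IsAnnular κ g) (k : ℤ) {z : ℂ}
    (hz : z ∉ surface κ \ {0}) : mode k g z = 0 := by
  rw [mode, hg.eq_zero (norm_sq_notMem_radii hz), mul_zero]

theorem IsAnnular.tsupport_mode {κ : ℝ} {g : ℝ → ℂ} (hg : IsAnnular κ g) (k : ℤ) :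
    HasCompactSupport (mode k g) ∧ tsupport (mode k g) ⊆ surface κ \ {0} := by
  obtain ⟨a, b, ha, hb, h0⟩ := hg.bounds
  set S : Set ℂ := {z | ‖z‖ ^ 2 ∈ Icc a b} with hS
  have hSc : IsClosed S := isClosed_Icc.preimage (by fun_prop : Continuous fun z : ℂ => ‖z‖ ^ 2)
  have hSk : IsCompact S := by
    refine (isCompact_closedBall (0 : ℂ) (b + 1)).of_isClosed_subset hSc fun z hz => ?_
    have : ‖z‖ ^ 2 ≤ b := hz.2
    rw [mem_closedBall_zero_iff]
    nlinarith [sq_nonneg (‖z‖ - 1), norm_nonneg z]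
  have hsub : tsupport (mode k g) ⊆ S := closure_minimal (fun z hz => by
    by_contra hn
    exact hz (by rw [mode, h0 _ hn, mul_zero])) hSc
  refine ⟨hSk.of_isClosed_subset (isClosed_tsupport _) hsub, hsub.trans fun z hz => ?_⟩
  by_contra hn
  exact norm_sq_notMem_radii hn (Icc_subset_radii ha hb hz)

theorem IsAnnular.isTestFunction {κ : ℝ} {g : ℝ → ℂ} (hg : IsAnnular κ g) (k : ℤ) :
    IsTestFunction κ (mode k g) := by
  obtain ⟨hc, hs⟩ := hg.tsupport_mode k
  refine ⟨contDiff_iff_contDiffAt.2 fun z => ?_, hc, hs.trans sdiff_subset⟩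
  by_cases hz : z ∈ tsupport (mode k g)
  · exact contDiffAt_mode (hs hz).2 k hg.smooth.contDiffAt
  · exact (contDiffAt_const (c := (0 : ℂ))).congr_of_eventuallyEq
      (notMem_tsupport_iff_eventuallyEq.1 hz)

theorem IsAnnular.hasDerivAt {κ : ℝ} {g : ℝ → ℂ} (hg : IsAnnular κ g) (x : ℝ) :
    HasDerivAt g (_root_.deriv g x) x :=
  (hg.smooth.differentiable (by simp) x).hasDerivAt

theorem eq_mode_of_eqOn {κ : ℝ} {φ : ℂ → ℂ} {g : ℝ → ℂ} {k : ℤ} (hφ : tsupport φ ⊆ surface κ \ {0})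
    (hg : IsAnnular κ g) (he : EqOn φ (mode k g) (surface κ \ {0})) : φ = mode k g := by
  funext z
  by_cases hz : z ∈ surface κ \ {0}
  · exact he hz
  · rw [hg.mode_eq_zero k hz, image_eq_zero_of_notMem_tsupport fun h => hz (hφ h)]

theorem IsAnnular.lower_mode {κ : ℝ} {g : ℝ → ℂ} (hg : IsAnnular κ g) (α : ℝ) (k : ℤ) :
    ∃ g', IsAnnular κ g' ∧ lower κ α (mode k g) = mode (k + 1) g' := by
  have ha : IsAnnular κ fun x => (1 + κ * (x : ℂ)) * _root_.deriv g x + α * g x :=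
    (hg.deriv.mul (u := fun x : ℝ => 1 + κ * (x : ℂ))
      (contDiff_const.add (contDiff_const.mul Complex.ofRealCLM.contDiff)).contDiffOn).add
      (hg.const_mul _)
  refine ⟨_, ha, eq_mode_of_eqOn (((hg.isTestFunction k).lower' κ α).2.trans
    (hg.tsupport_mode k).2) ha fun z hz => ?_⟩
  rw [TwistedLaplacian.lower_mode κ α k hz.2 (hg.hasDerivAt _), mode]

theorem IsAnnular.lowerComp_mode {κ : ℝ} (m : ℕ) {g : ℝ → ℂ} (hg : IsAnnular κ g) (ν : ℝ) (k : ℤ) :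
    ∃ g', IsAnnular κ g' ∧ lowerComp κ ν m (mode k g) = mode (k + m) g' := by
  induction m generalizing g ν k with
  | zero => exact ⟨g, hg, by simp [lowerComp]⟩
  | succ m ih =>
    obtain ⟨g₁, hg₁, e₁⟩ := hg.lower_mode ν k
    obtain ⟨g₂, hg₂, e₂⟩ := ih hg₁ (ν + κ) (k + 1)
    refine ⟨g₂, hg₂, ?_⟩
    rw [lowerComp, e₁, e₂]
    congr 1; push_cast; ring

/-- The primitive vanishes near the origin and is constant beyond `b`. Its total integral is the
only obstruction to its being annular, and each use below disposes of that constant in its own way.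
-/
theorem IsAnnular.exists_primitive {κ : ℝ} {q : ℝ → ℂ} (hq : IsAnnular κ q) :
    ∃ F : ℝ → ℂ, ContDiff ℝ ∞ F ∧ (∀ x, HasDerivAt F (q x) x) ∧
      ∃ a b, 0 < a ∧ 0 < 1 + κ * b ∧ (∀ x, x ∉ Icc a b → q x = 0) ∧ (∀ x, x < a → F x = 0) ∧
        ∀ x, b < x → F x = ∫ t, q t := by
  obtain ⟨a, b, ha, hb, h0⟩ := hq.bounds
  have hd : ∀ x, HasDerivAt (fun x => ∫ t in (0 : ℝ)..x, q t) (q x) x := fun x =>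
    intervalIntegral.integral_hasDerivAt_right (hq.smooth.continuous.intervalIntegrable _ _)
      (hq.smooth.continuous.stronglyMeasurableAtFilter _ _) hq.smooth.continuous.continuousAt
  refine ⟨fun x => ∫ t in (0 : ℝ)..x, q t, contDiff_infty_iff_deriv.2
    ⟨fun x => (hd x).differentiableAt, ?_⟩, hd, a, b, ha, hb, h0, fun x hx => ?_, fun x hx => ?_⟩
  · rw [funext fun x => (hd x).deriv]; exact hq.smooth
  · refine intervalIntegral.integral_zero_ae (Eventually.of_forall fun t ht => h0 t fun h => ?_)
    have : t ≤ max 0 x := ht.2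
    exact absurd (h.1.trans this) (not_le.2 (max_lt ha hx))
  · refine intervalIntegral.integral_eq_integral_of_support_subset fun t ht => ?_
    have : t ∈ Icc a b := by_contra fun h => ht (h0 t h)
    exact ⟨ha.trans_le this.1, this.2.trans hx.le⟩

theorem contDiffOn_ofReal_radialWeight (κ ν : ℝ) :
    ContDiffOn ℝ ∞ (fun x => (radialWeight κ ν x : ℂ)) (radii κ) := fun _ hx =>
  (contDiffAt_ofReal_radialWeight ν hx.2).contDiffWithinAt

theorem contDiff_one_add (κ : ℝ) : ContDiff ℝ ∞ (fun x : ℝ => 1 + κ * (x : ℂ)) :=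
  contDiff_const.add (contDiff_const.mul Complex.ofRealCLM.contDiff)

theorem one_add_ne_zero {κ x : ℝ} (hx : x ∈ radii κ) : (1 + κ * (x : ℂ)) ≠ 0 := by
  have : ((1 + κ * x : ℝ) : ℂ) ≠ 0 := Complex.ofReal_ne_zero.2 hx.2.ne'
  simpa using this

theorem ofReal_radialWeight_ne_zero {κ x : ℝ} (ν : ℝ) (hx : x ∈ radii κ) :
    (radialWeight κ ν x : ℂ) ≠ 0 :=
  Complex.ofReal_ne_zero.2 (radialWeight_pos hx.2).ne'

theorem contDiffOn_zpow_ofReal (κ : ℝ) (k : ℤ) :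
    ContDiffOn ℝ ∞ (fun x : ℝ => (x : ℂ) ^ k) (radii κ) := fun x hx =>
  (ContDiffAt.comp x (contDiffAt_zpow (Complex.ofReal_ne_zero.2 hx.1.ne') k)
    Complex.ofRealCLM.contDiff.contDiffAt).contDiffWithinAt

theorem integral_radial (q : ℝ → ℂ) :
    ∫ z : ℂ, q (‖z‖ ^ 2) = (Real.pi : ℂ) * ∫ x in Ioi (0 : ℝ), q x := by
  have h1 := integral_fun_norm_addHaar (volume : Measure ℂ) (fun r => q (r ^ 2))
  have h2 := integral_comp_rpow_Ioi_of_pos (g := q) (p := 2) two_pos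
  rw [h1, ← h2, Complex.finrank_real_complex, Measure.real, Complex.volume_ball]
  simp only [ENNReal.ofReal_one, one_pow, one_mul, ENNReal.coe_toReal, NNReal.coe_real_pi,
    Nat.add_one_sub_one, pow_one, nsmul_eq_mul, Complex.real_smul]
  have h3 : ∀ x : ℝ, ((2 * x ^ ((2 : ℝ) - 1) : ℝ) : ℂ) * q (x ^ (2 : ℝ))
      = 2 * ((x : ℂ) * q (x ^ 2)) := fun x => by
    rw [show (2 : ℝ) - 1 = 1 by norm_num, Real.rpow_one, Real.rpow_two]
    push_cast; ring
  simp only [h3, integral_const_mul]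
  push_cast; ring

/-- A test function of angular momentum `k` orthogonal to `w zᵏ` is in the range of `∇_{ν+κ}`. -/
theorem IsAnnular.exists_nabla_eq {κ : ℝ} (ν : ℝ) {k : ℤ} {χ : ℝ → ℂ} (hχ : IsAnnular κ χ)
    (h0 : ∫ z, mode k (fun x => (radialWeight κ ν x : ℂ)) z * conj (mode k χ z) ∂(vol κ) = 0) :
    ∃ g, IsAnnular κ g ∧ nabla κ (ν + κ) (mode (k + 1) g) = mode k χ := by
  -- Variation of constants. The function `(1 + κx) w⁻¹ x^(-k-1)`, which is `-u` below, solves the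
  -- homogeneous radial equation of `∇_{ν+κ}` on angular momentum `k + 1`. For `g = u F` there
  -- remains `F' = v χ`, and `v χ` is, up to conjugation and the factor `π`, also the radial density
  -- of the pairing in `h0`.
  set v : ℝ → ℂ := fun x => (radialWeight κ ν x : ℂ) * (x : ℂ) ^ k * ((1 + κ * (x : ℂ)) ^ 2)⁻¹
    with hv
  have hvs : ContDiffOn ℝ ∞ v (radii κ) :=
    ((contDiffOn_ofReal_radialWeight κ ν).mul (contDiffOn_zpow_ofReal κ k)).mul
      (((contDiff_one_add κ).contDiffOn.pow 2).inv fun x hx => pow_ne_zero 2 (one_add_ne_zero hx))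
  have hq := hχ.mul hvs
  obtain ⟨F, hF, hFd, a, b, ha, hb, hq0, hFa, hFb⟩ := hq.exists_primitive
  have hJ : ∫ x, v x * χ x = 0 := by
    have e1 : ∫ z, mode k (fun x => (radialWeight κ ν x : ℂ)) z * conj (mode k χ z) ∂(vol κ)
        = ∫ z : ℂ, conj (v (‖z‖ ^ 2) * χ (‖z‖ ^ 2)) := by
      rw [integral_vol, setIntegral_eq_integral_of_ae_compl_eq_zero]
      · refine integral_congr_ae ?_
        filter_upwards [Measure.ae_ne volume (0 : ℂ)] with z hz
        have e2 : z ^ k * conj z ^ k = ((‖z‖ ^ 2 : ℝ) : ℂ) ^ k := by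
          rw [← mul_zpow]; push_cast; rw [norm_sq_eq]
        simp only [mode, hv, map_mul, map_zpow₀, Complex.conj_ofReal, map_inv₀, map_pow, map_add,
          map_one, ofReal_h_eq]
        linear_combination (((1 + κ * ((‖z‖ ^ 2 : ℝ) : ℂ)) ^ 2)⁻¹ *
          (radialWeight κ ν (‖z‖ ^ 2) : ℂ) * conj (χ (‖z‖ ^ 2))) * e2
      · refine Eventually.of_forall fun z hz => ?_
        rw [hχ.mode_eq_zero k fun h => hz h.1]; simp
    rw [e1, integral_conj, map_eq_zero, integral_radial (fun x => v x * χ x), mul_eq_zero,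
      setIntegral_eq_integral_of_forall_compl_eq_zero] at h0
    · exact h0.resolve_left (Complex.ofReal_ne_zero.2 Real.pi_ne_zero)
    · intro x hx
      rw [hχ.eq_zero fun h => hx h.1, mul_zero]
  have hFan : IsAnnular κ F := ⟨hF, a, b, ha, hb, fun x hx => by
    rcases lt_or_ge x a with h | h
    · exact hFa x h
    · rw [hFb x (not_le.1 fun h' => hx ⟨h, h'⟩), hJ]⟩
  set u : ℝ → ℂ := fun x => -((1 + κ * (x : ℂ)) * (radialWeight κ ν x : ℂ)⁻¹ *
    (x : ℂ) ^ (-(k + 1))) with hu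
  have hus : ContDiffOn ℝ ∞ u (radii κ) :=
    (((contDiff_one_add κ).contDiffOn.mul ((contDiffOn_ofReal_radialWeight κ ν).inv
      fun x hx => ofReal_radialWeight_ne_zero ν hx)).mul (contDiffOn_zpow_ofReal κ _)).neg
  have hg := hFan.mul hus
  refine ⟨_, hg, eq_mode_of_eqOn (((hg.isTestFunction (k + 1)).nabla' κ (ν + κ)).2.trans
    (hg.tsupport_mode _).2) hχ fun z hz => ?_⟩
  have hx := norm_sq_mem_radii hz.1 hz.2
  set x := ‖z‖ ^ 2 with hxdef
  have hw := ofReal_radialWeight_ne_zero ν hx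
  have hx1 := one_add_ne_zero hx
  have hx0 : (x : ℂ) ≠ 0 := Complex.ofReal_ne_zero.2 hx.1.ne'
  have hd1 : HasDerivAt (fun x : ℝ => 1 + κ * (x : ℂ)) (κ : ℂ) x := by
    simpa using ((Complex.ofRealCLM.hasDerivAt (x := x)).const_mul (κ : ℂ)).const_add 1
  have hd2 := ((hasDerivAt_radialWeight ν hx.2).ofReal_comp).fun_inv hw
  have hd3 : HasDerivAt (fun x : ℝ => (x : ℂ) ^ (-(k + 1)))
      (((-(k + 1) : ℤ) : ℂ) * (x : ℂ) ^ (-(k + 1) - 1)) x :=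
    (hasDerivAt_zpow (-(k + 1)) (x : ℂ) (Or.inl hx0)).comp_ofReal
  have hgd := ((((hd1.fun_mul hd2).fun_mul hd3).fun_neg).fun_mul (hFd x))
  rw [nabla_mode κ (ν + κ) (k + 1) hz.2 hgd, mode, ← hxdef]
  simp only [hv]
  have e1 : (x : ℂ) ^ (-(k + 1) - 1) = ((x : ℂ) ^ k * x * x)⁻¹ := by
    rw [← zpow_add_one₀ hx0, ← zpow_add_one₀ hx0, ← zpow_neg]; congr 1; ring
  have e2 : (x : ℂ) ^ (-(k + 1)) = ((x : ℂ) ^ k * x)⁻¹ := by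
    rw [← zpow_add_one₀ hx0, ← zpow_neg]
  have hxk : (x : ℂ) ^ k ≠ 0 := zpow_ne_zero _ hx0
  rw [e1, e2, add_sub_cancel_right]
  congr 1
  push_cast
  field_simp
  ring

/-! ### Weak eigenfunctions -/

/-- The sesquilinear pairing of `L²(vol κ)`. -/
def pairing (κ : ℝ) (Φ φ : ℂ → ℂ) : ℂ := ∫ z, Φ z * conj (φ z) ∂(vol κ)

/-- The eigenvalue equation in the sense of distributions. -/
def IsWeakEigenfunction (κ ν : ℝ) (m : ℕ) (Φ : ℂ → ℂ) : Prop :=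
  ∀ φ, IsTestFunction κ φ →
    pairing κ Φ (twistedLaplacian κ ν φ) = (eigenvalue κ ν m : ℂ) * pairing κ Φ φ

theorem memLp_conj {κ : ℝ} {φ : ℂ → ℂ} (hφ : MemLp φ 2 (vol κ)) :
    MemLp (fun z => conj (φ z)) 2 (vol κ) :=
  hφ.of_le (Complex.continuous_conj.comp_aestronglyMeasurable hφ.1)
    (Eventually.of_forall fun z => by simp)

theorem integrable_pairing {κ : ℝ} {Φ φ : ℂ → ℂ} (hΦ : MemLp Φ 2 (vol κ))
    (hφ : MemLp φ 2 (vol κ)) : Integrable (fun z => Φ z * conj (φ z)) (vol κ) :=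
  hΦ.integrable_mul (memLp_conj hφ)

theorem pairing_add {κ : ℝ} {Φ φ ψ : ℂ → ℂ} (hΦ : MemLp Φ 2 (vol κ)) (hφ : MemLp φ 2 (vol κ))
    (hψ : MemLp ψ 2 (vol κ)) :
    pairing κ Φ (fun z => φ z + ψ z) = pairing κ Φ φ + pairing κ Φ ψ := by
  unfold pairing
  rw [← integral_add (integrable_pairing hΦ hφ) (integrable_pairing hΦ hψ)]
  simp only [map_add, mul_add]

theorem pairing_const_mul (κ : ℝ) (Φ φ : ℂ → ℂ) (c : ℂ) :
    pairing κ Φ (fun z => c * φ z) = conj c * pairing κ Φ φ := by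
  unfold pairing
  rw [← integral_const_mul]
  simp only [map_mul]
  refine integral_congr_ae (Eventually.of_forall fun z => ?_)
  simp only; ring

theorem IsWeakEigenfunction.pairing_defect {κ ν : ℝ} {m : ℕ} {Φ : ℂ → ℂ} (hΦ : MemLp Φ 2 (vol κ))
    (hw : IsWeakEigenfunction κ ν m Φ) {ψ : ℂ → ℂ} (hψ : IsTestFunction κ ψ) :
    pairing κ Φ (fun z => twistedLaplacian κ ν ψ z - (eigenvalue κ ν m : ℂ) * ψ z) = 0 := by
  simp only [sub_eq_add_neg, ← neg_mul]
  rw [pairing_add hΦ ((hψ.twistedLaplacian ν).memLp 2) ((hψ.const_mul _).memLp 2),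
    pairing_const_mul, hw ψ hψ]
  simp

theorem IsWeakEigenfunction.pairing_nablaComp_lower {κ ν : ℝ} {m : ℕ} {Φ : ℂ → ℂ}
    (hΦ : MemLp Φ 2 (vol κ)) (hw : IsWeakEigenfunction κ ν m Φ) {ψ : ℂ → ℂ}
    (hψ : IsTestFunction κ ψ) :
    pairing κ Φ (nablaComp κ ν (m + 1) (lower κ (ν + m * κ) ψ)) = 0 := by
  rw [← hw.pairing_defect hΦ (hψ.nablaComp κ ν m)]
  congr 1
  funext z
  rw [twistedLaplacian_nablaComp κ isOpen_univ hψ.1.contDiffOn m ν (mem_univ z), nablaComp,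
    show ν + m * κ + κ = ν + (m + 1) * κ by ring]

theorem IsWeakEigenfunction.ladderConst_mul_pairing {κ ν : ℝ} {m : ℕ} {Φ : ℂ → ℂ}
    (hΦ : MemLp Φ 2 (vol κ)) (hw : IsWeakEigenfunction κ ν m Φ) {φ : ℂ → ℂ}
    (hφ : IsTestFunction κ φ) :
    (ladderConst κ ν m : ℂ) * pairing κ Φ φ
      = pairing κ Φ (nablaComp κ ν m (lowerComp κ ν m φ)) := by
  obtain ⟨ψ, hψ, he⟩ := nablaComp_lowerComp m (ν := ν) hφ
  rw [funext he, pairing_add hΦ ((hφ.const_mul _).memLp 2), pairing_const_mul,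
    hw.pairing_defect hΦ hψ]
  · simp
  · have h1 := ((hψ.twistedLaplacian ν).add (hψ.const_mul (-(eigenvalue κ ν m : ℂ)))).memLp 2
    simpa [sub_eq_add_neg] using h1

/-! ### The coordinate `∫ dx / (1 + κ x)` -/

/-- The primitive of `1 / (1 + κ x)` vanishing at the origin. -/
def logCoord (κ x : ℝ) : ℝ := if κ = 0 then x else Real.log (1 + κ * x) / κ

/-- The inverse function of `logCoord κ`. -/
def expCoord (κ t : ℝ) : ℝ := if κ = 0 then t else (Real.exp (κ * t) - 1) / κ

theorem one_add_expCoord_pos (κ t : ℝ) : 0 < 1 + κ * expCoord κ t := by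
  unfold expCoord
  split_ifs with hκ
  · simp [hκ]
  · rw [mul_div_cancel₀ _ hκ]; simpa using Real.exp_pos _

theorem logCoord_expCoord (κ t : ℝ) : logCoord κ (expCoord κ t) = t := by
  unfold logCoord expCoord
  split_ifs with hκ
  · rfl
  · rw [mul_div_cancel₀ _ hκ, add_sub_cancel, Real.log_exp, mul_div_cancel_left₀ _ hκ]

theorem expCoord_pos {κ t : ℝ} (ht : 0 < t) : 0 < expCoord κ t := by
  unfold expCoord
  split_ifs with hκ
  · exact ht
  · rcases lt_or_gt_of_ne hκ with h | h
    · refine div_pos_of_neg_of_neg ?_ h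
      rw [sub_neg, Real.exp_lt_one_iff]
      exact mul_neg_of_neg_of_pos h ht
    · refine div_pos ?_ h
      rw [sub_pos, Real.one_lt_exp_iff]
      exact mul_pos h ht

theorem logCoord_lt {κ x y : ℝ} (hx : 0 < 1 + κ * x) (hy : 0 < 1 + κ * y) (hxy : x < y) :
    logCoord κ x < logCoord κ y := by
  unfold logCoord
  split_ifs with hκ
  · exact hxy
  · rcases lt_or_gt_of_ne hκ with h | h
    · refine div_lt_div_of_neg_of_lt h (Real.log_lt_log hy ?_)
      nlinarith
    · refine div_lt_div_of_pos_right (Real.log_lt_log hx ?_) h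
      nlinarith

theorem logCoord_le {κ x y : ℝ} (hx : 0 < 1 + κ * x) (hy : 0 < 1 + κ * y) (hxy : x ≤ y) :
    logCoord κ x ≤ logCoord κ y := by
  rcases hxy.eq_or_lt with rfl | h
  · exact le_rfl
  · exact (logCoord_lt hx hy h).le

theorem hasDerivAt_logCoord {κ x : ℝ} (hx : 0 < 1 + κ * x) :
    HasDerivAt (logCoord κ) (1 + κ * x)⁻¹ x := by
  unfold logCoord
  split_ifs with hκ
  · simpa [hκ] using hasDerivAt_id' x
  · have h1 : HasDerivAt (fun x => 1 + κ * x) κ x := by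
      simpa using ((hasDerivAt_id x).const_mul κ).const_add 1
    refine ((h1.log hx.ne').div_const κ).congr_deriv ?_
    field_simp

theorem contDiffAt_logCoord {κ x : ℝ} (hx : 0 < 1 + κ * x) : ContDiffAt ℝ ∞ (logCoord κ) x := by
  unfold logCoord
  split_ifs with hκ
  · exact contDiffAt_id
  · exact (ContDiffAt.log (f := fun x => 1 + κ * x) (by fun_prop) hx.ne').div_const _

/-! ### Translates of a bump function in the coordinate `logCoord` -/

/-- Families of functions of `x`, indexed by the translation parameter, that are generated by the
translates of bump functions in the coordinate `logCoord κ` under multiplication by `x`. The natural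
number bounds the growth in `x`. -/
inductive BumpFamily (κ : ℝ) : ℕ → (ℝ → ℝ → ℂ) → Prop
  | base (ζ : ℝ → ℂ) (hζ : ContDiff ℝ ∞ ζ) (h0 : ∀ y, y ∉ Icc 0 1 → ζ y = 0) :
      BumpFamily κ 0 fun R x => ζ (logCoord κ x - R)
  | mulX {s : ℕ} {F : ℝ → ℝ → ℂ} (hF : BumpFamily κ s F) :
      BumpFamily κ (s + 1) fun R x => (x : ℂ) * F R x
  | add {s : ℕ} {F G : ℝ → ℝ → ℂ} (hF : BumpFamily κ s F) (hG : BumpFamily κ s G) :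
      BumpFamily κ s fun R x => F R x + G R x
  | smul {s : ℕ} {F : ℝ → ℝ → ℂ} (c : ℂ) (hF : BumpFamily κ s F) :
      BumpFamily κ s fun R x => c * F R x
  | mono {s : ℕ} {F : ℝ → ℝ → ℂ} (hF : BumpFamily κ s F) : BumpFamily κ (s + 1) F

/-- Since `d(logCoord)/dx = 1/(1 + κx)`, differentiation costs exactly this factor and constants
independent of `R`. In the case of multiplication by `x`, the term `F` is rewritten as `(F + κ x
F)/(1 + κx)`. -/
theorem BumpFamily.exists_hasDerivAt {κ : ℝ} {s : ℕ} {F : ℝ → ℝ → ℂ} (hF : BumpFamily κ s F) :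
    ∃ G, BumpFamily κ s G ∧
      ∀ R, ∀ x ∈ radii κ, HasDerivAt (F R) (G R x / (1 + κ * (x : ℂ))) x := by
  induction hF with
  | base ζ hζ h0 =>
    refine ⟨_, .base (deriv ζ) (contDiff_infty_iff_deriv.1 hζ).2 fun y hy => ?_, fun R x hx => ?_⟩
    · have : ζ =ᶠ[𝓝 y] fun _ => 0 := by
        filter_upwards [isClosed_Icc.isOpen_compl.mem_nhds (show y ∈ (Icc (0 : ℝ) 1)ᶜ from hy)]
          with t ht
        exact h0 t ht
      rw [this.deriv_eq, deriv_const]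
    · have h1 := (hζ.differentiable (by simp) (logCoord κ x - R)).hasDerivAt
      have h2 := h1.scomp x ((hasDerivAt_logCoord hx.2).sub_const R)
      refine h2.congr_deriv ?_
      rw [Complex.real_smul, div_eq_inv_mul]
      push_cast; rfl
  | mulX _ ih =>
    rename_i s F hF
    obtain ⟨G, hG, hd⟩ := ih
    refine ⟨_, ((hF.mono).add ((hF.mulX).smul κ)).add hG.mulX, fun R x hx => ?_⟩
    have h1 : HasDerivAt (fun x : ℝ => (x : ℂ)) 1 x := Complex.ofRealCLM.hasDerivAt
    refine (h1.fun_mul (hd R x hx)).congr_deriv ?_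
    have := one_add_ne_zero hx
    rw [eq_div_iff this, add_mul, mul_assoc (x : ℂ), div_mul_cancel₀ _ this]
    ring
  | add _ _ ih₁ ih₂ =>
    obtain ⟨G₁, hG₁, hd₁⟩ := ih₁
    obtain ⟨G₂, hG₂, hd₂⟩ := ih₂
    refine ⟨_, hG₁.add hG₂, fun R x hx => ?_⟩
    exact ((hd₁ R x hx).fun_add (hd₂ R x hx)).congr_deriv (by ring)
  | smul c _ ih =>
    obtain ⟨G, hG, hd⟩ := ih
    exact ⟨_, hG.smul c, fun R x hx => ((hd R x hx).const_mul c).congr_deriv (by ring)⟩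
  | mono _ ih =>
    obtain ⟨G, hG, hd⟩ := ih
    exact ⟨G, hG.mono, hd⟩

theorem BumpFamily.eq_zero {κ : ℝ} {s : ℕ} {F : ℝ → ℝ → ℂ} (hF : BumpFamily κ s F) {R x : ℝ}
    (hx : logCoord κ x < R) : F R x = 0 := by
  induction hF with
  | base ζ hζ h0 => exact h0 _ fun h => by linarith [h.1]
  | mulX _ ih => simp only [ih, mul_zero]
  | add _ _ ih₁ ih₂ => simp only [ih₁, ih₂, add_zero]
  | smul c _ ih => simp only [ih, mul_zero]
  | mono _ ih => exact ih

/-- The bound does not depend on `R`; this uniformity provides the dominating function when the bump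
moves to the boundary. -/
theorem BumpFamily.exists_norm_le {κ : ℝ} {s : ℕ} {F : ℝ → ℝ → ℂ} (hF : BumpFamily κ s F) :
    ∃ C, 0 ≤ C ∧ ∀ R x, 0 ≤ x → ‖F R x‖ ≤ C * (1 + x) ^ s := by
  induction hF with
  | base ζ hζ h0 =>
    obtain ⟨C, hC⟩ := isCompact_Icc.exists_bound_of_continuousOn
      (hζ.continuous.continuousOn (s := Icc 0 1))
    refine ⟨max C 0, le_max_right _ _, fun R x _ => ?_⟩
    rw [pow_zero, mul_one]
    by_cases h : logCoord κ x - R ∈ Icc (0 : ℝ) 1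
    · exact (hC _ h).trans (le_max_left _ _)
    · simp only [h0 _ h, norm_zero]; exact le_max_right _ _
  | mulX _ ih =>
    rename_i s F hF
    obtain ⟨C, hC, hb⟩ := ih
    refine ⟨C, hC, fun R x hx => ?_⟩
    rw [norm_mul, Complex.norm_real, Real.norm_of_nonneg hx]
    calc _ ≤ (1 + x) * (C * (1 + x) ^ s) := by
          gcongr
          · linarith
          · exact hb R x hx
      _ = _ := by ring
  | add _ _ ih₁ ih₂ =>
    obtain ⟨C₁, hC₁, hb₁⟩ := ih₁
    obtain ⟨C₂, hC₂, hb₂⟩ := ih₂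
    refine ⟨C₁ + C₂, add_nonneg hC₁ hC₂, fun R x hx => (norm_add_le _ _).trans ?_⟩
    rw [add_mul]
    exact add_le_add (hb₁ R x hx) (hb₂ R x hx)
  | smul c _ ih =>
    obtain ⟨C, hC, hb⟩ := ih
    refine ⟨‖c‖ * C, by positivity, fun R x hx => ?_⟩
    rw [norm_mul, mul_assoc]
    exact mul_le_mul_of_nonneg_left (hb R x hx) (norm_nonneg c)
  | mono _ ih =>
    obtain ⟨C, hC, hb⟩ := ih
    refine ⟨C, hC, fun R x hx => (hb R x hx).trans ?_⟩
    refine mul_le_mul_of_nonneg_left ?_ hC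
    exact pow_le_pow_right₀ (by linarith) (Nat.le_succ _)

/-- The factor `1 + κx` in each `∇_α` cancels the denominator of the derivative, so the family is
preserved and every operator adds only one degree of growth. -/
theorem BumpFamily.exists_nablaComp {κ : ℝ} (ν ν' : ℝ) (m : ℕ) {s : ℕ} {F : ℝ → ℝ → ℂ}
    (hF : BumpFamily κ s F) (k : ℤ) :
    ∃ G, BumpFamily κ (s + m) G ∧ ∀ R,
      EqOn (nablaComp κ ν m (mode k fun x => (radialWeight κ ν' x : ℂ) * F R x))
        (mode (k - m) fun x => (radialWeight κ ν' x : ℂ) * G R x) (surface κ \ {0}) := by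
  induction m generalizing s F k with
  | zero => exact ⟨F, hF, fun R z _ => by simp [nablaComp]⟩
  | succ m ih =>
    obtain ⟨F', hF', hd⟩ := hF.exists_hasDerivAt
    have hG := ((((hF.mono).add ((hF.mulX).smul κ)).smul (-k)).add (hF'.mulX.smul (-1))).add
      (hF.mulX.smul (((ν + (m + 1) * κ : ℝ) : ℂ) + ν'))
    obtain ⟨G, hG', he⟩ := ih hG (k - 1)
    refine ⟨G, by rwa [show s + (m + 1) = s + 1 + m by ring], fun R => ?_⟩
    rw [nablaComp, show k - ((m + 1 : ℕ) : ℤ) = k - 1 - m by push_cast; ring]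
    refine (nablaComp_congr (isOpen_punctured κ) m fun z hz => ?_).trans (he R)
    have hx := norm_sq_mem_radii hz.1 hz.2
    rw [nabla_mode_radialWeight ν' _ k hz.1 hz.2 (hd R _ hx), mode]
    have := one_add_ne_zero hx
    congr 2
    field_simp
    ring

/-! ### Vanishing of the pairing on the range of `∇^{(m+1)}` -/

theorem smoothTransition_deriv_eq_zero {y : ℝ} (hy : y ∉ Icc (0 : ℝ) 1) :
    deriv Real.smoothTransition y = 0 := by
  rcases not_and_or.1 hy with h | h
  · have : Real.smoothTransition =ᶠ[𝓝 y] fun _ => 0 := by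
      filter_upwards [Iio_mem_nhds (not_le.1 h)] with t ht
      exact Real.smoothTransition.zero_of_nonpos (le_of_lt ht)
    rw [this.deriv_eq, deriv_const]
  · have : Real.smoothTransition =ᶠ[𝓝 y] fun _ => 1 := by
      filter_upwards [Ioi_mem_nhds (not_le.1 h)] with t ht
      exact Real.smoothTransition.one_of_one_le (le_of_lt ht)
    rw [this.deriv_eq, deriv_const]

theorem contDiff_smoothTransition_deriv :
    ContDiff ℝ ∞ fun y => ((deriv Real.smoothTransition y : ℝ) : ℂ) :=
  Complex.ofRealCLM.contDiff.comp
    (contDiff_infty_iff_deriv.1 (Real.smoothTransition.contDiff (n := ⊤))).2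

theorem mode_indicator_eqOn (κ : ℝ) (k : ℤ) (u : ℝ → ℂ) :
    EqOn (mode k ((radii κ).indicator u)) (mode k u) (surface κ \ {0}) := fun z hz => by
  rw [mode, mode, indicator_of_mem (norm_sq_mem_radii hz.1 hz.2)]

/-- The factor `1 / ((1 + κ x) w)` by which one passes from `g` to the derivative of `f` in
`A_ν (zᵏ w f) = zᵏ⁺¹ g`. -/
theorem contDiffOn_inv_weight (κ ν : ℝ) : ContDiffOn ℝ ∞
    (fun x => ((radialWeight κ ν x : ℂ) * (1 + κ * (x : ℂ)))⁻¹) (radii κ) :=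
  ((contDiffOn_ofReal_radialWeight κ ν).mul (contDiff_one_add κ).contDiffOn).inv
    fun _ hx => mul_ne_zero (ofReal_radialWeight_ne_zero ν hx) (one_add_ne_zero hx)

/-- Since `A_ν(zⁿ w f) = zⁿ⁺¹ w (1 + κx) f'`, the function `f` is a primitive. The one vanishing at
large `x` is chosen; near the origin it is constant, so `ψ` is a multiple of `w zⁿ` there, which is
smooth because `n ≥ 0`. -/
theorem exists_lower_eq_of_nonneg {κ : ℝ} (ν : ℝ) (n : ℕ) {g : ℝ → ℂ} (hg : IsAnnular κ g) :
    ∃ ψ, IsTestFunction κ ψ ∧ lower κ ν ψ = mode (n + 1) g := by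
  obtain ⟨F, hF, hFd, a, b, ha, hb, hq0, hFa, hFb⟩ :=
    (hg.mul (contDiffOn_inv_weight κ ν)).exists_primitive
  set c := ∫ t, ((radialWeight κ ν t : ℂ) * (1 + κ * (t : ℂ)))⁻¹ * g t
  set u : ℝ → ℂ := fun x => (radialWeight κ ν x : ℂ) * (F x - c) with hu
  set ψ : ℂ → ℂ := fun z => z ^ n * u (‖z‖ ^ 2) with hψ
  have h0 : ∀ z : ℂ, b < ‖z‖ ^ 2 → ψ z = 0 := fun z hz => by
    simp [hψ, hu, hFb _ hz, c]
  set S : Set ℂ := {z | ‖z‖ ^ 2 ≤ b} with hS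
  have hSc : IsClosed S := isClosed_le (by fun_prop) continuous_const
  have hsub : tsupport ψ ⊆ S := closure_minimal (fun z hz => by
    by_contra hn
    exact hz (h0 z (not_le.1 hn))) hSc
  have hSk : IsCompact S := by
    refine (isCompact_closedBall (0 : ℂ) (b + 1)).of_isClosed_subset hSc fun z hz => ?_
    have : ‖z‖ ^ 2 ≤ b := hz
    rw [mem_closedBall_zero_iff]
    nlinarith [sq_nonneg (‖z‖ - 1), norm_nonneg z]
  have hSs : S ⊆ surface κ := fun z hz => by
    have : ‖z‖ ^ 2 ≤ b := hz
    change 0 < 1 + κ * ‖z‖ ^ 2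
    rcases le_total 0 κ with h | h
    · positivity
    · nlinarith
  have htest : IsTestFunction κ ψ := by
    refine ⟨contDiff_iff_contDiffAt.2 fun z => ?_, hSk.of_isClosed_subset (isClosed_tsupport _) hsub,
      hsub.trans hSs⟩
    by_cases hz : z ∈ tsupport ψ
    · have hz' : 0 < 1 + κ * ‖z‖ ^ 2 := hSs (hsub hz)
      exact ContDiffAt.mul (by fun_prop) (contDiffAt_radial
        ((contDiffAt_ofReal_radialWeight ν hz').mul (hF.contDiffAt.sub contDiffAt_const)))
    · exact (contDiffAt_const (c := (0 : ℂ))).congr_of_eventuallyEq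
        (notMem_tsupport_iff_eventuallyEq.1 hz)
  -- The polar formula holds only off the origin; continuity of both sides gives the value there.
  refine ⟨ψ, htest, Continuous.ext_on (dense_compl_singleton 0) (htest.lower κ ν).1.continuous
    (hg.isTestFunction _).1.continuous fun z hz => ?_⟩
  by_cases hzs : z ∈ surface κ
  · have hm : ψ = mode n u := by funext w; simp [hψ, mode]
    have hx := norm_sq_mem_radii hzs hz
    rw [hm, lower_mode_radialWeight ν n hzs hz ((hFd _).sub_const c), mode]
    have h1 := ofReal_radialWeight_ne_zero ν hx
    have h2 := one_add_ne_zero hx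
    congr 1
    field_simp
  · rw [hg.mode_eq_zero _ fun h => hzs h.1]
    exact image_eq_zero_of_notMem_tsupport fun h =>
      hzs (hSs (hsub ((htest.lower' κ ν).2 h)))

/-- In the coordinate `logCoord` the bump lives on `[R, R + 1]`; this interval stays inside `radii
κ` for every `R > 0`. -/
theorem exists_isAnnular_bump (κ ν : ℝ) {R : ℝ} (hR : 0 < R) :
    IsAnnular κ ((radii κ).indicator fun x => (radialWeight κ ν x : ℂ) *
      ((deriv Real.smoothTransition (logCoord κ x - R) : ℝ) : ℂ)) := by
  refine isAnnular_indicator (expCoord_pos (κ := κ) hR) (one_add_expCoord_pos κ (R + 1)) ?_ ?_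
  · refine (contDiffOn_ofReal_radialWeight κ ν).mul fun x hx => ?_
    exact (ContDiffAt.comp x contDiff_smoothTransition_deriv.contDiffAt
      ((contDiffAt_logCoord hx.2).sub contDiffAt_const)).contDiffWithinAt
  · intro x hx hn
    rw [smoothTransition_deriv_eq_zero, Complex.ofReal_zero, mul_zero]
    intro h
    refine hn ⟨?_, ?_⟩
    · by_contra hlt
      have := logCoord_lt hx.2 (one_add_expCoord_pos κ R) (not_le.1 hlt)
      rw [logCoord_expCoord] at this
      linarith [h.1]
    · by_contra hlt
      have := logCoord_lt (one_add_expCoord_pos κ (R + 1)) hx.2 (not_le.1 hlt)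
      rw [logCoord_expCoord] at this
      linarith [h.2]

/-- Up to a multiple of a bump far away, `zᵏ⁺¹ g` is in the range of `A_ν`. -/
theorem exists_lower_eq_sub_bump {κ : ℝ} (ν : ℝ) (k : ℤ) {g : ℝ → ℂ} (hg : IsAnnular κ g) :
    ∃ c : ℂ, ∀ᶠ R in atTop, ∃ ψ, IsTestFunction κ ψ ∧ lower κ ν ψ = fun z =>
      mode (k + 1) g z + c * mode (k + 1) ((radii κ).indicator fun x => (radialWeight κ ν x : ℂ) *
        ((deriv Real.smoothTransition (logCoord κ x - R) : ℝ) : ℂ)) z := by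
  obtain ⟨F, hF, hFd, a, b, ha, hb, hq0, hFa, hFb⟩ :=
    (hg.mul (contDiffOn_inv_weight κ ν)).exists_primitive
  set c := ∫ t, ((radialWeight κ ν t : ℂ) * (1 + κ * (t : ℂ)))⁻¹ * g t with hc
  refine ⟨-c, ?_⟩
  filter_upwards [eventually_gt_atTop 0, eventually_gt_atTop (logCoord κ b)] with R hR hRb
  -- For negative `k` the primitive must vanish at the origin, so it tends to the constant `c` and
  -- has to be cut off far out. The derivative of the cut-off produces the bump with coefficient
  -- `-c`.
  set cut : ℝ → ℂ := fun x => ((1 - Real.smoothTransition (logCoord κ x - R) : ℝ) : ℂ) with hcut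
  have hcutd : ∀ x ∈ radii κ, HasDerivAt cut
      (-((deriv Real.smoothTransition (logCoord κ x - R) : ℝ) : ℂ) / (1 + κ * (x : ℂ))) x := by
    intro x hx
    have h1 := ((Real.smoothTransition.contDiff (n := ⊤)).differentiable (by simp)
      (logCoord κ x - R)).hasDerivAt
    have h2 := (h1.comp x ((hasDerivAt_logCoord hx.2).sub_const R)).const_sub 1
    refine h2.ofReal_comp.congr_deriv ?_
    push_cast
    rw [neg_div, div_eq_mul_inv]
  have hcuts : ContDiffOn ℝ ∞ cut (radii κ) := fun x hx =>
    (ContDiffAt.comp x Complex.ofRealCLM.contDiff.contDiffAt (contDiffAt_const.sub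
      (ContDiffAt.comp x Real.smoothTransition.contDiffAt
        ((contDiffAt_logCoord hx.2).sub contDiffAt_const)))).contDiffWithinAt
  have han : IsAnnular κ ((radii κ).indicator fun x => (radialWeight κ ν x : ℂ) * (F x * cut x)) := by
    refine isAnnular_indicator ha (one_add_expCoord_pos κ (R + 1))
      ((contDiffOn_ofReal_radialWeight κ ν).mul (hF.contDiffOn.mul hcuts)) fun x hx hn => ?_
    rcases lt_or_ge x a with h | h
    · rw [hFa x h]; ring
    · have h1 : expCoord κ (R + 1) < x := not_le.1 fun h' => hn ⟨h, h'⟩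
      have h2 := logCoord_lt (one_add_expCoord_pos κ (R + 1)) hx.2 h1
      rw [logCoord_expCoord] at h2
      simp only [hcut]
      rw [Real.smoothTransition.one_of_one_le (by linarith)]
      simp
  have hbump := exists_isAnnular_bump κ ν hR
  have hsum := hg.add (hbump.const_mul (-c))
  refine ⟨_, han.isTestFunction k, ?_⟩
  have he : (fun z => mode (k + 1) g z + -c * mode (k + 1) ((radii κ).indicator fun x =>
      (radialWeight κ ν x : ℂ) * ((deriv Real.smoothTransition (logCoord κ x - R) : ℝ) : ℂ)) z)
      = mode (k + 1) fun x => g x + -c * (radii κ).indicator (fun x => (radialWeight κ ν x : ℂ) *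
        ((deriv Real.smoothTransition (logCoord κ x - R) : ℝ) : ℂ)) x := by
    funext z; simp only [mode]; ring
  rw [he]
  refine eq_mode_of_eqOn (((han.isTestFunction k).lower' κ ν).2.trans (han.tsupport_mode k).2) hsum
    fun z hz => ?_
  have hx := norm_sq_mem_radii hz.1 hz.2
  rw [lower_congr (isOpen_punctured κ) (mode_indicator_eqOn κ k _) hz,
    lower_mode_radialWeight ν k hz.1 hz.2 ((hFd _).fun_mul (hcutd _ hx)), mode,
    indicator_of_mem hx]
  set x := ‖z‖ ^ 2
  have h1 := ofReal_radialWeight_ne_zero ν hx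
  have h2 := one_add_ne_zero hx
  congr 1
  -- Up to `b` the cut-off is `1` and the bump vanishes; beyond `b` the function `g` vanishes and `F
  -- = c`.
  rcases le_or_gt x b with hxb | hxb
  · have h3 : logCoord κ x - R < 0 := by linarith [logCoord_le hx.2 hb hxb]
    have h4 : cut x = 1 := by
      simp only [hcut, Real.smoothTransition.zero_of_nonpos h3.le]; simp
    rw [smoothTransition_deriv_eq_zero fun h => absurd h.1 (not_le.2 h3), h4]
    push_cast
    field_simp
    ring
  · have h3 := hq0 x fun h => absurd h.2 (not_le.2 hxb)
    have h4 : g x = 0 := (mul_eq_zero.1 h3).resolve_left (inv_ne_zero (mul_ne_zero h1 h2))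
    rw [hFb x hxb, h4]
    field_simp
    ring

/-- For `κ > 0`, `K = N + 2m`, and `N ≥ 1` gives the one degree of growth beyond `m` that `∇^(m+1)`
of a bump requires. -/
theorem Admissible.exists_growth {κ ν : ℝ} {m : ℕ} (hA : Admissible κ ν m) :
    ∃ K : ℕ, 0 < κ → 2 * (ν + m * κ) = κ * K ∧ m + 1 ≤ K := by
  by_cases hκ : 0 < κ
  · obtain ⟨N, hN, hN'⟩ := hA.of_pos hκ
    exact ⟨N + 2 * m, fun _ => ⟨by push_cast; linarith, by omega⟩⟩
  · exact ⟨0, fun h => absurd h hκ⟩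

/-- The images of the bumps converge to zero pointwise, because their supports leave every compact
part of `M_κ`. They are dominated, uniformly in `R`, by a multiple of `w (1 + |z|)^(m+1)`, which is
in `L²`. -/
theorem tendsto_pairing_bump {κ ν : ℝ} {m : ℕ} (hA : Admissible κ ν m) {Φ : ℂ → ℂ}
    (hΦ : MemLp Φ 2 (vol κ)) {k : ℤ} (hk : k < 0) :
    Tendsto (fun R => pairing κ Φ (nablaComp κ ν (m + 1) (mode (k + 1)
      ((radii κ).indicator fun x => (radialWeight κ (ν + m * κ) x : ℂ) *
        ((deriv Real.smoothTransition (logCoord κ x - R) : ℝ) : ℂ))))) atTop (𝓝 0) := by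
  obtain ⟨G, hG, he⟩ := (BumpFamily.base (κ := κ) _ contDiff_smoothTransition_deriv
    fun y hy => by rw [smoothTransition_deriv_eq_zero hy, Complex.ofReal_zero]).exists_nablaComp ν
      (ν + m * κ) (m + 1) (k + 1)
  obtain ⟨C₁, hC₁, hb₁⟩ := hG.exists_norm_le
  obtain ⟨δ, hδ, -, hδs⟩ := exists_closedBall_subset_surface κ
  -- The total power is `k + 1 - (m + 1) + 2(m + 1)`, and this is at most `m + 1` precisely because
  -- `k < 0`.
  obtain ⟨C₂, hC₂, hb₂⟩ := zpow_mul_le (j := k + 1 - (m + 1 : ℕ)) (D := m + 1) (M := m + 1)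
    (by push_cast; omega) hδ
  obtain ⟨K, hK⟩ := hA.exists_growth
  set W : ℂ → ℂ := fun z =>
    ((radialWeight κ (ν + m * κ) (‖z‖ ^ 2) * (1 + ‖z‖) ^ (m + 1) : ℝ) : ℂ) with hW
  have hWm : MemLp W 2 (vol κ) := by
    refine memLp_of_norm_le_weight (K := K) (M := m + 1) (C := 1) hA.top_pos hA.of_neg hK
      (aestronglyMeasurable_vol fun z hz => ?_) ?_
    · refine (Complex.continuous_ofReal.continuousAt.comp (ContinuousAt.mul ?_
        (by fun_prop))).continuousWithinAt
      exact ContinuousAt.comp (f := fun z : ℂ => ‖z‖ ^ 2) (x := z)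
        (contDiffAt_radialWeight (κ := κ) (ν + m * κ) hz).continuousAt (by fun_prop)
    · filter_upwards [ae_vol_mem_surface κ] with z hz
      rw [hW, Complex.norm_real, Real.norm_of_nonneg, one_mul]
      exact mul_nonneg (radialWeight_pos hz).le (by positivity)
  have heq : ∀ R, ∀ z ∈ surface κ \ {0}, nablaComp κ ν (m + 1) (mode (k + 1)
      ((radii κ).indicator fun x => (radialWeight κ (ν + m * κ) x : ℂ) *
        ((deriv Real.smoothTransition (logCoord κ x - R) : ℝ) : ℂ))) z
      = mode (k + 1 - (m + 1 : ℕ)) (fun x => (radialWeight κ (ν + m * κ) x : ℂ) * G R x) z :=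
    fun R z hz => (nablaComp_congr (isOpen_punctured κ) (m + 1)
      (mode_indicator_eqOn κ (k + 1) _) hz).trans (he R hz)
  have hae : ∀ᵐ z ∂(vol κ), z ∈ surface κ \ {0} := by
    filter_upwards [ae_vol_mem_surface κ, ae_vol_ne_zero κ] with z hz hz0 using ⟨hz, hz0⟩
  have hδ2 : 0 < 1 + κ * δ ^ 2 := by
    have : (δ : ℂ) ∈ surface κ := hδs (by simp [abs_of_pos hδ])
    simpa [surface, h] using this
  rw [show (0 : ℂ) = ∫ _, (0 : ℂ) ∂(vol κ) by simp]
  refine tendsto_integral_filter_of_dominated_convergence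
    (fun z => ‖Φ z‖ * ((C₁ * C₂) * ‖W z‖)) ?_ ?_ ?_ ?_
  · filter_upwards [eventually_gt_atTop 0] with R hR
    exact (integrable_pairing hΦ ((((exists_isAnnular_bump κ (ν + m * κ) hR).isTestFunction
      (k + 1)).nablaComp κ ν (m + 1)).memLp 2)).1
  -- For such `R` the bump vanishes for `|z| < δ`, so the negative power of `z` does no harm.
  · filter_upwards [eventually_gt_atTop (logCoord κ (δ ^ 2))] with R hR
    filter_upwards [hae] with z hz
    rw [heq R z hz, norm_mul, RCLike.norm_conj]
    refine mul_le_mul_of_nonneg_left ?_ (norm_nonneg _)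
    have hw := (radialWeight_pos (ν := ν + m * κ) (norm_sq_mem_radii hz.1 hz.2).2).le
    rw [norm_mode, norm_mul, Complex.norm_real, Real.norm_of_nonneg hw]
    by_cases hlt : logCoord κ (‖z‖ ^ 2) < R
    · rw [hG.eq_zero hlt]; simp; positivity
    · have hzδ : δ ≤ ‖z‖ := by
        by_contra hn
        have h1 : ‖z‖ ^ 2 < δ ^ 2 := pow_lt_pow_left₀ (not_le.1 hn) (norm_nonneg z) (by norm_num)
        have h2 := logCoord_lt (norm_sq_mem_radii hz.1 hz.2).2 hδ2 h1
        linarith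
      have e1 := hb₁ R (‖z‖ ^ 2) (by positivity)
      have e2 := hb₂ ‖z‖ hzδ
      rw [zero_add] at e1
      rw [hW, Complex.norm_real, Real.norm_of_nonneg (mul_nonneg hw (by positivity))]
      calc _ ≤ ‖z‖ ^ (k + 1 - (m + 1 : ℕ) : ℤ) * (radialWeight κ (ν + m * κ) (‖z‖ ^ 2)
              * (C₁ * (1 + ‖z‖ ^ 2) ^ (m + 1))) := by gcongr
        _ = C₁ * radialWeight κ (ν + m * κ) (‖z‖ ^ 2)
              * (‖z‖ ^ (k + 1 - (m + 1 : ℕ) : ℤ) * (1 + ‖z‖ ^ 2) ^ (m + 1)) := by ring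
        _ ≤ C₁ * radialWeight κ (ν + m * κ) (‖z‖ ^ 2) * (C₂ * (1 + ‖z‖) ^ (m + 1)) := by gcongr
        _ = _ := by ring
  · exact hΦ.norm.integrable_mul (hWm.norm.const_mul (C₁ * C₂))
  · filter_upwards [hae] with z hz
    refine tendsto_const_nhds.congr' ?_
    filter_upwards [eventually_gt_atTop (logCoord κ (‖z‖ ^ 2))] with R hR
    rw [heq R z hz, mode, hG.eq_zero hR]
    simp

/-- `Φ` annihilates `∇^(m+1) A_{ν+mκ} ψ = (𝔏 - E) ∇^(m) ψ` for test functions `ψ`. For `k ≥ 0` the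
given function has this form; for `k < 0` it does up to a bump whose contribution tends to zero. -/
theorem IsWeakEigenfunction.pairing_nablaComp_mode {κ ν : ℝ} {m : ℕ} (hA : Admissible κ ν m)
    {Φ : ℂ → ℂ} (hΦ : MemLp Φ 2 (vol κ)) (hw : IsWeakEigenfunction κ ν m Φ) (k : ℤ) {g : ℝ → ℂ}
    (hg : IsAnnular κ g) : pairing κ Φ (nablaComp κ ν (m + 1) (mode (k + 1) g)) = 0 := by
  rcases le_or_gt 0 k with hk | hk
  · obtain ⟨n, rfl⟩ := Int.eq_ofNat_of_zero_le hk
    obtain ⟨ψ, hψ, he⟩ := exists_lower_eq_of_nonneg (ν + m * κ) n hg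
    rw [← he]
    exact hw.pairing_nablaComp_lower hΦ hψ
  · obtain ⟨c, hc⟩ := exists_lower_eq_sub_bump (ν + m * κ) k hg
    have h1 := (tendsto_pairing_bump hA hΦ hk).const_mul (conj c)
    rw [mul_zero] at h1
    have h2 : (fun R => conj c * pairing κ Φ (nablaComp κ ν (m + 1) (mode (k + 1)
        ((radii κ).indicator fun x => (radialWeight κ (ν + m * κ) x : ℂ) *
        ((deriv Real.smoothTransition (logCoord κ x - R) : ℝ) : ℂ))))) =ᶠ[atTop]
        fun _ => -pairing κ Φ (nablaComp κ ν (m + 1) (mode (k + 1) g)) := by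
      filter_upwards [hc, eventually_gt_atTop 0] with R ⟨ψ, hψ, he⟩ hR
      have hb := (exists_isAnnular_bump κ (ν + m * κ) hR).isTestFunction (k + 1)
      have hg' := hg.isTestFunction (k + 1)
      have h3 := hw.pairing_nablaComp_lower hΦ hψ
      have h4 : nablaComp κ ν (m + 1) (lower κ (ν + m * κ) ψ) = fun z =>
          nablaComp κ ν (m + 1) (mode (k + 1) g) z + c * nablaComp κ ν (m + 1) (mode (k + 1)
            ((radii κ).indicator fun x => (radialWeight κ (ν + m * κ) x : ℂ) *
            ((deriv Real.smoothTransition (logCoord κ x - R) : ℝ) : ℂ))) z := by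
        funext z
        rw [he, nablaComp_add isOpen_univ κ ν (m + 1) hg'.1.contDiffOn
          (hb.const_mul c).1.contDiffOn (mem_univ z)]
        simp only
        rw [nablaComp_const_mul isOpen_univ κ ν (m + 1) c hb.1.contDiffOn (mem_univ z)]
      rw [h4, pairing_add hΦ ((hg'.nablaComp κ ν (m + 1)).memLp 2)
        (((hb.nablaComp κ ν (m + 1)).const_mul c).memLp 2), pairing_const_mul] at h3
      linear_combination h3
    have h5 := tendsto_nhds_unique (h1.congr' h2) tendsto_const_nhds
    exact neg_eq_zero.1 h5.symm

/-- The radial part of `∇^{(m)} (w zᵏ)`. -/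
def radialPart (κ ν : ℝ) (m : ℕ) (k : ℤ) (x : ℝ) : ℂ :=
  (radialWeight κ (ν + m * κ) x : ℂ) * ((radPoly κ (ν + (ν + m * κ)) m k 1).eval x : ℝ)

theorem contDiffOn_radialPart (κ ν : ℝ) (m : ℕ) (k : ℤ) :
    ContDiffOn ℝ ∞ (radialPart κ ν m k) (radii κ) :=
  (contDiffOn_ofReal_radialWeight κ _).mul
    (Complex.ofRealCLM.contDiff.comp
      (by simpa using Polynomial.contDiff_aeval (𝕜 := ℝ) (radPoly κ (ν + (ν + m * κ)) m k 1) ∞)).contDiffOn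

/-- On test functions of a fixed angular momentum, a weak eigenfunction is determined by its value
on one test function. -/
theorem IsWeakEigenfunction.pairing_mode_eq_zero {κ ν : ℝ} {m : ℕ} (hA : Admissible κ ν m)
    {Φ : ℂ → ℂ} (hΦ : MemLp Φ 2 (vol κ)) (hw : IsWeakEigenfunction κ ν m Φ) (k : ℤ) {φ : ℝ → ℂ}
    (hφ : IsAnnular κ φ)
    (h0 : pairing κ (mode (k - m) (radialPart κ ν m k)) (mode (k - m) φ) = 0) :
    pairing κ Φ (mode (k - m) φ) = 0 := by
  obtain ⟨χ, hχ, he⟩ := hφ.lowerComp_mode m ν (k - m)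
  rw [sub_add_cancel] at he
  have hws := contDiffOn_mode k (contDiffOn_ofReal_radialWeight κ (ν + m * κ))
  have h1 := integral_nablaComp_mul_conj m (ν := ν) (isOpen_punctured κ) sdiff_subset hws
    (hφ.isTestFunction (k - m)) (hφ.tsupport_mode _).2
  have h2 : ∫ z, nablaComp κ ν m (mode k fun x => (radialWeight κ (ν + m * κ) x : ℂ)) z *
      conj (mode (k - m) φ z) ∂(vol κ) = 0 := by
    rw [← h0, pairing]
    refine integral_congr_ae (Eventually.of_forall fun z => ?_)
    by_cases hz : z ∈ surface κ \ {0}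
    · have h3 := nablaComp_mode_radialWeight (κ := κ) (ν := ν) (ν' := ν + m * κ) m k 1 hz
      simp only [Polynomial.eval_one, Complex.ofReal_one, mul_one] at h3
      simp only [h3]
      rfl
    · simp only [hφ.mode_eq_zero _ hz, map_zero, mul_zero]
  rw [h2, he] at h1
  -- By adjointness, `h0` says that `A^(m)` of the test function is orthogonal to `w z^k`, the
  -- solvability condition of the radial equation.
  obtain ⟨g, hg, hge⟩ := hχ.exists_nabla_eq (ν + m * κ) h1.symm
  have h4 := hw.ladderConst_mul_pairing hΦ (hφ.isTestFunction (k - m))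
  have h5 : nablaComp κ ν m (nabla κ (ν + m * κ + κ) (mode (k + 1) g))
      = nablaComp κ ν (m + 1) (mode (k + 1) g) := by
    rw [nablaComp, show ν + m * κ + κ = ν + (m + 1) * κ by ring]
  rw [he, ← hge, h5, hw.pairing_nablaComp_mode hA hΦ k hg] at h4
  exact (mul_eq_zero.1 h4).resolve_left
    (Complex.ofReal_ne_zero.2 (ladderConst_pos m hA.pos hA.top_pos).ne')

/-! ### Exhaustion of `M_κ` without the origin by annuli -/

/-- Cut-off functions of `x = |z|²` that converge to `1` on `radii κ`. -/
def cutoff (κ : ℝ) (n : ℕ) (x : ℝ) : ℝ :=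
  Real.smoothTransition ((n + 1) * x - 1) * Real.smoothTransition ((n + 1) * (1 + κ * x) - 1) *
    Real.smoothTransition (2 - x / (n + 1))

theorem cutoff_nonneg (κ : ℝ) (n : ℕ) (x : ℝ) : 0 ≤ cutoff κ n x :=
  mul_nonneg (mul_nonneg (Real.smoothTransition.nonneg _) (Real.smoothTransition.nonneg _))
    (Real.smoothTransition.nonneg _)

theorem cutoff_le_one (κ : ℝ) (n : ℕ) (x : ℝ) : cutoff κ n x ≤ 1 :=
  mul_le_one₀ (mul_le_one₀ (Real.smoothTransition.le_one _) (Real.smoothTransition.nonneg _)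
    (Real.smoothTransition.le_one _)) (Real.smoothTransition.nonneg _)
    (Real.smoothTransition.le_one _)

theorem contDiff_cutoff (κ : ℝ) (n : ℕ) : ContDiff ℝ ∞ (cutoff κ n) :=
  ((Real.smoothTransition.contDiff.comp (by fun_prop)).mul
    (Real.smoothTransition.contDiff.comp (by fun_prop))).mul
    (Real.smoothTransition.contDiff.comp (by fun_prop))

/-- The three factors keep `x` away from the origin, from the zero of `1 + κx`, and from infinity.
The upper endpoint depends on the sign of `κ`: for `κ < 0` the second factor already bounds `x`. -/
theorem isAnnular_cutoff (κ : ℝ) (n : ℕ) : IsAnnular κ fun x => (cutoff κ n x : ℂ) := by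
  have hn : (0 : ℝ) < n + 1 := by positivity
  have h0 : ∀ x, (cutoff κ n x : ℂ) ≠ 0 →
      1 < (n + 1) * x ∧ 1 < (n + 1) * (1 + κ * x) ∧ x < 2 * (n + 1) := by
    intro x hx
    have hx' : cutoff κ n x ≠ 0 := fun h => hx (by rw [h, Complex.ofReal_zero])
    refine ⟨?_, ?_, ?_⟩
    · by_contra h
      exact hx' (by rw [cutoff, Real.smoothTransition.zero_of_nonpos (by linarith), zero_mul,
        zero_mul])
    · by_contra h
      refine hx' ?_
      rw [cutoff, Real.smoothTransition.zero_of_nonpos (x := (n + 1) * (1 + κ * x) - 1)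
        (by linarith), mul_zero, zero_mul]
    · by_contra h
      refine hx' ?_
      rw [cutoff, Real.smoothTransition.zero_of_nonpos (x := 2 - x / (n + 1)), mul_zero]
      rw [sub_nonpos, le_div_iff₀ hn]
      linarith
  refine ⟨Complex.ofRealCLM.contDiff.comp (contDiff_cutoff κ n), (n + 1 : ℝ)⁻¹,
    if 0 ≤ κ then 2 * (n + 1) else ((n + 1 : ℝ)⁻¹ - 1) / κ, by positivity, ?_, fun x hx => ?_⟩
  · split_ifs with hκ
    · positivity
    · rw [mul_div_cancel₀ _ (not_le.1 hκ).ne, add_sub_cancel]; positivity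
  · by_contra hne
    obtain ⟨h1, h2, h3⟩ := h0 x hne
    refine hx ⟨(inv_le_iff_one_le_mul₀ hn).2 (by linarith), ?_⟩
    split_ifs with hκ
    · exact h3.le
    · rw [le_div_iff_of_neg (not_le.1 hκ)]
      have : (n + 1 : ℝ)⁻¹ ≤ 1 + κ * x := (inv_le_iff_one_le_mul₀ hn).2 (by linarith)
      linarith

theorem eventually_cutoff_eq_one {κ x : ℝ} (hx : x ∈ radii κ) :
    ∀ᶠ n : ℕ in atTop, cutoff κ n x = 1 := by
  have hlim : Tendsto (fun n : ℕ => (n : ℝ) + 1) atTop atTop :=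
    tendsto_atTop_add_const_right _ _ tendsto_natCast_atTop_atTop
  filter_upwards [hlim.eventually_ge_atTop (2 / x), hlim.eventually_ge_atTop (2 / (1 + κ * x)),
    hlim.eventually_ge_atTop x] with n h1 h2 h3
  have hn : (0 : ℝ) < n + 1 := by positivity
  rw [div_le_iff₀ hx.1] at h1
  rw [div_le_iff₀ hx.2] at h2
  rw [cutoff, Real.smoothTransition.one_of_one_le (by linarith),
    Real.smoothTransition.one_of_one_le (by linarith), Real.smoothTransition.one_of_one_le, one_mul,
    one_mul]
  have : x / (n + 1) ≤ 1 := (div_le_one hn).2 h3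
  linarith

theorem ae_eventually_cutoff_eq_one (κ : ℝ) :
    ∀ᵐ z ∂(vol κ), ∀ᶠ n : ℕ in atTop, cutoff κ n (‖z‖ ^ 2) = 1 := by
  filter_upwards [ae_vol_mem_surface κ, ae_vol_ne_zero κ] with z hz hz0
  exact eventually_cutoff_eq_one (norm_sq_mem_radii hz hz0)

theorem continuous_cutoff_norm_sq (κ : ℝ) (n : ℕ) :
    Continuous fun z : ℂ => (cutoff κ n (‖z‖ ^ 2) : ℂ) :=
  Complex.continuous_ofReal.comp ((contDiff_cutoff κ n).continuous.comp (by fun_prop))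

theorem norm_mul_cutoff_le (κ : ℝ) (n : ℕ) (w : ℂ) (x : ℝ) : ‖w * (cutoff κ n x : ℂ)‖ ≤ ‖w‖ := by
  rw [norm_mul, Complex.norm_real, Real.norm_of_nonneg (cutoff_nonneg κ n x)]
  exact mul_le_of_le_one_right (norm_nonneg _) (cutoff_le_one κ n x)

theorem memLp_mul_cutoff {κ : ℝ} {Φ : ℂ → ℂ} (hΦ : MemLp Φ 2 (vol κ)) (n : ℕ) :
    MemLp (fun z => Φ z * (cutoff κ n (‖z‖ ^ 2) : ℂ)) 2 (vol κ) :=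
  hΦ.of_le (hΦ.1.mul (continuous_cutoff_norm_sq κ n).aestronglyMeasurable)
    (Eventually.of_forall fun _ => norm_mul_cutoff_le _ _ _ _)

theorem pairing_eq_inner {κ : ℝ} {Φ φ : ℂ → ℂ} (hΦ : MemLp Φ 2 (vol κ)) (hφ : MemLp φ 2 (vol κ)) :
    pairing κ Φ φ = ⟪hφ.toLp φ, hΦ.toLp Φ⟫_ℂ := by
  rw [L2.inner_def, pairing]
  refine integral_congr_ae ?_
  filter_upwards [hΦ.coeFn_toLp, hφ.coeFn_toLp] with z h1 h2
  rw [h1, h2]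
  simp

/-- The cut-off enters squared to match the test functions of `memLp_mode_of_pairing_eq`, where one
factor goes to each side of the pairing. -/
theorem tendsto_pairing_cutoff_sq {κ : ℝ} {Φ φ : ℂ → ℂ} (hΦ : MemLp Φ 2 (vol κ))
    (hφ : MemLp φ 2 (vol κ)) :
    Tendsto (fun n => pairing κ Φ fun z => φ z * (cutoff κ n (‖z‖ ^ 2) : ℂ) ^ 2) atTop
      (𝓝 (pairing κ Φ φ)) := by
  refine tendsto_integral_of_dominated_convergence (fun z => ‖Φ z * conj (φ z)‖) (fun n => ?_)
    (integrable_pairing hΦ hφ).norm (fun n => Eventually.of_forall fun z => ?_) ?_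
  · exact hΦ.1.mul (Complex.continuous_conj.comp_aestronglyMeasurable
      (hφ.1.mul ((continuous_cutoff_norm_sq κ n).pow 2).aestronglyMeasurable))
  · simp only [norm_mul (Φ z), RCLike.norm_conj, sq, ← mul_assoc]
    exact mul_le_mul_of_nonneg_left
      ((norm_mul_cutoff_le _ _ _ _).trans (norm_mul_cutoff_le _ _ _ _)) (norm_nonneg _)
  · filter_upwards [ae_eventually_cutoff_eq_one κ] with z hz
    refine tendsto_const_nhds.congr' ?_
    filter_upwards [hz] with n hn
    rw [hn]; simp

/-! ### Orthogonality to all test functions of a fixed angular momentum -/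

/-- A functional that vanishes on the kernel of another one is a multiple of it. -/
theorem IsWeakEigenfunction.exists_pairing_mode_eq {κ ν : ℝ} {m : ℕ} (hA : Admissible κ ν m)
    {Φ : ℂ → ℂ} (hΦ : MemLp Φ 2 (vol κ)) (hw : IsWeakEigenfunction κ ν m Φ) (k : ℤ) :
    ∃ d : ℂ, ∀ φ, IsAnnular κ φ → pairing κ Φ (mode (k - m) φ)
      = d * pairing κ (mode (k - m) (radialPart κ ν m k)) (mode (k - m) φ) := by
  set Ψ := mode (k - m) (radialPart κ ν m k) with hΨ
  by_cases hall : ∀ φ, IsAnnular κ φ → pairing κ Ψ (mode (k - m) φ) = 0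
  · exact ⟨0, fun φ hφ => by
      rw [hw.pairing_mode_eq_zero hA hΦ k hφ (hall φ hφ), zero_mul]⟩
  push Not at hall
  obtain ⟨φ₁, hφ₁, hne⟩ := hall
  refine ⟨pairing κ Φ (mode (k - m) φ₁) / pairing κ Ψ (mode (k - m) φ₁), fun φ hφ => ?_⟩
  have hint : ∀ φ, IsAnnular κ φ → Integrable (fun z => Ψ z * conj (mode (k - m) φ z)) (vol κ) :=
    fun φ hφ => integrable_mul_conj (isOpen_punctured κ)
      (contDiffOn_mode _ (contDiffOn_radialPart κ ν m k)) (hφ.isTestFunction _)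
      (hφ.tsupport_mode _).2
  set c := -conj (pairing κ Ψ (mode (k - m) φ) / pairing κ Ψ (mode (k - m) φ₁)) with hc
  have he : mode (k - m) (fun x => φ x + c * φ₁ x)
      = fun z => mode (k - m) φ z + c * mode (k - m) φ₁ z := by
    funext z; simp only [mode]; ring
  have h0 : pairing κ Ψ (mode (k - m) fun x => φ x + c * φ₁ x) = 0 := by
    have h1 := hint _ (hφ₁.const_mul c)
    have h2 : mode (k - m) (fun x => c * φ₁ x) = fun z => c * mode (k - m) φ₁ z := by
      funext z; simp only [mode]; ring
    rw [h2] at h1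
    rw [he, pairing]
    simp only [map_add, mul_add]
    rw [integral_add (hint φ hφ) h1]
    change pairing κ Ψ (mode (k - m) φ) + pairing κ Ψ (fun z => c * mode (k - m) φ₁ z) = 0
    rw [pairing_const_mul, hc, map_neg, Complex.conj_conj, neg_mul, div_mul_cancel₀ _ hne,
      add_neg_cancel]
  have h3 := hw.pairing_mode_eq_zero hA hΦ k (hφ.add (hφ₁.const_mul c)) h0
  rw [he, pairing_add hΦ ((hφ.isTestFunction _).memLp 2)
    (((hφ₁.isTestFunction _).const_mul c).memLp 2), pairing_const_mul, hc, map_neg,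
    Complex.conj_conj] at h3
  rw [div_mul_eq_mul_div, eq_div_iff hne]
  rw [neg_mul, ← sub_eq_add_neg, div_mul_eq_mul_div, sub_eq_zero, eq_div_iff hne] at h3
  rw [h3]; ring

/-- If the values of an `L²` function on the test functions `zʲ φ(|z|²)` are proportional to those
of `zʲ g(|z|²)`, with a nonzero factor, then the latter function is in `L²`. -/
theorem memLp_mode_of_pairing_eq {κ : ℝ} {j : ℤ} {g : ℝ → ℂ} (hg : ContDiffOn ℝ ∞ g (radii κ))
    {Φ : ℂ → ℂ} (hΦ : MemLp Φ 2 (vol κ)) {d : ℂ} (hd : d ≠ 0)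
    (h : ∀ φ, IsAnnular κ φ → pairing κ Φ (mode j φ) = d * pairing κ (mode j g) (mode j φ)) :
    MemLp (mode j g) 2 (vol κ) := by
  have han : ∀ n, IsAnnular κ fun x => g x * (cutoff κ n x : ℂ) := fun n =>
    (isAnnular_cutoff κ n).mul hg
  have han' : ∀ n, IsAnnular κ fun x => g x * (cutoff κ n x : ℂ) ^ 2 := fun n => by
    have := (isAnnular_cutoff κ n).mul (hg.mul (isAnnular_cutoff κ n).smooth.contDiffOn)
    simpa only [sq, mul_assoc] using this
  have hP : ∀ n, MemLp (mode j fun x => g x * (cutoff κ n x : ℂ)) 2 (vol κ) := fun n =>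
    ((han n).isTestFunction j).memLp 2
  -- Testing with `g` times the squared cut-off gives `|d| ‖g·cut‖² ≤ ‖Φ‖ ‖g·cut‖` by
  -- Cauchy–Schwarz. The resulting bound is uniform in `n`, and Fatou's lemma passes to the limit.
  have hb : ∀ n, ‖(hP n).toLp‖ ≤ ‖hΦ.toLp‖ / ‖d‖ := by
    intro n
    have e1 : pairing κ Φ (mode j fun x => g x * (cutoff κ n x : ℂ) ^ 2)
        = pairing κ (fun z => Φ z * (cutoff κ n (‖z‖ ^ 2) : ℂ))
          (mode j fun x => g x * (cutoff κ n x : ℂ)) := by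
      refine integral_congr_ae (Eventually.of_forall fun z => ?_)
      simp only [mode, map_mul, map_pow, Complex.conj_ofReal]; ring
    have e2 : pairing κ (mode j g) (mode j fun x => g x * (cutoff κ n x : ℂ) ^ 2)
        = pairing κ (mode j fun x => g x * (cutoff κ n x : ℂ))
          (mode j fun x => g x * (cutoff κ n x : ℂ)) := by
      refine integral_congr_ae (Eventually.of_forall fun z => ?_)
      simp only [mode, map_mul, map_pow, Complex.conj_ofReal]; ring
    have h1 := h _ (han' n)
    rw [e1, e2, pairing_eq_inner (memLp_mul_cutoff hΦ n) (hP n), pairing_eq_inner (hP n) (hP n),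
      inner_self_eq_norm_sq_to_K] at h1
    have h2 := norm_inner_le_norm (𝕜 := ℂ) (hP n).toLp (memLp_mul_cutoff hΦ n).toLp
    have h3 : ‖(memLp_mul_cutoff hΦ n).toLp‖ ≤ ‖hΦ.toLp‖ := by
      rw [Lp.norm_toLp, Lp.norm_toLp]
      exact ENNReal.toReal_mono hΦ.2.ne (eLpNorm_mono fun z => norm_mul_cutoff_le _ _ _ _)
    rw [h1] at h2
    simp only [norm_mul, norm_pow, Complex.coe_algebraMap, Complex.norm_real, norm_norm] at h2
    have hd' : 0 < ‖d‖ := norm_pos_iff.2 hd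
    rw [le_div_iff₀ hd']
    rcases (norm_nonneg (hP n).toLp).eq_or_lt with h0 | h0
    · rw [← h0, zero_mul]; exact norm_nonneg _
    · refine le_trans (le_of_mul_le_mul_left ?_ h0) h3
      linarith
  have hlim : ∀ᵐ z ∂(vol κ), Tendsto (fun n => mode j (fun x => g x * (cutoff κ n x : ℂ)) z) atTop
      (𝓝 (mode j g z)) := by
    filter_upwards [ae_eventually_cutoff_eq_one κ] with z hz
    refine tendsto_const_nhds.congr' ?_
    filter_upwards [hz] with n hn
    simp only [mode, hn, Complex.ofReal_one, mul_one]
  refine ⟨aestronglyMeasurable_of_tendsto_ae _ (fun n => (hP n).1) hlim,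
    (Lp.eLpNorm_lim_le_liminf_eLpNorm (fun n => (hP n).1) _ hlim).trans_lt
      (lt_of_le_of_lt (b := ENNReal.ofReal (‖hΦ.toLp‖ / ‖d‖)) ?_ ENNReal.ofReal_lt_top)⟩
  refine liminf_le_of_frequently_le' (Frequently.of_forall fun n => ?_)
  have := hb n
  rw [Lp.norm_toLp] at this
  exact (ENNReal.le_ofReal_iff_toReal_le (hP n).2.ne (by positivity)).2 this

theorem mode_radialPart_ae_eq_Psi (κ ν : ℝ) (m n : ℕ) :
    mode ((n : ℤ) - m) (radialPart κ ν m n) =ᵐ[vol κ] Psi κ ν m n := by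
  filter_upwards [ae_vol_mem_surface κ, ae_vol_ne_zero κ] with z hz hz0
  exact (Psi_eq_mode κ ν m n ⟨hz, hz0⟩).symm

theorem Psi_toLp_ne_zero {κ ν : ℝ} {m : ℕ} (hA : Admissible κ ν m) {n : ℕ}
    (hm : MemLp (Psi κ ν m n) 2 (vol κ)) : hm.toLp ≠ 0 := by
  intro h0
  obtain ⟨z, hz, hne⟩ := exists_Psi_ne_zero hA n
  refine hne (eqOn_zero_of_ae_vol (contDiffOn_Psi κ ν m n).continuousOn ?_ hz)
  filter_upwards [hm.coeFn_toLp, Lp.coeFn_zero ℂ 2 (vol κ)] with w h1 h2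
  rw [← h1, h0, h2, Pi.zero_apply]

/-- A nonzero factor `d` would put `∇^(m)(w z^k)` into `L²`. For `k < 0` this fails at the origin;
for `k ≥ 0` removing the cut-offs turns the proportionality into `0 = d ‖Psi‖²`, with `Psi` nonzero.
-/
theorem IsWeakEigenfunction.pairing_mode_eq_zero_of_orthogonal {κ ν : ℝ} {m : ℕ}
    (hA : Admissible κ ν m) {Φ : ℂ → ℂ} (hΦ : MemLp Φ 2 (vol κ)) (hw : IsWeakEigenfunction κ ν m Φ)
    (horth : ∀ n, MemLp (Psi κ ν m n) 2 (vol κ) → pairing κ Φ (Psi κ ν m n) = 0) (j : ℤ) {φ : ℝ → ℂ}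
    (hφ : IsAnnular κ φ) : pairing κ Φ (mode j φ) = 0 := by
  obtain ⟨k, rfl⟩ : ∃ k : ℤ, j = k - m := ⟨j + m, by ring⟩
  obtain ⟨d, hd⟩ := hw.exists_pairing_mode_eq hA hΦ k
  suffices d = 0 by rw [hd φ hφ, this, zero_mul]
  by_contra hd0
  have hL := memLp_mode_of_pairing_eq (contDiffOn_radialPart κ ν m k) hΦ hd0 hd
  rcases lt_or_ge k 0 with hk | hk
  · exact not_memLp_mode_of_neg m hk hL
  lift k to ℕ using hk with n
  have hae := mode_radialPart_ae_eq_Psi κ ν m n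
  have hP : MemLp (Psi κ ν m n) 2 (vol κ) := (memLp_congr_ae hae).1 hL
  have h1 : pairing κ Φ (mode (n - m) (radialPart κ ν m n)) = 0 := by
    rw [← horth n hP]
    refine integral_congr_ae ?_
    filter_upwards [hae] with z hz
    rw [hz]
  have hseq : ∀ i, pairing κ Φ (fun z => mode (n - m) (radialPart κ ν m n) z *
      (cutoff κ i (‖z‖ ^ 2) : ℂ) ^ 2) = d * pairing κ (mode (n - m) (radialPart κ ν m n))
      (fun z => mode (n - m) (radialPart κ ν m n) z * (cutoff κ i (‖z‖ ^ 2) : ℂ) ^ 2) := by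
    intro i
    have h2 := hd (fun x => radialPart κ ν m n x * (cutoff κ i x : ℂ) ^ 2) (by
      have := (isAnnular_cutoff κ i).mul ((contDiffOn_radialPart κ ν m n).mul
        (isAnnular_cutoff κ i).smooth.contDiffOn)
      simpa only [sq, mul_assoc] using this)
    have h3 : mode (n - m) (fun x => radialPart κ ν m n x * (cutoff κ i x : ℂ) ^ 2)
        = fun z => mode (n - m) (radialPart κ ν m n) z * (cutoff κ i (‖z‖ ^ 2) : ℂ) ^ 2 := by
      funext z; simp only [mode]; ring
    rwa [h3] at h2
  have h4 := tendsto_pairing_cutoff_sq hΦ hL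
  rw [funext hseq, h1] at h4
  have h5 := tendsto_nhds_unique ((tendsto_pairing_cutoff_sq hL hL).const_mul d) h4
  rw [pairing_eq_inner hL hL] at h5
  have h6 := inner_self_eq_zero.1 ((mul_eq_zero.1 h5).resolve_left hd0)
  refine Psi_toLp_ne_zero hA hP ?_
  rw [← h6]
  exact (MemLp.toLp_eq_toLp_iff _ _).2 hae.symm

/-! ### Functions orthogonal to all polynomials in `z` and `z̄` -/

/-- Integration against an integrable function on a compact set, as a functional on the continuous
functions. -/
def integralFunctional {K : Set ℂ} [CompactSpace K] {μ : Measure K} {F : K → ℂ}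
    (hF : Integrable F μ) : C(K, ℂ) →L[ℂ] ℂ :=
  have hint (f : C(K, ℂ)) : Integrable (fun z => f z * F z) μ :=
    hF.bdd_mul f.continuous.aestronglyMeasurable (Eventually.of_forall f.norm_coe_le_norm)
  LinearMap.mkContinuous
    { toFun := fun f => ∫ z, f z * F z ∂μ
      map_add' := fun f g => by
        simp only [ContinuousMap.add_apply, add_mul]
        exact integral_add (hint f) (hint g)
      map_smul' := fun c f => by
        simp only [ContinuousMap.smul_apply, smul_eq_mul, mul_assoc, integral_const_mul,
          RingHom.id_apply] }
    (∫ z, ‖F z‖ ∂μ) fun f => by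
      rw [mul_comm, ← integral_const_mul]
      refine norm_integral_le_of_norm_le (hF.norm.const_mul _) (Eventually.of_forall fun z => ?_)
      rw [norm_mul]
      exact mul_le_mul_of_nonneg_right (f.norm_coe_le_norm z) (norm_nonneg _)

/-- The integral against `F` is a continuous functional on `C(K)` that vanishes on the polynomials
in `z` and `z̄`, which are dense by Stone–Weierstrass. So it vanishes on all continuous functions,
in particular on smooth test functions. -/
theorem ae_eq_zero_of_integral_pow_mul_pow {μ : Measure ℂ} {F : ℂ → ℂ} (hF : Integrable F μ)
    {K : Set ℂ} (hK : IsCompact K) (hFK : ∀ z, z ∉ K → F z = 0)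
    (h0 : ∀ a b : ℕ, ∫ z, z ^ a * conj z ^ b * F z ∂μ = 0) : ∀ᵐ z ∂μ, F z = 0 := by
  have : CompactSpace K := isCompact_iff_compactSpace.1 hK
  have hKm := hK.measurableSet
  have hF' : Integrable (fun z : K => F z) (μ.comap Subtype.val) :=
    (integrableOn_iff_comap_subtypeVal hKm).1 hF.integrableOn
  have hval : ∀ f : ℂ → ℂ, ∫ z : K, f z * F z ∂(μ.comap Subtype.val) = ∫ z, f z * F z ∂μ := by
    intro f
    rw [integral_subtype_comap hKm fun z => f z * F z]
    exact setIntegral_eq_integral_of_forall_compl_eq_zero fun z hz => by rw [hFK z hz, mul_zero]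
  have hker : ∀ f : C(K, ℂ), integralFunctional hF' f = 0 := by
    intro f
    have hle : (polynomialFunctions K).starClosure.toSubalgebra.toSubmodule
        ≤ LinearMap.ker (integralFunctional hF').toLinearMap := by
      rw [polynomialFunctions.starClosure_eq_adjoin_X, StarAlgebra.adjoin_toSubalgebra,
        Algebra.adjoin_eq_span, Submodule.span_le, star_singleton, singleton_union]
      intro g hg
      obtain ⟨a, b, rfl⟩ := (Submonoid.mem_closure_pair _ _ _).1 hg
      refine LinearMap.mem_ker.2 (Eq.trans ?_ (h0 a b))
      rw [← hval fun z => z ^ a * conj z ^ b]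
      refine integral_congr_ae (Eventually.of_forall fun z => ?_)
      simp
    have hmem : f ∈ (polynomialFunctions K).starClosure.topologicalClosure := by
      rw [polynomialFunctions.starClosure_topologicalClosure]; trivial
    have := closure_mono hle (StarSubalgebra.topologicalClosure_coe (R := ℂ)
      (polynomialFunctions K).starClosure ▸ hmem : f ∈ closure _)
    rw [(integralFunctional hF').isClosed_ker.closure_eq] at this
    exact this
  refine ae_eq_zero_of_integral_contDiff_smul_eq_zero hF.locallyIntegrable fun g hg _ => ?_
  have h1 := hval fun z => (g z : ℂ)
  have h2 := hker ⟨fun z => (g z : ℂ), by fun_prop⟩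
  simp only [Complex.real_smul]
  rw [← h1]
  exact h2

/-- After multiplication by a cut-off, the moment with `z^a z̄^b` is the pairing with the annular
function of angular momentum `b - a` and radial part `x^a` times the cut-off. -/
theorem ae_eq_zero_of_pairing_mode {κ : ℝ} {Φ : ℂ → ℂ} (hΦ : MemLp Φ 2 (vol κ))
    (h0 : ∀ (j : ℤ) (φ : ℝ → ℂ), IsAnnular κ φ → pairing κ Φ (mode j φ) = 0) :
    ∀ᵐ z ∂(vol κ), Φ z = 0 := by
  have hn : ∀ n : ℕ, ∀ᵐ z ∂(vol κ), Φ z * (cutoff κ n (‖z‖ ^ 2) : ℂ) = 0 := by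
    intro n
    have han := isAnnular_cutoff κ n
    have htest := han.isTestFunction 0
    have he : mode 0 (fun x => (cutoff κ n x : ℂ)) = fun z => (cutoff κ n (‖z‖ ^ 2) : ℂ) := by
      funext z; simp [mode]
    rw [he] at htest
    have hint : Integrable (fun z => Φ z * (cutoff κ n (‖z‖ ^ 2) : ℂ)) (vol κ) := by
      simpa using integrable_pairing hΦ (htest.memLp 2)
    refine ae_eq_zero_of_integral_pow_mul_pow hint htest.2.1.isCompact
      (fun z hz => by rw [image_eq_zero_of_notMem_tsupport hz, mul_zero]) fun a b => ?_
    have hp := h0 (b - a) (fun x => (x : ℂ) ^ a * (cutoff κ n x : ℂ))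
      (han.mul (Complex.ofRealCLM.contDiff.pow a).contDiffOn)
    rw [← hp]
    refine integral_congr_ae ?_
    filter_upwards [ae_vol_ne_zero κ] with z hz
    have hz' : conj z ≠ 0 := (map_ne_zero _).2 hz
    have e : ((‖z‖ ^ 2 : ℝ) : ℂ) = z * conj z := by push_cast; exact norm_sq_eq z
    simp only [mode, map_mul, map_pow, map_zpow₀, Complex.conj_ofReal]
    rw [e, mul_pow, zpow_sub₀ hz', zpow_natCast, zpow_natCast]
    field_simp
  filter_upwards [ae_all_iff.2 hn, ae_eventually_cutoff_eq_one κ] with z h1 h2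
  obtain ⟨n, hn⟩ := h2.exists
  have := h1 n
  rwa [hn, Complex.ofReal_one, mul_one] at this

/-! ### The eigenspace -/

theorem isWeakEigenfunction_Psi (κ ν : ℝ) (m n : ℕ) : IsWeakEigenfunction κ ν m (Psi κ ν m n) := by
  intro φ hφ
  rw [pairing, integral_twistedLaplacian_mul_conj ν (isOpen_surface κ) subset_rfl
    (contDiffOn_Psi κ ν m n) hφ hφ.2.2, pairing, ← integral_const_mul]
  refine integral_congr_ae ?_
  filter_upwards [ae_vol_mem_surface κ] with z hz
  rw [twistedLaplacian_Psi κ ν m n hz, mul_assoc]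

/-- The functions `𝔏 φ - E φ` for test functions `φ`. -/
def defects (κ ν : ℝ) (m : ℕ) : Set (Lp ℂ 2 (vol κ)) :=
  {f | ∃ φ, IsTestFunction κ φ ∧
    f =ᵐ[vol κ] fun z => twistedLaplacian κ ν φ z - (eigenvalue κ ν m : ℂ) * φ z}

theorem mem_eigenspace_iff {κ ν : ℝ} {m : ℕ} (Φ : Lp ℂ 2 (vol κ)) :
    Φ ∈ eigenspace κ ν m ↔ IsWeakEigenfunction κ ν m Φ :=
  Iff.rfl

/-- As an orthogonal complement, the eigenspace is a closed subspace, so the projection argument for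
completeness applies inside it. -/
theorem eigenspace_eq (κ ν : ℝ) (m : ℕ) :
    eigenspace κ ν m = ((Submodule.span ℂ (defects κ ν m))ᗮ : Submodule ℂ (Lp ℂ 2 (vol κ))) := by
  ext Φ
  have hΦ := Lp.memLp Φ
  rw [SetLike.mem_coe, Submodule.mem_orthogonal, mem_eigenspace_iff]
  have key : ∀ φ, IsTestFunction κ φ → ∀ f : Lp ℂ 2 (vol κ),
      f =ᵐ[vol κ] (fun z => twistedLaplacian κ ν φ z - (eigenvalue κ ν m : ℂ) * φ z) →
      ⟪f, Φ⟫_ℂ = pairing κ Φ (twistedLaplacian κ ν φ) - (eigenvalue κ ν m : ℂ) * pairing κ Φ φ := by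
    intro φ hφ f hf
    have h1 := pairing_add hΦ ((hφ.twistedLaplacian ν).memLp 2)
      ((hφ.const_mul (-(eigenvalue κ ν m : ℂ))).memLp 2)
    rw [pairing_const_mul, map_neg, Complex.conj_ofReal, neg_mul, ← sub_eq_add_neg] at h1
    rw [← h1, L2.inner_def, pairing]
    refine integral_congr_ae ?_
    filter_upwards [hf] with z hz
    rw [hz]
    simp [sub_eq_add_neg]
  constructor
  · intro hw u hu
    induction hu using Submodule.span_induction with
    | mem f hf =>
      obtain ⟨φ, hφ, hfe⟩ := hf
      rw [key φ hφ f hfe, hw φ hφ, sub_self]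
    | zero => exact inner_zero_left _
    | add f g _ _ hf hg => rw [inner_add_left, hf, hg, add_zero]
    | smul c f _ hf => rw [inner_smul_left, hf, mul_zero]
  · intro h φ hφ
    have hd : MemLp (fun z => twistedLaplacian κ ν φ z - (eigenvalue κ ν m : ℂ) * φ z) 2 (vol κ) :=
      ((hφ.twistedLaplacian ν).memLp 2).sub ((hφ.const_mul _).memLp 2)
    have h1 := h hd.toLp (Submodule.subset_span ⟨φ, hφ, hd.coeFn_toLp⟩)
    rw [key φ hφ _ hd.coeFn_toLp] at h1
    exact sub_eq_zero.1 h1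

theorem IsWeakEigenfunction.congr {κ ν : ℝ} {m : ℕ} {Φ Ψ : ℂ → ℂ} (hw : IsWeakEigenfunction κ ν m Φ)
    (h : Φ =ᵐ[vol κ] Ψ) : IsWeakEigenfunction κ ν m Ψ := by
  have : ∀ φ, pairing κ Ψ φ = pairing κ Φ φ := fun φ => by
    refine integral_congr_ae ?_
    filter_upwards [h] with z hz
    rw [hz]
  intro φ hφ
  rw [this, this, hw φ hφ]

theorem isOrthogonalBasis_Psi {κ ν : ℝ} {m : ℕ} (hA : Admissible κ ν m) :
    IsOrthogonalBasis (fun n : {n : ℕ // MemLp (Psi κ ν m n) 2 (vol κ)} => n.2.toLp)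
      (eigenspace κ ν m) := by
  refine ⟨fun n => Psi_toLp_ne_zero hA n.2, fun i j hij => ?_, ?_⟩
  · rw [← pairing_eq_inner j.2 i.2]
    exact integral_Psi_mul_conj_Psi κ ν m fun h => hij (Subtype.ext h.symm)
  set V := Submodule.span ℂ (range fun n : {n : ℕ // MemLp (Psi κ ν m n) 2 (vol κ)} => n.2.toLp)
  have hle : V.topologicalClosure ≤ (Submodule.span ℂ (defects κ ν m))ᗮ := by
    refine Submodule.topologicalClosure_minimal _ (Submodule.span_le.2 ?_)
      (Submodule.isClosed_orthogonal _)
    rintro _ ⟨n, rfl⟩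
    rw [← eigenspace_eq]
    exact (isWeakEigenfunction_Psi κ ν m n).congr n.2.coeFn_toLp.symm
  rw [eigenspace_eq, SetLike.coe_set_eq]
  have : CompleteSpace V.topologicalClosure := V.isClosed_topologicalClosure.completeSpace_coe
  -- The eigenspace is the closed span plus its orthogonal complement within the eigenspace, so it
  -- remains to see that this complement is zero.
  rw [← Submodule.sup_orthogonal_inf_of_hasOrthogonalProjection hle, left_eq_sup]
  refine ((Submodule.eq_bot_iff _).2 ?_).trans_le bot_le
  intro Φ hΦ
  have hw : IsWeakEigenfunction κ ν m Φ := by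
    rw [← mem_eigenspace_iff, eigenspace_eq]
    exact hΦ.2
  have hL := Lp.memLp Φ
  have horth : ∀ n, MemLp (Psi κ ν m n) 2 (vol κ) → pairing κ Φ (Psi κ ν m n) = 0 := by
    intro n hn
    rw [pairing_eq_inner hL hn, Lp.toLp_coeFn]
    exact hΦ.1 _ (V.le_topologicalClosure (Submodule.subset_span ⟨⟨n, hn⟩, rfl⟩))
  refine (Lp.eq_zero_iff_ae_eq_zero).2 (ae_eq_zero_of_pairing_mode hL fun j φ hφ => ?_)
  exact hw.pairing_mode_eq_zero_of_orthogonal hA hL horth j hφ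

/-! ### The hypotheses on the parameters -/

theorem admissible_of_lt {κ ν : ℝ} {m : ℕ} (hν : 0 < ν)
    (hκ_pos : 0 < κ → ∃ N : ℕ, 0 < N ∧ 2 * ν / κ = N)
    (hm : κ < 0 → (m : ℝ) < (2 * ν + κ) / (|κ| - κ)) : Admissible κ ν m := by
  have hneg : κ < 0 → -κ < 2 * (ν + m * κ) := fun h => by
    have h1 := hm h
    -- For `κ < 0` the denominator is `-2κ`, and the bound on `m` becomes `-κ < 2(ν + mκ)`, the
    -- integrability condition at the boundary circle.
    rw [abs_of_neg h, lt_div_iff₀ (by linarith)] at h1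
    linarith
  refine ⟨hν, ?_, hneg, fun h => ?_⟩
  · rcases lt_or_ge κ 0 with h | h
    · linarith [hneg h]
    · positivity
  · obtain ⟨N, hN, he⟩ := hκ_pos h
    exact ⟨N, hN, by rw [← he, mul_div_cancel₀ _ h.ne']⟩

end TwistedLaplacian

end

theorem theorem2p1 (κ ν : ℝ) (m : ℕ) (hν : 0 < ν)
    (hκ_nonpos : κ ≤ 0 → 0 < 2 * ν + κ)
    (hκ_pos : 0 < κ → ∃ N : ℕ, 0 < N ∧ 2 * ν / κ = N)
    -- for `κ ≥ 0` the bound on `m` is `+∞`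
    (hm : κ < 0 → (m : ℝ) < (2 * ν + κ) / (|κ| - κ)) :
    -- each of the functions is a smooth solution of the eigenvalue equation on `M_κ`
    (∀ n : ℕ, ContDiffOn ℝ ∞ (TwistedLaplacian.Psi κ ν m n) (TwistedLaplacian.surface κ) ∧
      ∀ z ∈ TwistedLaplacian.surface κ,
        TwistedLaplacian.twistedLaplacian κ ν (TwistedLaplacian.Psi κ ν m n) z
          = (TwistedLaplacian.eigenvalue κ ν m : ℂ) * TwistedLaplacian.Psi κ ν m n z) ∧
    -- which of them are square integrable: all for `κ ≤ 0`, those with `n ≤ 2(ν/κ + m)` for `κ > 0`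
    (∀ n : ℕ, MemLp (TwistedLaplacian.Psi κ ν m n) 2 (TwistedLaplacian.vol κ) ↔
      (0 < κ → (n : ℝ) ≤ 2 * (ν / κ + m))) ∧
    -- the square integrable ones are an orthogonal basis of the `L²`-eigenspace
    TwistedLaplacian.IsOrthogonalBasis
      (fun n : {n : ℕ // MemLp (TwistedLaplacian.Psi κ ν m n) 2 (TwistedLaplacian.vol κ)} =>
        MemLp.toLp (TwistedLaplacian.Psi κ ν m n.1) n.2)
      (TwistedLaplacian.eigenspace κ ν m) := by
  have hA := TwistedLaplacian.admissible_of_lt hν hκ_pos hm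
  exact ⟨fun n => ⟨TwistedLaplacian.contDiffOn_Psi κ ν m n,
    fun z hz => TwistedLaplacian.twistedLaplacian_Psi κ ν m n hz⟩,
    TwistedLaplacian.memLp_Psi_iff hA, TwistedLaplacian.isOrthogonalBasis_Psi hA⟩
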